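/- An $n$-edge-coloured multigraph is a finite loopless multigraph whose edges are coloured with colours from a set of $n$ colours. It is an $(n,v)$-multigraph ($v$ real) if, for each of the $n$ colours, the edges of that colour form a simple graph which is a disjoint union of complete graphs, each on at least two vertices, having in total at least $v$ vertices. It has edge multiplicity at most $m$ if every two vertices are joined by at most $m$ edges (of all colours together). A rainbow matching is a set of pairwise vertex-disjoint edges with distinct colours. (i) There is an absolute constant $C>0$ such that for all integers $n\ge 2$ and $m\ge 0$, every $\left(n,\,2n+2m+C\,\frac{n}{(\log n)^{1/4}}\right)$-multigraph with edge multiplicity at most $m$ contains a rainbow matching using all $n$ colours. (ii) The dependence on $m$ in (i) is asymptotically tight for $m=\varepsilon n$ with small $\varepsilon>0$: there are absolute constants $C,\varepsilon_0>0$ such that for all $0<\varepsilon\le\varepsilon_0$ and all integers $n\ge C\varepsilon^{-3}\log(1/\varepsilon)$ there is an $(n,\,2n+2\varepsilon n-C\varepsilon^2 n)$-multigraph with edge multiplicity at most $\varepsilon n$ which contains no rainbow matching using all $n$ colours. -/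

import Mathlib

universe u v

/-- A loopless multigraph with vertex set `V` and edge set `E`, whose edges are coloured with
`n` colours. Parallel edges are different elements of `E` with the same pair of endpoints. -/
structure ColouredMultigraph (V : Type u) (E : Type v) (n : ℕ) where
  ends : E → Sym2 V
  loopless : ∀ e, ¬ (ends e).IsDiag
  colour : E → Fin n

namespace ColouredMultigraph

variable {V : Type u} {E : Type v} {n : ℕ}

/-- The edges of colour `c` form a simple graph (no two of them are parallel) which is the disjoint
union of the complete graphs on the members of `P`, where `P` is a family of pairwise disjoint
vertex sets with at least two elements each. -/
def IsCliqueUnion (G : ColouredMultigraph V E n) (c : Fin n) (P : Set (Set V)) : Prop :=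
  (∀ K ∈ P, K.Nontrivial) ∧
  P.PairwiseDisjoint id ∧
  (∀ e f : E, G.colour e = c → G.colour f = c → G.ends e = G.ends f → e = f) ∧
  (∀ x y : V, (∃ e : E, G.colour e = c ∧ G.ends e = s(x, y)) ↔
    x ≠ y ∧ ∃ K ∈ P, x ∈ K ∧ y ∈ K)

/-- `G` is an `(n, N)`-multigraph: each of the `n` colour classes is a disjoint union of non-trivial
cliques that have in total at least `N` vertices. -/
def IsCliqueMultigraph (G : ColouredMultigraph V E n) (N : ℝ) : Prop :=
  ∀ c : Fin n, ∃ P : Set (Set V), G.IsCliqueUnion c P ∧ N ≤ ((⋃₀ P).ncard : ℝ)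

/-- Every pair of vertices is joined by at most `m` edges (of all colours together). -/
def MultiplicityAtMost (G : ColouredMultigraph V E n) (m : ℕ) : Prop :=
  ∀ x y : V, {e : E | G.ends e = s(x, y)}.encard ≤ m

/-- No two different edges of `M` share a vertex. -/
def IsMatching (G : ColouredMultigraph V E n) (M : Set E) : Prop :=
  ∀ e ∈ M, ∀ f ∈ M, e ≠ f → ∀ x : V, x ∈ G.ends e → x ∉ G.ends f

/-- All edges of `M` have distinct colours. -/
def IsRainbow (G : ColouredMultigraph V E n) (M : Set E) : Prop :=
  Set.InjOn G.colour M

/-- `G` contains a rainbow matching using all the `n` colours. -/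
def HasFullRainbowMatching (G : ColouredMultigraph V E n) : Prop :=
  ∃ M : Set E, G.IsMatching M ∧ G.IsRainbow M ∧ ∀ c : Fin n, ∃ e ∈ M, G.colour e = c

end ColouredMultigraph

/-! Part (i). Take a maximum rainbow matching and treat each matching edge, each unused colour and
each uncovered vertex as one token. A set of tokens frees a colour or a vertex if the matching can
be rerouted inside that set, without losing edges, so as to avoid it (`Frees`). If disjoint sets
free a colour c and a vertex d, and xd has colour c for some matching edge xy outside them, then
using xd instead of xy frees y and the colour of xy (`Frees.swap`). An edge of a freed colour
between two freed vertices contradicts maximality (`Frees.augment`).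

A web grows from the unused colours and uncovered vertices by such exchanges. Combining exchanges
requires disjoint token sets, so all sets have size and load at most A, where the load of a token is
the number of sets containing it. Moreover any two vertices of D can be uncovered together while
avoiding any B tokens outside their supports. This robustness comes from redundancy: a vertex enters
D only if its mate has two families of s links to the web that do not hinge on the same vertex, and
its support records the vertices on which they do hinge. A colour needs only one link, but new
colours use distinct colours and vertices of the web. A round of growth multiplies A by 5
(`IsWeb.extend`). As a web has at most 3n colours and covered vertices, some round among the first l
> 3n/(r+1) adds at most r of them (`exists_stalled`).

Links at such a stalled web are counted twice (`stalled_count`). In a colour c of F, almost no two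
vertices of D are adjacent, so almost all of them lie in different cliques and have distinct
neighbours outside D. A class with 2n+2m+g vertices therefore has at least about 2m+g links at
matched vertices whose edge misses D. Conversely, such a vertex has at most s² links, except that
when its edge has a colour of F one single vertex can account for m more. Only 2|F| vertices are of
that kind, so the total is about 2m|F| plus an error. The terms in m cancel, F is small, and the
matching uses all but fewer than t colours (`IsMaxRM.card_lt`).

The missing colours are added greedily inside a random reservoir, set aside beforehand, that costs
each class few vertices but contains many disjoint edges of each colour (`exists_reservoir`,
`exists_full_of_exp_le`).

Part (ii). Take k blocks of odd size 2b+1, no edge joining different blocks. A matching has at most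
b edges in a block, so kb < n excludes a full one, while the number of vertices is 2kb+k, about
2n+n/b; here b is about 1/(2ε). A colour pairs up each block by a reflection of the cycle and puts
the fixed point in a triangle. Spreading colours evenly over all centres and triangles gives
multiplicity about n/(2b), that is εn. -/

namespace RainbowClique

open Finset
open scoped Classical

universe u₁ v₁

/-! ### Rainbow matchings, tokens and exchanges. -/

section

variable {V : Type u₁} {κ : Type v₁}

/-- A rainbow matching in a family of graphs: the edge of colour `c ∈ S` joins `a c` to `b c`. -/
structure IsRM (G : κ → SimpleGraph V) (S : Finset κ) (a b : κ → V) : Prop where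
  adj : ∀ c ∈ S, (G c).Adj (a c) (b c)
  ne_aa : ∀ c ∈ S, ∀ c' ∈ S, c ≠ c' → a c ≠ a c'
  ne_ab : ∀ c ∈ S, ∀ c' ∈ S, c ≠ c' → a c ≠ b c'
  ne_bb : ∀ c ∈ S, ∀ c' ∈ S, c ≠ c' → b c ≠ b c'

/-- A rainbow matching with the largest possible number of edges. -/
structure IsMaxRM (G : κ → SimpleGraph V) (S : Finset κ) (a b : κ → V) : Prop extends
    IsRM G S a b where
  max : ∀ S' a' b', IsRM G S' a' b' → #S' ≤ #S

/-- The token of a vertex: the colour of the matching edge covering it, or the vertex itself. -/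
noncomputable def tok (S : Finset κ) (a b : κ → V) (v : V) : κ ⊕ V :=
  if h : ∃ c ∈ S, v = a c ∨ v = b c then Sum.inl h.choose else Sum.inr v

/-- The endpoints of the edge of colour `c ∈ S`, in one of the two orders. -/
def Ends (S : Finset κ) (a b : κ → V) (c : κ) (x y : V) : Prop :=
  c ∈ S ∧ ((x = a c ∧ y = b c) ∨ (x = b c ∧ y = a c))

section Tokens

variable {G : κ → SimpleGraph V} {S : Finset κ} {a b : κ → V}

lemma Ends.symm {c : κ} {x y : V} (h : Ends S a b c x y) : Ends S a b c y x := by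
  obtain ⟨h1, h2⟩ := h
  exact ⟨h1, by tauto⟩

lemma Ends.ne (hM : IsRM G S a b) {c : κ} {x y : V} (h : Ends S a b c x y) : x ≠ y := by
  obtain ⟨h1, ⟨rfl, rfl⟩ | ⟨rfl, rfl⟩⟩ := h
  · exact (hM.adj c h1).ne
  · exact (hM.adj c h1).ne'

lemma IsRM.eq_of_mem (hM : IsRM G S a b) {c c' : κ} (hc : c ∈ S) (hc' : c' ∈ S) {v : V}
    (h : v = a c ∨ v = b c) (h' : v = a c' ∨ v = b c') : c = c' := by
  by_contra hne
  rcases h with rfl | rfl <;> rcases h' with h' | h'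
  · exact hM.ne_aa c hc c' hc' hne h'
  · exact hM.ne_ab c hc c' hc' hne h'
  · exact hM.ne_ab c' hc' c hc (Ne.symm hne) h'.symm
  · exact hM.ne_bb c hc c' hc' hne h'

lemma Ends.tok_left (hM : IsRM G S a b) {c : κ} {x y : V} (h : Ends S a b c x y) :
    tok S a b x = Sum.inl c := by
  have h' : ∃ c ∈ S, x = a c ∨ x = b c := ⟨c, h.1, by have := h.2; tauto⟩
  rw [tok, dif_pos h']
  have hs := h'.choose_spec
  exact congrArg _ (hM.eq_of_mem hs.1 h.1 hs.2 (by have := h.2; tauto))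

lemma Ends.tok_right (hM : IsRM G S a b) {c : κ} {x y : V} (h : Ends S a b c x y) :
    tok S a b y = Sum.inl c := h.symm.tok_left hM

lemma tok_inl {v : V} {c : κ} (h : tok S a b v = Sum.inl c) : ∃ x, Ends S a b c x v := by
  rw [tok] at h
  split_ifs at h with h'
  have hs := h'.choose_spec
  have : h'.choose = c := Sum.inl.inj h
  rw [this] at hs
  rcases hs.2 with h2 | h2
  · exact ⟨b c, hs.1, Or.inr ⟨rfl, h2⟩⟩
  · exact ⟨a c, hs.1, Or.inl ⟨rfl, h2⟩⟩

lemma tok_inr {v w : V} (h : tok S a b v = Sum.inr w) : w = v := by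
  rw [tok] at h
  split_ifs at h
  exact (Sum.inr.inj h).symm

lemma Ends.eq_or_eq {c : κ} {x y x' y' : V} (h : Ends S a b c x y) (h' : Ends S a b c x' y') :
    (x' = x ∧ y' = y) ∨ (x' = y ∧ y' = x) := by
  obtain ⟨_, ⟨rfl, rfl⟩ | ⟨rfl, rfl⟩⟩ := h <;> obtain ⟨_, ⟨rfl, rfl⟩ | ⟨rfl, rfl⟩⟩ := h' <;> simp

lemma Ends.eq_of_tok (_hM : IsRM G S a b) {c : κ} {x y v : V} (h : Ends S a b c x y)
    (hv : tok S a b v = Sum.inl c) : v = x ∨ v = y := by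
  obtain ⟨w, hw⟩ := tok_inl hv
  rcases h.eq_or_eq hw with ⟨_, h2⟩ | ⟨_, h2⟩
  · exact Or.inr h2
  · exact Or.inl h2

lemma tok_eq_of_ne {v w : V} (h : tok S a b v = tok S a b w) (hne : v ≠ w) :
    ∃ c, Ends S a b c v w := by
  rcases hv : tok S a b v with c | z
  · obtain ⟨x, hx⟩ := tok_inl hv
    obtain ⟨y, hy⟩ := tok_inl (h ▸ hv)
    rcases hx.eq_or_eq hy with ⟨_, h2⟩ | ⟨_, h2⟩
    · exact absurd h2.symm hne
    · exact ⟨c, by rw [h2]; exact hx.symm⟩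
  · have h1 := tok_inr hv
    have h2 := tok_inr (h ▸ hv)
    exact absurd (h1.symm.trans h2) hne

/-- The tokens in `Z` can be rearranged: the colours and vertices in `Z` support a rainbow matching
with as many edges as the given one has on `Z`, and which avoids the colours in `C` and the
vertices in `Y`. -/
def Frees (G : κ → SimpleGraph V) (S : Finset κ) (a b : κ → V) (Z : Finset (κ ⊕ V))
    (C : Finset κ) (Y : Finset V) : Prop :=
  ∃ S' a' b', IsRM G S' a' b' ∧
    (∀ c ∈ S', Sum.inl c ∈ Z ∧ tok S a b (a' c) ∈ Z ∧ tok S a b (b' c) ∈ Z) ∧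
    #S' = #{c ∈ S | Sum.inl c ∈ Z} ∧
    (∀ c ∈ C, Sum.inl c ∈ Z ∧ c ∉ S') ∧
    (∀ y ∈ Y, tok S a b y ∈ Z ∧ ∀ c ∈ S', a' c ≠ y ∧ b' c ≠ y)

lemma Frees.mono {Z : Finset (κ ⊕ V)} {C C' : Finset κ} {Y Y' : Finset V}
    (h : Frees G S a b Z C Y) (hC : C' ⊆ C) (hY : Y' ⊆ Y) : Frees G S a b Z C' Y' := by
  obtain ⟨S', a', b', h1, h2, h3, h4, h5⟩ := h
  exact ⟨S', a', b', h1, h2, h3, fun c hc => h4 c (hC hc), fun y hy => h5 y (hY hy)⟩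

lemma frees_vertices {Y : Finset V} (h : ∀ y ∈ Y, tok S a b y = Sum.inr y) :
    Frees G S a b (Y.image Sum.inr) ∅ Y := by
  refine ⟨∅, a, b, ⟨by simp, by simp, by simp, by simp⟩, by simp, ?_, by simp, ?_⟩
  · symm
    simp
  · intro y hy
    rw [h y hy]
    simp [hy]

lemma frees_colour {c : κ} (h : c ∉ S) : Frees G S a b {Sum.inl c} {c} ∅ := by
  refine ⟨∅, a, b, ⟨by simp, by simp, by simp, by simp⟩, by simp, ?_, by simp, by simp⟩
  symm
  rw [card_empty, card_eq_zero, filter_eq_empty_iff]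
  intro d hd h'
  simp only [mem_singleton, Sum.inl.injEq] at h'
  exact h (h' ▸ hd)

/-- Disjoint token sets involve different colours and, since every vertex has one token, different
vertices; the two reroutings can be performed side by side. -/
lemma Frees.union {Z₁ Z₂ : Finset (κ ⊕ V)} {C₁ C₂ : Finset κ} {Y₁ Y₂ : Finset V}
    (h₁ : Frees G S a b Z₁ C₁ Y₁) (h₂ : Frees G S a b Z₂ C₂ Y₂) (hd : Disjoint Z₁ Z₂) :
    Frees G S a b (Z₁ ∪ Z₂) (C₁ ∪ C₂) (Y₁ ∪ Y₂) := by
  obtain ⟨S₁, a₁, b₁, hM₁, hZ₁, hc₁, hC₁, hY₁⟩ := h₁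
  obtain ⟨S₂, a₂, b₂, hM₂, hZ₂, hc₂, hC₂, hY₂⟩ := h₂
  rw [Finset.disjoint_left] at hd
  have hS : Disjoint S₁ S₂ := by
    rw [Finset.disjoint_left]
    exact fun c h1 h2 => hd (hZ₁ c h1).1 (hZ₂ c h2).1
  have hS' : ∀ c ∈ S₂, c ∉ S₁ := fun c h2 h1 => Finset.disjoint_left.1 hS h1 h2
  have key : ∀ v w, tok S a b v ∈ Z₁ → tok S a b w ∈ Z₂ → v ≠ w := by
    rintro v w hv hw rfl
    exact hd hv hw
  refine ⟨S₁ ∪ S₂, fun c => if c ∈ S₁ then a₁ c else a₂ c, fun c => if c ∈ S₁ then b₁ c else b₂ c,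
    ⟨?_, ?_, ?_, ?_⟩, ?_, ?_, ?_, ?_⟩
  · intro c hc
    rcases mem_union.1 hc with h | h
    · simpa [h] using hM₁.adj c h
    · simpa [hS' c h] using hM₂.adj c h
  · intro c hc c' hc' hne
    rcases mem_union.1 hc with h | h <;> rcases mem_union.1 hc' with h' | h'
    · simpa [h, h'] using hM₁.ne_aa c h c' h' hne
    · simpa [h, hS' _ h'] using key _ _ (hZ₁ c h).2.1 (hZ₂ c' h').2.1
    · simpa [hS' _ h, h'] using (key _ _ (hZ₁ c' h').2.1 (hZ₂ c h).2.1).symm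
    · simpa [hS' _ h, hS' _ h'] using hM₂.ne_aa c h c' h' hne
  · intro c hc c' hc' hne
    rcases mem_union.1 hc with h | h <;> rcases mem_union.1 hc' with h' | h'
    · simpa [h, h'] using hM₁.ne_ab c h c' h' hne
    · simpa [h, hS' _ h'] using key _ _ (hZ₁ c h).2.1 (hZ₂ c' h').2.2
    · simpa [hS' _ h, h'] using (key _ _ (hZ₁ c' h').2.2 (hZ₂ c h).2.1).symm
    · simpa [hS' _ h, hS' _ h'] using hM₂.ne_ab c h c' h' hne
  · intro c hc c' hc' hne
    rcases mem_union.1 hc with h | h <;> rcases mem_union.1 hc' with h' | h'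
    · simpa [h, h'] using hM₁.ne_bb c h c' h' hne
    · simpa [h, hS' _ h'] using key _ _ (hZ₁ c h).2.2 (hZ₂ c' h').2.2
    · simpa [hS' _ h, h'] using (key _ _ (hZ₁ c' h').2.2 (hZ₂ c h).2.2).symm
    · simpa [hS' _ h, hS' _ h'] using hM₂.ne_bb c h c' h' hne
  · intro c hc
    rcases mem_union.1 hc with h | h
    · have := hZ₁ c h
      simp only [h, if_true, mem_union]
      tauto
    · have := hZ₂ c h
      simp only [hS' c h, if_false, mem_union]
      tauto
  · rw [card_union_of_disjoint hS, hc₁, hc₂, ← card_union_of_disjoint]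
    · congr 1
      ext c
      simp only [mem_union, mem_filter]
      tauto
    · rw [Finset.disjoint_left]
      intro c h1 h2
      exact hd (mem_filter.1 h1).2 (mem_filter.1 h2).2
  · intro c hc
    rcases mem_union.1 hc with h | h
    · have h1 := hC₁ c h
      exact ⟨mem_union_left _ h1.1, fun h' => (mem_union.1 h').elim h1.2
        fun h' => hd h1.1 (hZ₂ c h').1⟩
    · have h1 := hC₂ c h
      exact ⟨mem_union_right _ h1.1, fun h' => (mem_union.1 h').elim
        (fun h' => hd (hZ₁ c h').1 h1.1) h1.2⟩
  · intro y hy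
    rcases mem_union.1 hy with h | h
    · have h1 := hY₁ y h
      refine ⟨mem_union_left _ h1.1, fun c hc => ?_⟩
      rcases mem_union.1 hc with h' | h'
      · simpa [h'] using h1.2 c h'
      · simpa [hS' c h'] using
          And.intro (key _ _ h1.1 (hZ₂ c h').2.1).symm (key _ _ h1.1 (hZ₂ c h').2.2).symm
    · have h1 := hY₂ y h
      refine ⟨mem_union_right _ h1.1, fun c hc => ?_⟩
      rcases mem_union.1 hc with h' | h'
      · simpa [h'] using
          And.intro (key _ _ (hZ₁ c h').2.1 h1.1) (key _ _ (hZ₁ c h').2.2 h1.1)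
      · simpa [hS' c h'] using h1.2 c h'

/-- Adding one edge to a rainbow matching. -/
lemma IsRM.insert_edge {S' : Finset κ} {a' b' : κ → V} (h : IsRM G S' a' b') {c : κ} (hc : c ∉ S')
    {x y : V} (hxy : (G c).Adj x y) (hx : ∀ d ∈ S', a' d ≠ x ∧ b' d ≠ x)
    (hy : ∀ d ∈ S', a' d ≠ y ∧ b' d ≠ y) :
    IsRM G (insert c S') (Function.update a' c x) (Function.update b' c y) := by
  have hne : ∀ d ∈ S', d ≠ c := fun d hd h => hc (h ▸ hd)
  refine ⟨?_, ?_, ?_, ?_⟩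
  · intro d hd
    rcases mem_insert.1 hd with rfl | h'
    · simpa using hxy
    · simpa [hne d h'] using h.adj d h'
  · intro d hd e he hde
    rcases mem_insert.1 hd with rfl | hd' <;> rcases mem_insert.1 he with rfl | he'
    · exact absurd rfl hde
    · simpa [hne e he'] using (hx e he').1.symm
    · simpa [hne d hd'] using (hx d hd').1
    · simpa [hne e he', hne d hd'] using h.ne_aa d hd' e he' hde
  · intro d hd e he hde
    rcases mem_insert.1 hd with rfl | hd' <;> rcases mem_insert.1 he with rfl | he'
    · exact absurd rfl hde
    · simpa [hne e he'] using (hx e he').2.symm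
    · simpa [hne d hd'] using (hy d hd').1
    · simpa [hne e he', hne d hd'] using h.ne_ab d hd' e he' hde
  · intro d hd e he hde
    rcases mem_insert.1 hd with rfl | hd' <;> rcases mem_insert.1 he with rfl | he'
    · exact absurd rfl hde
    · simpa [hne e he'] using (hy e he').2.symm
    · simpa [hne d hd'] using (hy d hd').2
    · simpa [hne e he', hne d hd'] using h.ne_bb d hd' e he' hde

/-- The exchange step: the edge xd of colour c takes the place of xy. The count is preserved because
c₀ joins the tokens exactly when c joins the rerouted matching. What was freed apart from c and d
stays free. -/
lemma Frees.swap (hM : IsRM G S a b) {Z : Finset (κ ⊕ V)} {C : Finset κ} {Y : Finset V}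
    (h : Frees G S a b Z C Y) {c c₀ : κ} {d x y : V} (hc : c ∈ C) (hd : d ∈ Y)
    (hxy : Ends S a b c₀ x y) (hZ : Sum.inl c₀ ∉ Z) (hadj : (G c).Adj x d) :
    Frees G S a b (insert (Sum.inl c₀) Z) (insert c₀ (C.erase c)) (insert y (Y.erase d)) := by
  obtain ⟨S', a', b', hM', hZ', hcard, hC, hY⟩ := h
  have hx := hxy.tok_left hM
  have hy := hxy.tok_right hM
  have hav : ∀ v, tok S a b v = Sum.inl c₀ → ∀ e ∈ S', a' e ≠ v ∧ b' e ≠ v := by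
    intro v hv e he
    refine ⟨?_, ?_⟩
    · rintro rfl
      exact hZ (hv ▸ (hZ' e he).2.1)
    · rintro rfl
      exact hZ (hv ▸ (hZ' e he).2.2)
  have hcS : c ∉ S' := (hC c hc).2
  have hne : ∀ e ∈ S', e ≠ c := fun d hd h => hcS (h ▸ hd)
  have hc₀ : c₀ ∉ S' := fun h => hZ (hZ' c₀ h).1
  have hcc : c₀ ≠ c := by
    rintro rfl
    exact hZ (hC _ hc).1
  refine ⟨insert c S', Function.update a' c x, Function.update b' c d,
    hM'.insert_edge hcS hadj (hav x hx) (hY d hd).2, ?_, ?_, ?_, ?_⟩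
  · intro e he
    rcases mem_insert.1 he with rfl | he
    · simp only [Function.update_self, hx, mem_insert, true_or, true_and]
      exact ⟨Or.inr (hC _ hc).1, Or.inr (hY d hd).1⟩
    · have := hZ' e he
      simp only [Function.update_of_ne (hne e he), mem_insert]
      tauto
  · rw [card_insert_of_notMem hcS, hcard]
    have : ({c ∈ S | Sum.inl c ∈ insert (Sum.inl c₀) Z} : Finset κ) =
        insert c₀ {c ∈ S | Sum.inl c ∈ Z} := by
      ext e
      simp only [mem_filter, mem_insert, Sum.inl.injEq]
      constructor
      · tauto
      · rintro (rfl | h)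
        · exact ⟨hxy.1, Or.inl rfl⟩
        · tauto
    rw [this, card_insert_of_notMem]
    simp [hZ]
  · intro e he
    rcases mem_insert.1 he with rfl | he
    · exact ⟨mem_insert_self _ _, by simp [hcc, hc₀]⟩
    · obtain ⟨h1, h2⟩ := mem_erase.1 he
      have := hC e h2
      exact ⟨mem_insert_of_mem this.1, by simp [h1, this.2]⟩
  · intro v hv
    have aux : tok S a b v ∈ insert (Sum.inl c₀) Z ∧ v ≠ x ∧ v ≠ d ∧
        ∀ e ∈ S', a' e ≠ v ∧ b' e ≠ v := by
      rcases mem_insert.1 hv with rfl | hv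
      · refine ⟨by rw [hy]; exact mem_insert_self _ _, (hxy.ne hM).symm, ?_, hav _ hy⟩
        rintro rfl
        exact hZ (hy ▸ (hY _ hd).1)
      · obtain ⟨h1, h2⟩ := mem_erase.1 hv
        refine ⟨mem_insert_of_mem (hY v h2).1, ?_, h1, (hY v h2).2⟩
        rintro rfl
        exact hZ (hx ▸ (hY _ h2).1)
    refine ⟨aux.1, fun e he => ?_⟩
    rcases mem_insert.1 he with rfl | he
    · simp only [Function.update_self]
      exact ⟨aux.2.1.symm, aux.2.2.1.symm⟩
    · simp only [Function.update_of_ne (hne e he)]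
      exact aux.2.2.2 e he

/-- The rerouted matching and the new edge inside Z, together with the original edges outside Z,
have one edge more than a maximum matching. -/
lemma Frees.augment (hM : IsMaxRM G S a b) {Z : Finset (κ ⊕ V)} {C : Finset κ} {Y : Finset V}
    (h : Frees G S a b Z C Y) {c : κ} {x y : V} (hc : c ∈ C) (hx : x ∈ Y) (hy : y ∈ Y)
    (hadj : (G c).Adj x y) : False := by
  obtain ⟨S', a', b', hM', hZ', hcard, hC, hY⟩ := h
  have h1 := hM'.insert_edge (hC c hc).2 hadj (hY x hx).2 (hY y hy).2
  set S₁ := insert c S' with hS₁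
  set a₁ := Function.update a' c x
  set b₁ := Function.update b' c y
  set S₂ : Finset κ := {c ∈ S | Sum.inl c ∉ Z} with hS₂
  have hZ₁ : ∀ e ∈ S₁, Sum.inl e ∈ Z ∧ tok S a b (a₁ e) ∈ Z ∧ tok S a b (b₁ e) ∈ Z := by
    intro e he
    rcases mem_insert.1 he with rfl | he
    · simp only [a₁, b₁, Function.update_self]
      exact ⟨(hC _ hc).1, (hY x hx).1, (hY y hy).1⟩
    · have hne : e ≠ c := fun h => (hC c hc).2 (h ▸ he)
      simp only [a₁, b₁, Function.update_of_ne hne]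
      exact hZ' e he
  have hS2 : ∀ e ∈ S₂, e ∈ S ∧ Sum.inl e ∉ Z := fun e he => mem_filter.1 he
  have hn : ∀ e ∈ S₂, e ∉ S₁ := fun e he h => (hS2 e he).2 (hZ₁ e h).1
  have hta : ∀ e ∈ S₂, tok S a b (a e) ∉ Z := fun e he => by
    rw [Ends.tok_left hM.toIsRM (show Ends S a b e (a e) (b e) from
      ⟨(hS2 e he).1, Or.inl ⟨rfl, rfl⟩⟩)]
    exact (hS2 e he).2
  have htb : ∀ e ∈ S₂, tok S a b (b e) ∉ Z := fun e he => by
    rw [Ends.tok_right hM.toIsRM (show Ends S a b e (a e) (b e) from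
      ⟨(hS2 e he).1, Or.inl ⟨rfl, rfl⟩⟩)]
    exact (hS2 e he).2
  have key : ∀ v w, tok S a b v ∈ Z → tok S a b w ∉ Z → v ≠ w := by
    rintro v w hv hw rfl
    exact hw hv
  have hbig : IsRM G (S₁ ∪ S₂) (fun e => if e ∈ S₁ then a₁ e else a e)
      (fun e => if e ∈ S₁ then b₁ e else b e) := by
    refine ⟨?_, ?_, ?_, ?_⟩
    · intro e he
      rcases mem_union.1 he with h | h
      · simpa [h] using h1.adj e h
      · simpa [hn e h] using hM.adj e (hS2 e h).1
    · intro e he e' he' hne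
      rcases mem_union.1 he with h | h <;> rcases mem_union.1 he' with h' | h'
      · simpa [h, h'] using h1.ne_aa e h e' h' hne
      · simpa [h, hn _ h'] using key _ _ (hZ₁ e h).2.1 (hta e' h')
      · simpa [hn _ h, h'] using (key _ _ (hZ₁ e' h').2.1 (hta e h)).symm
      · simpa [hn _ h, hn _ h'] using hM.ne_aa e (hS2 e h).1 e' (hS2 e' h').1 hne
    · intro e he e' he' hne
      rcases mem_union.1 he with h | h <;> rcases mem_union.1 he' with h' | h'
      · simpa [h, h'] using h1.ne_ab e h e' h' hne
      · simpa [h, hn _ h'] using key _ _ (hZ₁ e h).2.1 (htb e' h')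
      · simpa [hn _ h, h'] using (key _ _ (hZ₁ e' h').2.2 (hta e h)).symm
      · simpa [hn _ h, hn _ h'] using hM.ne_ab e (hS2 e h).1 e' (hS2 e' h').1 hne
    · intro e he e' he' hne
      rcases mem_union.1 he with h | h <;> rcases mem_union.1 he' with h' | h'
      · simpa [h, h'] using h1.ne_bb e h e' h' hne
      · simpa [h, hn _ h'] using key _ _ (hZ₁ e h).2.2 (htb e' h')
      · simpa [hn _ h, h'] using (key _ _ (hZ₁ e' h').2.2 (htb e h)).symm
      · simpa [hn _ h, hn _ h'] using hM.ne_bb e (hS2 e h).1 e' (hS2 e' h').1 hne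
  have hle := hM.max _ _ _ hbig
  rw [card_union_of_disjoint (Finset.disjoint_left.2 fun e h1 h2 => hn e h2 h1), hS₁,
    card_insert_of_notMem (hC c hc).2, hcard, hS₂] at hle
  have := card_filter_add_card_filter_not (s := S) (fun c => (Sum.inl c : κ ⊕ V) ∈ Z)
  omega

end Tokens

/-! ### Webs and the configurations that maximality forbids. -/

/-- The data of a web: the set `D` of vertices which can be uncovered, the set `F` of colours which
can be freed, for each such colour a set `T` of tokens which can be used for freeing it, and for
each vertex of `D` its support `sup`. -/
structure WebData (κ : Type v₁) (V : Type u₁) where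
  D : Finset V
  F : Finset κ
  T : κ → Finset (κ ⊕ V)
  sup : V → Finset (κ ⊕ V)

/-- The tokens which are used for uncovering the vertex `d`. -/
noncomputable def WebData.Q (S : Finset κ) (a b : κ → V) (W : WebData κ V) (d : V) :
    Finset (κ ⊕ V) :=
  Sum.elim W.T (fun v => {Sum.inr v}) (tok S a b d)

/-- The support of an optional vertex. -/
def WebData.supO (W : WebData κ V) (o : Option V) : Finset (κ ⊕ V) :=
  o.elim ∅ W.sup

/-- The colour `c` can be used for joining `x` to the vertex `d` of the web. -/
structure Link (G : κ → SimpleGraph V) (S : Finset κ) (a b : κ → V) (W : WebData κ V)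
    (x : V) (c : κ) (d : V) : Prop where
  mem_F : c ∈ W.F
  mem_D : d ∈ W.D
  adj : (G c).Adj x d
  disj_sup : Disjoint (W.T c) (W.sup d)
  disj_Q : Disjoint (W.T c) (W.Q S a b d)

/-- There are `s` links at `x` of distinct colours, either all to the same vertex `d`, or to
distinct vertices. -/
def Fam (G : κ → SimpleGraph V) (S : Finset κ) (a b : κ → V) (s : ℕ) (W : WebData κ V)
    (F' : Finset κ) (D' : Finset V) (x : V) : Option V → Prop
  | some d => d ∈ D' ∧ s ≤ #{c ∈ F' | Link G S a b W x c d}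
  | none => ∃ Γ : Finset (κ × V), s ≤ #Γ ∧ Set.InjOn Prod.fst (Γ : Set (κ × V)) ∧
      Set.InjOn Prod.snd (Γ : Set (κ × V)) ∧
      ∀ p ∈ Γ, p.1 ∈ F' ∧ p.2 ∈ D' ∧ Link G S a b W x p.1 p.2

/-- There are two families of links at `x` which do not use the same single vertex. -/
def Fam2 (G : κ → SimpleGraph V) (S : Finset κ) (a b : κ → V) (s : ℕ) (W : WebData κ V)
    (F' : Finset κ) (D' : Finset V) (x : V) (o₁ o₂ : Option V) : Prop :=
  Fam G S a b s W F' D' x o₁ ∧ Fam G S a b s W F' D' x o₂ ∧ ∀ d, o₁ = some d → o₂ ≠ some d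

/-- The properties of a web; `A` bounds the sizes and loads of the sets of tokens, and `B` is the
number of tokens which can be avoided when uncovering two vertices. -/
structure IsWeb (G : κ → SimpleGraph V) (S : Finset κ) (a b : κ → V) (A B s : ℕ)
    (W : WebData κ V) : Prop where
  mem_D : ∀ v, tok S a b v = Sum.inr v → v ∈ W.D
  mem_F : ∀ c, c ∉ S → c ∈ W.F
  frees_T : ∀ c ∈ W.F, Frees G S a b (W.T c) {c} ∅
  head : ∀ c ∈ W.F, c ∈ S → ∃ x y, Ends S a b c x y ∧ Frees G S a b (W.T c) ∅ {y} ∧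
    ∃ o, Fam G S a b s W W.F W.D x o
  tail : ∀ y ∈ W.D, ∀ c, tok S a b y = Sum.inl c → c ∈ W.F ∧ Frees G S a b (W.T c) ∅ {y}
  mate : ∀ c x y, Ends S a b c x y → x ∈ W.D → y ∉ W.D
  T_inl : ∀ c ∈ W.F, ∀ c', Sum.inl c' ∈ W.T c → c' ∈ W.F
  sup_tok : ∀ d ∈ W.D, ∀ z ∈ W.sup d, ∃ d' ∈ W.D, tok S a b d' = z
  tok_sup : ∀ d ∈ W.D, tok S a b d ∈ W.sup d
  card_T : ∀ c ∈ W.F, #(W.T c) ≤ A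
  card_sup : ∀ d ∈ W.D, #(W.sup d) ≤ A
  load_T : ∀ z, #{c ∈ W.F | z ∈ W.T c} ≤ A
  load_sup : ∀ z, #{d ∈ W.D | z ∈ W.sup d} ≤ A
  pair : ∀ y ∈ W.D, ∀ w ∈ W.D, y ≠ w → ∀ X : Finset (κ ⊕ V), #X ≤ B → Disjoint X (W.sup y) →
    Disjoint X (W.sup w) → ∃ Z, Frees G S a b Z ∅ {y, w} ∧ Disjoint X Z

section Web

variable {G : κ → SimpleGraph V} {S : Finset κ} {a b : κ → V} {A B s : ℕ} {W : WebData κ V}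
  {F' : Finset κ} {D' : Finset V}

lemma Fam.mono {F'' : Finset κ} {D'' : Finset V} {x : V} {o : Option V}
    (h : Fam G S a b s W F' D' x o) (hF : F' ⊆ F'') (hD : D' ⊆ D'') :
    Fam G S a b s W F'' D'' x o := by
  cases o with
  | some d =>
    exact ⟨hD h.1, h.2.trans (card_le_card (filter_subset_filter _ hF))⟩
  | none =>
    obtain ⟨Γ, h1, h2, h3, h4⟩ := h
    exact ⟨Γ, h1, h2, h3, fun p hp => ⟨hF (h4 p hp).1, hD (h4 p hp).2.1, (h4 p hp).2.2⟩⟩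

lemma Fam2.mono {F'' : Finset κ} {D'' : Finset V} {x : V} {o₁ o₂ : Option V}
    (h : Fam2 G S a b s W F' D' x o₁ o₂) (hF : F' ⊆ F'') (hD : D' ⊆ D'') :
    Fam2 G S a b s W F'' D'' x o₁ o₂ :=
  ⟨h.1.mono hF hD, h.2.1.mono hF hD, h.2.2⟩

/-- One of two families avoids a given single vertex. -/
lemma Fam2.exists_ne {x : V} {o₁ o₂ : Option V} (h : Fam2 G S a b s W F' D' x o₁ o₂)
    (o' : Option V) : ∃ o, (o = o₁ ∨ o = o₂) ∧ Fam G S a b s W F' D' x o ∧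
      ∀ d, o' = some d → o ≠ some d := by
  by_cases h' : ∃ d, o' = some d ∧ o₁ = some d
  · obtain ⟨d, rfl, h1⟩ := h'
    refine ⟨o₂, Or.inr rfl, h.2.1, ?_⟩
    intro e he
    cases he
    exact h.2.2 d h1
  · push Not at h'
    exact ⟨o₁, Or.inl rfl, h.1, h'⟩

/-- Union bound over the tokens of X, each of load at most A. -/
lemma card_hit_le {α : Type*} {I : Finset α} {f : α → Finset (κ ⊕ V)} {X : Finset (κ ⊕ V)} {A : ℕ}
    (h : ∀ z, #{i ∈ I | z ∈ f i} ≤ A) : #{i ∈ I | ¬ Disjoint (f i) X} ≤ A * #X := by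
  have hsub : {i ∈ I | ¬ Disjoint (f i) X} ⊆ X.biUnion fun z => {i ∈ I | z ∈ f i} := by
    intro i hi
    obtain ⟨h1, h2⟩ := mem_filter.1 hi
    obtain ⟨z, hz, hz'⟩ := Finset.not_disjoint_iff.1 h2
    exact mem_biUnion.2 ⟨z, hz', mem_filter.2 ⟨h1, hz⟩⟩
  calc _ ≤ _ := card_le_card hsub
    _ ≤ #X * A := card_biUnion_le_card_mul _ _ _ fun z _ => h z
    _ = _ := mul_comm _ _

/-- A family of links contains one which avoids given small sets of tokens. -/
lemma IsWeb.select (hW : IsWeb G S a b A B s W) {x w : V} {o : Option V}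
    (h : Fam G S a b s W F' D' x o) (hF : F' ⊆ W.F) (hD : D' ⊆ W.D) (ho : o ≠ some w)
    {X₁ X₂ : Finset (κ ⊕ V)} (hX : Disjoint X₁ (W.supO o)) (hs : A * (#X₁ + #X₂) + 1 < s) :
    ∃ c ∈ F', ∃ d ∈ D', Link G S a b W x c d ∧ d ≠ w ∧ Disjoint (W.T c) X₂ ∧
      Disjoint (W.sup d) X₁ := by
  have hC := card_hit_le (I := W.F) (f := W.T) (X := X₂) hW.load_T
  have hV := card_hit_le (I := W.D) (f := W.sup) (X := X₁) hW.load_sup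
  rw [mul_add] at hs
  cases o with
  | some d =>
    obtain ⟨h1, h2⟩ := h
    obtain ⟨c, hc, hc'⟩ := exists_mem_notMem_of_card_lt_card
      (lt_of_lt_of_le (show #{c ∈ W.F | ¬ Disjoint (W.T c) X₂} < s by omega) h2)
    obtain ⟨hc1, hc2⟩ := mem_filter.1 hc
    refine ⟨c, hc1, d, h1, hc2, fun h => ho (by rw [h]), ?_, hX.symm⟩
    by_contra h3
    exact hc' (mem_filter.2 ⟨hF hc1, h3⟩)
  | none =>
    obtain ⟨Γ, h1, h2, h3, h4⟩ := h
    have e1 : #{p ∈ Γ | ¬ Disjoint (W.T p.1) X₂} ≤ A * #X₂ := by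
      refine le_trans (card_le_card_of_injOn Prod.fst ?_ ?_) hC
      · intro p hp
        simp only [coe_filter, Set.mem_ofPred_eq] at hp ⊢
        exact ⟨hF (h4 p hp.1).1, hp.2⟩
      · exact h2.mono fun p hp => (mem_filter.1 hp).1
    have e2 : #{p ∈ Γ | ¬ Disjoint (W.sup p.2) X₁} ≤ A * #X₁ := by
      refine le_trans (card_le_card_of_injOn Prod.snd ?_ ?_) hV
      · intro p hp
        simp only [coe_filter, Set.mem_ofPred_eq] at hp ⊢
        exact ⟨hD (h4 p hp.1).2.1, hp.2⟩
      · exact h3.mono fun p hp => (mem_filter.1 hp).1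
    -- This is the extra 1 in the lower bound on s: distinct second entries leave at most one link
    -- to w.
    have e3 : #{p ∈ Γ | p.2 = w} ≤ 1 := by
      rw [← card_singleton w]
      refine card_le_card_of_injOn Prod.snd ?_ ?_
      · intro p hp
        simpa using (mem_filter.1 hp).2
      · exact h3.mono fun p hp => (mem_filter.1 hp).1
    have e4 := card_union_le ({p ∈ Γ | ¬ Disjoint (W.T p.1) X₂} ∪
      {p ∈ Γ | ¬ Disjoint (W.sup p.2) X₁}) {p ∈ Γ | p.2 = w}
    have e5 := card_union_le {p ∈ Γ | ¬ Disjoint (W.T p.1) X₂}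
      {p ∈ Γ | ¬ Disjoint (W.sup p.2) X₁}
    obtain ⟨p, hp, hp'⟩ := exists_mem_notMem_of_card_lt_card (s := ({p ∈ Γ |
      ¬ Disjoint (W.T p.1) X₂} ∪ {p ∈ Γ | ¬ Disjoint (W.sup p.2) X₁}) ∪ {p ∈ Γ | p.2 = w})
      (t := Γ) (by omega)
    simp only [mem_union, mem_filter, hp, true_and, not_or, not_not] at hp'
    exact ⟨p.1, (h4 p hp).1, p.2, (h4 p hp).2.1, (h4 p hp).2.2, hp'.2, hp'.1.1, hp'.1.2⟩

/-- In a maximum rainbow matching, there is no edge of a free colour joining two vertices of the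
web, unless the supports interfere. -/
lemma IsWeb.not_adj (hM : IsMaxRM G S a b) (hW : IsWeb G S a b A B s W) (hAB : A ≤ B) {c : κ}
    {y w : V} (hc : c ∈ W.F) (hy : y ∈ W.D) (hw : w ∈ W.D) (hTy : Disjoint (W.T c) (W.sup y))
    (hTw : Disjoint (W.T c) (W.sup w)) : ¬ (G c).Adj y w := by
  intro hadj
  obtain ⟨Z, hZ, hd⟩ := hW.pair y hy w hw hadj.ne (W.T c) ((hW.card_T c hc).trans hAB) hTy hTw
  exact ((hW.frees_T c hc).union hZ hd).augment hM (c := c) (x := y) (y := w) (by simp) (by simp)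
    (by simp) hadj

/-- Among many links from x some has `W.T c` disjoint from `W.sup x`; it would be an edge of a free
colour inside D, against `IsWeb.not_adj`. -/
lemma IsWeb.not_fam (hM : IsMaxRM G S a b) (hW : IsWeb G S a b A B s W) (hAB : A ≤ B)
    (hs : A * A + 1 < s) {x : V} (hx : x ∈ W.D) {o : Option V} :
    ¬ Fam G S a b s W W.F W.D x o := by
  intro h
  by_cases ho : o = some x
  · subst ho
    obtain ⟨h1, h2⟩ := h
    obtain ⟨c, hc⟩ : ({c ∈ W.F | Link G S a b W x c x}).Nonempty := by
      rw [← card_pos]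
      omega
    exact (mem_filter.1 hc).2.adj.ne rfl
  · have := Nat.mul_le_mul_left A (hW.card_sup x hx)
    obtain ⟨c, hc, d, hd, hl, -, h2, -⟩ := hW.select h subset_rfl subset_rfl ho
      (X₁ := ∅) (X₂ := W.sup x) (by simp) (by simp; omega)
    exact hW.not_adj hM hAB hc hx hd h2 hl.disj_sup hl.adj

lemma IsWeb.card_supO (hW : IsWeb G S a b A B s W) {x : V} {o : Option V}
    (h : Fam G S a b s W F' D' x o) (hD : D' ⊆ W.D) : #(W.supO o) ≤ A := by
  cases o with
  | some d => exact hW.card_sup d (hD h.1)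
  | none => simp [WebData.supO]

lemma IsWeb.supO_tok (hW : IsWeb G S a b A B s W) {x : V} {o : Option V}
    (h : Fam G S a b s W F' D' x o) (hD : D' ⊆ W.D) :
    ∀ z ∈ W.supO o, ∃ d' ∈ W.D, tok S a b d' = z := by
  cases o with
  | some d => exact hW.sup_tok d (hD h.1)
  | none => simp [WebData.supO]

/-- Supports consist of tokens of vertices of D, and x and y are the only vertices whose token is c.
-/
lemma IsWeb.inl_notMem_sup (hM : IsRM G S a b) (hW : IsWeb G S a b A B s W) {c : κ} {x y d : V}
    (h : Ends S a b c x y) (hx : x ∉ W.D) (hy : y ∉ W.D) (hd : d ∈ W.D) :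
    Sum.inl c ∉ W.sup d := by
  intro hmem
  obtain ⟨d', hd', htok⟩ := hW.sup_tok d hd _ hmem
  rcases h.eq_of_tok hM htok with rfl | rfl
  · exact hx hd'
  · exact hy hd'

/-- The two ends of a matching edge cannot both have enough links, if one of them has two families
of links. -/
lemma IsWeb.not_fam_fam2 (hM : IsMaxRM G S a b) (hW : IsWeb G S a b A B s W)
    (hAB : 2 * A + 1 ≤ B) (hs : A * (3 * A + 3) + 1 < s) {c₀ : κ} {x y : V}
    (h : Ends S a b c₀ x y) {o o₁ o₂ : Option V} (hx : Fam G S a b s W W.F W.D x o)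
    (hy : Fam2 G S a b s W W.F W.D y o₁ o₂) : False := by
  have hAA : A * A ≤ A * (3 * A + 3) := Nat.mul_le_mul_left A (by omega)
  have hxD : x ∉ W.D := fun hxD => hW.not_fam hM (by omega) (by omega) hxD hx
  have hyD : y ∉ W.D := fun hyD => hW.not_fam hM (by omega) (by omega) hyD hy.1
  have hsup : ∀ d ∈ W.D, Sum.inl c₀ ∉ W.sup d := fun d hd =>
    hW.inl_notMem_sup hM.toIsRM h hxD hyD hd
  obtain ⟨o', -, hy', ho'⟩ := hy.exists_ne o
  have hsupO : Sum.inl c₀ ∉ W.supO o' := by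
    cases o' with
    | some d => exact hsup d hy'.1
    | none => simp [WebData.supO]
  have hsupx : Sum.inl c₀ ∉ W.supO o := by
    cases o with
    | some d => exact hsup d hx.1
    | none => simp [WebData.supO]
  have hcard := hW.card_supO hy' subset_rfl
  -- Keeping d₁ away from w ensures `o' ≠ some d₁`, so that the second link can end elsewhere. If o'
  -- is `none`, any w with `o ≠ some w` serves.
  obtain ⟨w, how, hw⟩ : ∃ w, o ≠ some w ∧ ∀ d, o' = some d → d = w := by
    cases o' with
    | some d => exact ⟨d, fun h => ho' d h rfl, fun e he => (Option.some.inj he).symm⟩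
    | none =>
      by_cases hxo : o = some x
      · exact ⟨y, by rw [hxo]; exact fun h' => h.ne hM.toIsRM (Option.some.inj h'), by simp⟩
      · exact ⟨x, hxo, by simp⟩
  have c1 : #({Sum.inl c₀} : Finset (κ ⊕ V)) = 1 := card_singleton _
  have c2 := card_union_le {Sum.inl c₀} (W.supO o')
  -- `W.T c₁` must miss `W.supO o'`; otherwise the single vertex of o' could not be uncovered while
  -- c₁ is being freed.
  obtain ⟨c₁, hc₁, d₁, hd₁, hl₁, hdw, hT₁, -⟩ := hW.select hx subset_rfl subset_rfl how
    (X₁ := {Sum.inl c₀}) (X₂ := {Sum.inl c₀} ∪ W.supO o') (by simpa using hsupx)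
    (lt_of_le_of_lt (Nat.add_le_add_right (Nat.mul_le_mul_left A
      (show _ ≤ 3 * A + 3 by omega)) 1) hs)
  rw [disjoint_union_right] at hT₁
  have c3 := card_union_le {Sum.inl c₀} (W.T c₁)
  have c4 := card_union_le ({Sum.inl c₀} ∪ W.T c₁) (W.sup d₁)
  have c5 := hW.card_T c₁ hc₁
  have c6 := hW.card_sup d₁ hd₁
  obtain ⟨c₂, hc₂, d₂, hd₂, hl₂, hne, hT₂, hS₂⟩ := hW.select hy' subset_rfl subset_rfl (w := d₁)
    (by intro h'; exact hdw (hw _ h'))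
    (X₁ := {Sum.inl c₀} ∪ W.T c₁) (X₂ := {Sum.inl c₀} ∪ W.T c₁ ∪ W.sup d₁)
    (by rw [disjoint_union_left]; exact ⟨by simpa using hsupO, hT₁.2⟩)
    (lt_of_le_of_lt (Nat.add_le_add_right (Nat.mul_le_mul_left A
      (show _ ≤ 3 * A + 3 by omega)) 1) hs)
  rw [disjoint_union_right, disjoint_union_right] at hT₂
  rw [disjoint_union_right] at hS₂
  have c7 := card_union_le ({Sum.inl c₀} ∪ W.T c₁) (W.T c₂)
  have c8 := hW.card_T c₂ hc₂
  -- The tokens to avoid number at most 2A + 1, whence the bound on B.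
  obtain ⟨Z, hZ, hd⟩ := hW.pair d₁ hd₁ d₂ hd₂ hne.symm ({Sum.inl c₀} ∪ W.T c₁ ∪ W.T c₂)
    (by omega)
    (by
      rw [disjoint_union_left, disjoint_union_left]
      exact ⟨⟨by simpa using hsup d₁ hd₁, hl₁.disj_sup⟩, hT₂.2⟩)
    (by
      rw [disjoint_union_left, disjoint_union_left]
      exact ⟨⟨by simpa using hsup d₂ hd₂, hS₂.2.symm⟩, hl₂.disj_sup⟩)
  rw [disjoint_union_left, disjoint_union_left] at hd
  have f1 := ((hW.frees_T c₁ hc₁).union (hW.frees_T c₂ hc₂) hT₂.1.2.symm).union hZ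
    (by rw [disjoint_union_left]; exact ⟨hd.1.2, hd.2⟩)
  have hcc : c₁ ≠ c₂ := by
    rintro rfl
    obtain ⟨_, _, _, _, _, _, hC, _⟩ := hW.frees_T c₁ hc₁
    exact Finset.disjoint_left.1 hT₂.1.2 (hC c₁ (by simp)).1 (hC c₁ (by simp)).1
  -- The edge xd₁ of colour c₁ replaces xy, which uncovers y; then yd₂ of colour c₂ augments the
  -- matching.
  have f2 := f1.swap hM.toIsRM (c := c₁) (d := d₁) (by simp) (by simp) h
    (by
      simp only [mem_union, not_or]
      refine ⟨⟨?_, ?_⟩, ?_⟩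
      · simpa using hT₁.1
      · simpa using hT₂.1.1
      · simpa using hd.1.1) hl₁.adj
  exact f2.augment hM (c := c₂) (x := y) (y := d₂) (by simp [hcc.symm]) (by simp)
    (by simp [hne]) hl₂.adj

end Web

/-! ### One round of growth of a web. -/

section Extend

variable {G : κ → SimpleGraph V} {S : Finset κ} {a b : κ → V} {A B s : ℕ} {W : WebData κ V}
  {F' : Finset κ} {D' : Finset V}

lemma IsWeb.frees_Q (hW : IsWeb G S a b A B s W) {d : V} (hd : d ∈ W.D) :
    Frees G S a b (W.Q S a b d) ∅ {d} := by
  rcases h : tok S a b d with c | v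
  · simpa [WebData.Q, h] using (hW.tail d hd c h).2
  · obtain rfl := tok_inr h
    simpa [WebData.Q, h] using frees_vertices (G := G) (S := S) (a := a) (b := b) (Y := {v})
      (by simpa using h)

lemma IsWeb.Q_inl (hW : IsWeb G S a b A B s W) {d : V} (hd : d ∈ W.D) {c : κ}
    (hc : Sum.inl c ∈ W.Q S a b d) : c ∈ W.F := by
  rcases h : tok S a b d with c' | v
  · simp only [WebData.Q, h, Sum.elim_inl] at hc
    exact hW.T_inl c' (hW.tail d hd c' h).1 c hc
  · simp [WebData.Q, h] at hc

lemma IsWeb.card_Q (hW : IsWeb G S a b A B s W) (hA : 1 ≤ A) {d : V} (hd : d ∈ W.D) :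
    #(W.Q S a b d) ≤ A := by
  rcases h : tok S a b d with c' | v
  · simp only [WebData.Q, h, Sum.elim_inl]
    exact hW.card_T c' (hW.tail d hd c' h).1
  · simpa [WebData.Q, h] using hA

/-- Equal tokens of distinct vertices mean the two ends of one matching edge, which `mate` excludes.
-/
lemma IsWeb.tok_injOn (hW : IsWeb G S a b A B s W) : Set.InjOn (tok S a b) (W.D : Set V) := by
  intro d hd d' hd' h
  by_contra hne
  obtain ⟨c, hc⟩ := tok_eq_of_ne h hne
  exact hW.mate c d d' hc hd hd'

lemma IsWeb.load_Q (hW : IsWeb G S a b A B s W) (z : κ ⊕ V) :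
    #{d ∈ W.D | z ∈ W.Q S a b d} ≤ A + 1 := by
  have hsub : {d ∈ W.D | z ∈ W.Q S a b d} ⊆
      {d ∈ W.D | ∃ c, tok S a b d = Sum.inl c ∧ z ∈ W.T c} ∪ {d ∈ W.D | z = Sum.inr d} := by
    intro d hd
    obtain ⟨h1, h2⟩ := mem_filter.1 hd
    rw [mem_union, mem_filter, mem_filter]
    rcases h : tok S a b d with c | v
    · simp only [WebData.Q, h, Sum.elim_inl] at h2
      exact Or.inl ⟨h1, c, rfl, h2⟩
    · obtain rfl := tok_inr h
      simp only [WebData.Q, h, Sum.elim_inr, mem_singleton] at h2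
      exact Or.inr ⟨h1, h2⟩
  refine (card_le_card hsub).trans ((card_union_le _ _).trans (Nat.add_le_add ?_ ?_))
  · refine le_trans ?_ (hW.load_T z)
    rw [← card_image_of_injective _ (Sum.inl_injective (α := κ) (β := V))]
    refine card_le_card_of_injOn (tok S a b) ?_
      (hW.tok_injOn.mono fun d hd => (mem_filter.1 hd).1)
    intro d hd
    obtain ⟨h1, c, h2, h3⟩ := mem_filter.1 hd
    rw [h2]
    exact mem_coe.2 (mem_image_of_mem _ (mem_filter.2 ⟨(hW.tail d h1 c h2).1, h3⟩))
  · rw [card_le_one]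
    intro d hd d' hd'
    exact Sum.inr_injective ((mem_filter.1 hd).2.symm.trans (mem_filter.1 hd').2)

/-- New colours which can be freed, each by a link to the web; no two of them use the same colour or
the same vertex of the web. -/
structure FStep (G : κ → SimpleGraph V) (S : Finset κ) (a b : κ → V) (s : ℕ) (W : WebData κ V)
    (N : Finset κ) (p : κ → κ) (q : κ → V) : Prop where
  notMem : ∀ c ∈ N, c ∉ W.F
  link : ∀ c ∈ N, ∃ x y o, Ends S a b c x y ∧ Fam G S a b s W W.F W.D x o ∧
    Link G S a b W x (p c) (q c)
  inj_p : Set.InjOn p (N : Set κ)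
  inj_q : Set.InjOn q (N : Set κ)

/-- New vertices which can be uncovered in two ways. -/
structure DStep (G : κ → SimpleGraph V) (S : Finset κ) (a b : κ → V) (s : ℕ) (W : WebData κ V)
    (N : Finset V) (o₁ o₂ : V → Option V) : Prop where
  notMem : ∀ y ∈ N, y ∉ W.D
  fam : ∀ y ∈ N, ∃ c x, Ends S a b c x y ∧ c ∈ W.F ∧ Fam2 G S a b s W W.F W.D x (o₁ y) (o₂ y)
  inj₁ : ∀ y ∈ N, ∀ y' ∈ N, ∀ d, o₁ y = some d → o₁ y' = some d → y = y'
  inj₂ : ∀ y ∈ N, ∀ y' ∈ N, ∀ d, o₂ y = some d → o₂ y' = some d → y = y'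

/-- The web enlarged by new colours and new vertices. -/
noncomputable def WebData.extend (S : Finset κ) (a b : κ → V) (W : WebData κ V) (N : Finset κ)
    (p : κ → κ) (q : κ → V) (N' : Finset V) (o₁ o₂ : V → Option V) : WebData κ V where
  D := W.D ∪ N'
  F := W.F ∪ N
  T c := if c ∈ W.F then W.T c else insert (Sum.inl c) (W.T (p c) ∪ W.Q S a b (q c))
  sup d := if d ∈ W.D then W.sup d else insert (tok S a b d) (W.supO (o₁ d) ∪ W.supO (o₂ d))

variable {N : Finset κ} {p : κ → κ} {q : κ → V} {N' : Finset V} {o₁ o₂ : V → Option V}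

lemma extend_T {c : κ} (h : c ∈ W.F) : (W.extend S a b N p q N' o₁ o₂).T c = W.T c := if_pos h

lemma extend_T_new {c : κ} (h : c ∉ W.F) : (W.extend S a b N p q N' o₁ o₂).T c =
    insert (Sum.inl c) (W.T (p c) ∪ W.Q S a b (q c)) := if_neg h

lemma extend_sup {d : V} (h : d ∈ W.D) : (W.extend S a b N p q N' o₁ o₂).sup d = W.sup d :=
  if_pos h

lemma extend_sup_new {d : V} (h : d ∉ W.D) : (W.extend S a b N p q N' o₁ o₂).sup d =
    insert (tok S a b d) (W.supO (o₁ d) ∪ W.supO (o₂ d)) := if_neg h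

lemma IsWeb.extend_Q (hW : IsWeb G S a b A B s W) {d : V} (h : d ∈ W.D) :
    (W.extend S a b N p q N' o₁ o₂).Q S a b d = W.Q S a b d := by
  rcases h' : tok S a b d with c | v
  · simp only [WebData.Q, h', Sum.elim_inl]
    exact extend_T (hW.tail d h c h').1
  · simp [WebData.Q, h']

lemma IsWeb.link_extend (hW : IsWeb G S a b A B s W) {x : V} {c : κ} {d : V}
    (h : Link G S a b W x c d) : Link G S a b (W.extend S a b N p q N' o₁ o₂) x c d := by
  refine ⟨mem_union_left _ h.mem_F, mem_union_left _ h.mem_D, h.adj, ?_, ?_⟩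
  · rw [extend_T h.mem_F, extend_sup h.mem_D]
    exact h.disj_sup
  · rw [extend_T h.mem_F, hW.extend_Q h.mem_D]
    exact h.disj_Q

lemma IsWeb.fam_extend (hW : IsWeb G S a b A B s W) {x : V} {o : Option V}
    (h : Fam G S a b s W W.F W.D x o) :
    Fam G S a b s (W.extend S a b N p q N' o₁ o₂) (W.extend S a b N p q N' o₁ o₂).F
      (W.extend S a b N p q N' o₁ o₂).D x o := by
  refine Fam.mono (F' := W.F) (D' := W.D) ?_ subset_union_left subset_union_left
  cases o with
  | some d =>
    refine ⟨h.1, h.2.trans (card_le_card fun c hc => ?_)⟩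
    obtain ⟨h1, h2⟩ := mem_filter.1 hc
    exact mem_filter.2 ⟨h1, hW.link_extend h2⟩
  | none =>
    obtain ⟨Γ, h1, h2, h3, h4⟩ := h
    exact ⟨Γ, h1, h2, h3, fun p hp => ⟨(h4 p hp).1, (h4 p hp).2.1, hW.link_extend (h4 p hp).2.2⟩⟩

/-- The exchange needs the token of c outside both sets used. By `T_inl` these contain only colours
of F, and c is not one. -/
lemma IsWeb.frees_new (hM : IsRM G S a b) (hW : IsWeb G S a b A B s W) {c c' : κ} {x y d : V}
    (hc : c ∉ W.F) (h : Ends S a b c x y) (hl : Link G S a b W x c' d) :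
    Frees G S a b (insert (Sum.inl c) (W.T c' ∪ W.Q S a b d)) {c} {y} := by
  refine (((hW.frees_T c' hl.mem_F).union (hW.frees_Q hl.mem_D) hl.disj_Q).swap hM (c := c')
    (d := d) (by simp) (by simp) h ?_ hl.adj).mono (by simp) (by simp)
  rw [mem_union, not_or]
  exact ⟨fun h => hc (hW.T_inl c' hl.mem_F c h), fun h => hc (hW.Q_inl hl.mem_D h)⟩

/-- Uncovering a new vertex `y` together with another vertex `w`. -/
lemma IsWeb.pair_step (hM : IsRM G S a b) (hW : IsWeb G S a b A B s W) {c₀ : κ} {x y w : V}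
    (hxy : Ends S a b c₀ x y) (hx : x ∉ W.D) (hy : y ∉ W.D) {o₁ o₂ : Option V}
    (hF : Fam2 G S a b s W W.F W.D x o₁ o₂) {P X : Finset (κ ⊕ V)} (hyw : y ≠ w)
    (hP : #P ≤ 3 * A) (hcP : Sum.inl c₀ ∉ P) (hXP : Disjoint X P)
    (hXy : Disjoint X (insert (Sum.inl c₀) (W.supO o₁ ∪ W.supO o₂)))
    (hs : A * (2 * #X + 3 * A + 2) + 1 < s)
    (hpair : ∀ d ∈ W.D, d ≠ w → ∀ X' : Finset (κ ⊕ V), #X' ≤ #X + A + 1 →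
      Disjoint X' (W.sup d) → Disjoint X' P → ∃ Z, Frees G S a b Z ∅ {d, w} ∧ Disjoint X' Z) :
    ∃ Z, Frees G S a b Z ∅ {y, w} ∧ Disjoint X Z := by
  -- One of the two families does not hinge on w. It cannot be predicted which, so X is required to
  -- avoid both supports.
  obtain ⟨o, ho, hfam, how⟩ := hF.exists_ne (some w)
  rw [disjoint_insert_right, disjoint_union_right] at hXy
  have hXo : Disjoint X (W.supO o) := by
    rcases ho with rfl | rfl
    · exact hXy.2.1
    · exact hXy.2.2
  have hcs : ∀ d ∈ W.D, Sum.inl c₀ ∉ W.sup d := fun d hd => hW.inl_notMem_sup hM hxy hx hy hd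
  have hco : Sum.inl c₀ ∉ W.supO o := by
    cases o with
    | some d => exact hcs d hfam.1
    | none => simp [WebData.supO]
  have k1 := card_insert_le (Sum.inl c₀) X
  have k2 := card_insert_le (Sum.inl c₀) (X ∪ P)
  have k3 := card_union_le X P
  obtain ⟨c, hc, d, hd, hl, hdw, hT, hS⟩ := hW.select hfam subset_rfl subset_rfl (how w rfl)
    (X₁ := insert (Sum.inl c₀) X) (X₂ := insert (Sum.inl c₀) (X ∪ P))
    (by rw [disjoint_insert_left]; exact ⟨hco, hXo⟩)
    (lt_of_le_of_lt (Nat.add_le_add_right (Nat.mul_le_mul_left A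
      (show _ ≤ 2 * #X + 3 * A + 2 by omega)) 1) hs)
  rw [disjoint_insert_right, disjoint_union_right] at hT
  rw [disjoint_insert_right] at hS
  have k4 := card_insert_le (Sum.inl c₀) (X ∪ W.T c)
  have k5 := card_union_le X (W.T c)
  have k6 := hW.card_T c hc
  obtain ⟨Z, hZ, hXZ⟩ := hpair d hd hdw (insert (Sum.inl c₀) (X ∪ W.T c)) (by omega)
    (by
      rw [disjoint_insert_left, disjoint_union_left]
      exact ⟨hcs d hd, hS.2.symm, hl.disj_sup⟩)
    (by
      rw [disjoint_insert_left, disjoint_union_left]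
      exact ⟨hcP, hXP, hT.2.2⟩)
  rw [disjoint_insert_left, disjoint_union_left] at hXZ
  refine ⟨insert (Sum.inl c₀) (W.T c ∪ Z), (((hW.frees_T c hc).union hZ hXZ.2.2).swap hM (c := c)
    (d := d) (by simp) (by simp) hxy ?_ hl.adj).mono (by simp) ?_, ?_⟩
  · rw [mem_union, not_or]
    exact ⟨hT.1, hXZ.1⟩
  · intro v hv
    rcases mem_insert.1 hv with rfl | hv
    · simp
    · rw [mem_singleton] at hv
      subst hv
      simp [hdw.symm]
  · rw [disjoint_insert_right, disjoint_union_right]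
    exact ⟨hXy.1, hT.2.1.symm, hXZ.2.1⟩

/-- The factor 5 absorbs the largest new bound, a load of 3A + 2. The loss of 2A + 2 in B comes from
two nested uses of `IsWeb.pair_step`, each adding one colour and one set of at most A tokens to
those to be avoided. -/
theorem IsWeb.extend (hM : IsMaxRM G S a b) (hW : IsWeb G S a b A (B + 2 * A + 2) s W)
    (hA : 1 ≤ A) (hs : A * (2 * B + 9 * A + 9) + 1 < s) (hN : FStep G S a b s W N p q)
    (hN' : DStep G S a b s W N' o₁ o₂) :
    IsWeb G S a b (5 * A) B s (W.extend S a b N p q N' o₁ o₂) := by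
  have hmono : ∀ k, k ≤ 2 * B + 9 * A + 9 → A * k + 1 < s := fun k hk =>
    lt_of_le_of_lt (Nat.add_le_add_right (Nat.mul_le_mul_left A hk) 1) hs
  have nf : ∀ {x : V}, x ∈ W.D → ∀ {o : Option V}, ¬ Fam G S a b s W W.F W.D x o := fun hx _ =>
    hW.not_fam hM (by omega) (hmono _ (by omega)) hx
  have nf2 : ∀ {c x y o o₁ o₂}, Ends S a b c x y → Fam G S a b s W W.F W.D x o →
      Fam2 G S a b s W W.F W.D y o₁ o₂ → False := fun h hx hy =>
    hW.not_fam_fam2 hM (by omega) (hmono _ (by omega)) h hx hy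
  -- A vertex of D has no family of links, whereas the mate of a new vertex has one; if both ends
  -- are new, each has two families, which `nf2` excludes.
  have hmate : ∀ c x y, Ends S a b c x y → x ∈ W.D ∪ N' → y ∉ W.D ∪ N' := by
    have aux : ∀ c x y, Ends S a b c x y → y ∈ N' → ∃ o o', Fam2 G S a b s W W.F W.D x o o' := by
      intro c x y h hy
      obtain ⟨c', x', h', -, hf⟩ := hN'.fam y hy
      have hcc : c = c' := Sum.inl_injective
        ((h.tok_right hM.toIsRM).symm.trans (h'.tok_right hM.toIsRM))
      subst hcc
      rcases h.eq_or_eq h' with ⟨rfl, -⟩ | ⟨-, h2⟩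
      · exact ⟨_, _, hf⟩
      · exact absurd h2.symm (h.ne hM.toIsRM)
    intro c x y h hx hy
    rcases mem_union.1 hx with hx | hx <;> rcases mem_union.1 hy with hy | hy
    · exact hW.mate c x y h hx hy
    · obtain ⟨o, o', hf⟩ := aux c x y h hy
      exact nf hx hf.1
    · obtain ⟨o, o', hf⟩ := aux c y x h.symm hx
      exact nf hy hf.1
    · obtain ⟨o, o', hf⟩ := aux c x y h hy
      obtain ⟨_, _, hf'⟩ := aux c y x h.symm hx
      exact nf2 h hf.1 hf'
  have hinj : ∀ y ∈ W.D ∪ N', ∀ w ∈ W.D ∪ N', tok S a b y = tok S a b w → y = w := by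
    intro y hy w hw h
    by_contra hne
    obtain ⟨c, hc⟩ := tok_eq_of_ne h hne
    exact hmate c y w hc hy hw
  have hcs1 : ∀ y ∈ N', #(insert (tok S a b y) (W.supO (o₁ y) ∪ W.supO (o₂ y))) ≤ 3 * A := by
    intro y hy
    obtain ⟨c, x, -, -, hf⟩ := hN'.fam y hy
    have h1 := hW.card_supO hf.1 subset_rfl
    have h2 := hW.card_supO hf.2.1 subset_rfl
    have h3 := card_union_le (W.supO (o₁ y)) (W.supO (o₂ y))
    have h4 := card_insert_le (tok S a b y) (W.supO (o₁ y) ∪ W.supO (o₂ y))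
    omega
  -- The bound B + A + 1 instead of B leaves room for the call from `hpair2`.
  have hpair1 : ∀ y ∈ N', ∀ w ∈ W.D, ∀ X : Finset (κ ⊕ V), #X ≤ B + A + 1 →
      Disjoint X (insert (tok S a b y) (W.supO (o₁ y) ∪ W.supO (o₂ y))) →
      Disjoint X (W.sup w) → ∃ Z, Frees G S a b Z ∅ {y, w} ∧ Disjoint X Z := by
    intro y hy w hw X hX hXy hXw
    obtain ⟨c, x, hxy, -, hf⟩ := hN'.fam y hy
    have hyD := hN'.notMem y hy
    have hxD : x ∉ W.D := fun hx => nf hx hf.1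
    rw [hxy.tok_right hM.toIsRM] at hXy
    refine hW.pair_step hM.toIsRM hxy hxD hyD hf (P := W.sup w) (fun h => hyD (h ▸ hw))
      ((hW.card_sup w hw).trans (by omega)) (hW.inl_notMem_sup hM.toIsRM hxy hxD hyD hw) hXw hXy
      (hmono _ (by omega)) ?_
    intro d hd hdw X' hX' h1 h2
    exact hW.pair d hd w hw hdw X' (by omega) h1 h2
  have hpair2 : ∀ y ∈ N', ∀ w ∈ N', y ≠ w → ∀ X : Finset (κ ⊕ V), #X ≤ B →
      Disjoint X (insert (tok S a b y) (W.supO (o₁ y) ∪ W.supO (o₂ y))) →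
      Disjoint X (insert (tok S a b w) (W.supO (o₁ w) ∪ W.supO (o₂ w))) →
      ∃ Z, Frees G S a b Z ∅ {y, w} ∧ Disjoint X Z := by
    intro y hy w hw hyw X hX hXy hXw
    obtain ⟨c, x, hxy, -, hf⟩ := hN'.fam y hy
    obtain ⟨c', x', hxy', -, hf'⟩ := hN'.fam w hw
    have hyD := hN'.notMem y hy
    have hxD : x ∉ W.D := fun hx => nf hx hf.1
    have hcw : Sum.inl c ∉ insert (tok S a b w) (W.supO (o₁ w) ∪ W.supO (o₂ w)) := by
      rw [← hxy.tok_right hM.toIsRM, mem_insert, mem_union, not_or, not_or]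
      have aux : ∀ o, Fam G S a b s W W.F W.D x' o → tok S a b y ∉ W.supO o := by
        intro o ho hmem
        obtain ⟨d', hd', h⟩ := hW.supO_tok ho subset_rfl _ hmem
        exact hyD (hinj d' (mem_union_left _ hd') y (mem_union_right _ hy) h ▸ hd')
      exact ⟨fun h => hyw (hinj y (mem_union_right _ hy) w (mem_union_right _ hw) h),
        aux _ hf'.1, aux _ hf'.2.1⟩
    rw [hxy.tok_right hM.toIsRM] at hXy
    refine hW.pair_step hM.toIsRM hxy hxD hyD hf hyw (hcs1 w hw) hcw hXw hXy
      (hmono _ (by omega)) ?_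
    intro d hd hdw X' hX' h1 h2
    obtain ⟨Z, hZ, hZ'⟩ := hpair1 w hw d hd X' (by omega) h2 h1
    exact ⟨Z, by rwa [pair_comm], hZ'⟩
  have hnewF : ∀ c ∈ N, ∃ x y o, Ends S a b c x y ∧ Fam G S a b s W W.F W.D x o ∧
      Frees G S a b (insert (Sum.inl c) (W.T (p c) ∪ W.Q S a b (q c))) {c} {y} ∧
      p c ∈ W.F ∧ q c ∈ W.D := by
    intro c hc
    obtain ⟨x, y, o, hxy, hf, hl⟩ := hN.link c hc
    exact ⟨x, y, o, hxy, hf, hW.frees_new hM.toIsRM (hN.notMem c hc) hxy hl, hl.mem_F, hl.mem_D⟩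
  constructor
  · exact fun v hv => mem_union_left _ (hW.mem_D v hv)
  · exact fun c hc => mem_union_left _ (hW.mem_F c hc)
  · intro c hc
    rcases mem_union.1 hc with hc | hc
    · rw [extend_T hc]
      exact hW.frees_T c hc
    · rw [extend_T_new (hN.notMem c hc)]
      obtain ⟨x, y, o, -, -, h, -⟩ := hnewF c hc
      exact h.mono subset_rfl (by simp)
  · intro c hc hcS
    rcases mem_union.1 hc with hc | hc
    · rw [extend_T hc]
      obtain ⟨x, y, h1, h2, o, h3⟩ := hW.head c hc hcS
      exact ⟨x, y, h1, h2, o, hW.fam_extend h3⟩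
    · rw [extend_T_new (hN.notMem c hc)]
      obtain ⟨x, y, o, h1, h2, h3, -⟩ := hnewF c hc
      exact ⟨x, y, h1, h3.mono (by simp) subset_rfl, o, hW.fam_extend h2⟩
  · intro y hy c hyc
    rcases mem_union.1 hy with hy | hy
    · have h := hW.tail y hy c hyc
      rw [extend_T h.1]
      exact ⟨mem_union_left _ h.1, h.2⟩
    · obtain ⟨c', x, hxy, hc', hf⟩ := hN'.fam y hy
      obtain rfl : c' = c := Sum.inl_injective ((hxy.tok_right hM.toIsRM).symm.trans hyc)
      rw [extend_T hc']
      refine ⟨mem_union_left _ hc', ?_⟩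
      -- The set of c' frees the end opposite to an end with a family. That opposite end must be y,
      -- since otherwise one end would have a family and the other two.
      obtain ⟨x', y', h1, h2, o, h3⟩ := hW.head c' hc' hxy.1
      rcases hxy.eq_or_eq h1 with ⟨-, rfl⟩ | ⟨rfl, rfl⟩
      · exact h2
      · exact (nf2 h1 h3 hf).elim
  · exact hmate
  · intro c hc c' hc'
    rcases mem_union.1 hc with hc | hc
    · rw [extend_T hc] at hc'
      exact mem_union_left _ (hW.T_inl c hc c' hc')
    · rw [extend_T_new (hN.notMem c hc), mem_insert, mem_union] at hc'
      obtain ⟨x, y, o, -, -, -, h4, h5⟩ := hnewF c hc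
      rcases hc' with h | h | h
      · exact mem_union_right _ (Sum.inl_injective h ▸ hc)
      · exact mem_union_left _ (hW.T_inl _ h4 _ h)
      · exact mem_union_left _ (hW.Q_inl h5 h)
  · intro d hd z hz
    rcases mem_union.1 hd with hd | hd
    · rw [extend_sup hd] at hz
      obtain ⟨d', h1, h2⟩ := hW.sup_tok d hd z hz
      exact ⟨d', mem_union_left _ h1, h2⟩
    · rw [extend_sup_new (hN'.notMem d hd), mem_insert, mem_union] at hz
      obtain ⟨c, x, -, -, hf⟩ := hN'.fam d hd
      rcases hz with rfl | h | h
      · exact ⟨d, mem_union_right _ hd, rfl⟩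
      · obtain ⟨d', h1, h2⟩ := hW.supO_tok hf.1 subset_rfl z h
        exact ⟨d', mem_union_left _ h1, h2⟩
      · obtain ⟨d', h1, h2⟩ := hW.supO_tok hf.2.1 subset_rfl z h
        exact ⟨d', mem_union_left _ h1, h2⟩
  · intro d hd
    rcases mem_union.1 hd with hd | hd
    · rw [extend_sup hd]
      exact hW.tok_sup d hd
    · rw [extend_sup_new (hN'.notMem d hd)]
      exact mem_insert_self _ _
  · intro c hc
    rcases mem_union.1 hc with hc | hc
    · rw [extend_T hc]
      exact (hW.card_T c hc).trans (by omega)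
    · rw [extend_T_new (hN.notMem c hc)]
      obtain ⟨x, y, o, -, -, -, h4, h5⟩ := hnewF c hc
      have h1 := hW.card_T _ h4
      have h2 := hW.card_Q hA h5
      have h3 := card_union_le (W.T (p c)) (W.Q S a b (q c))
      have h6 := card_insert_le (Sum.inl c) (W.T (p c) ∪ W.Q S a b (q c))
      omega
  · intro d hd
    rcases mem_union.1 hd with hd | hd
    · rw [extend_sup hd]
      exact (hW.card_sup d hd).trans (by omega)
    · rw [extend_sup_new (hN'.notMem d hd)]
      exact (hcs1 d hd).trans (by omega)
  · intro z
    -- The four parts have at most A, 1, A and A + 1 elements; injectivity of p and q carries the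
    -- old load bounds over to the new colours.
    have hsub : {c ∈ W.F ∪ N | z ∈ (W.extend S a b N p q N' o₁ o₂).T c} ⊆
        (({c ∈ W.F | z ∈ W.T c} ∪ {c ∈ N | z = Sum.inl c}) ∪ {c ∈ N | z ∈ W.T (p c)}) ∪
          {c ∈ N | z ∈ W.Q S a b (q c)} := by
      intro c hc
      obtain ⟨h1, h2⟩ := mem_filter.1 hc
      simp only [mem_union, mem_filter]
      rcases mem_union.1 h1 with h1 | h1
      · rw [extend_T h1] at h2
        tauto
      · rw [extend_T_new (hN.notMem c h1), mem_insert, mem_union] at h2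
        tauto
    have e1 : #{c ∈ N | z = Sum.inl c} ≤ 1 := by
      rw [card_le_one]
      intro c hc c' hc'
      exact Sum.inl_injective ((mem_filter.1 hc).2.symm.trans (mem_filter.1 hc').2)
    have e2 : #{c ∈ N | z ∈ W.T (p c)} ≤ A := by
      refine le_trans (card_le_card_of_injOn p ?_ ?_) (hW.load_T z)
      · intro c hc
        obtain ⟨h1, h2⟩ := mem_filter.1 hc
        obtain ⟨_, _, _, -, -, -, h4, -⟩ := hnewF c h1
        exact mem_coe.2 (mem_filter.2 ⟨h4, h2⟩)
      · exact hN.inj_p.mono fun c hc => (mem_filter.1 hc).1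
    have e3 : #{c ∈ N | z ∈ W.Q S a b (q c)} ≤ A + 1 := by
      refine le_trans (card_le_card_of_injOn q ?_ ?_) (hW.load_Q z)
      · intro c hc
        obtain ⟨h1, h2⟩ := mem_filter.1 hc
        obtain ⟨_, _, _, -, -, -, -, h5⟩ := hnewF c h1
        exact mem_coe.2 (mem_filter.2 ⟨h5, h2⟩)
      · exact hN.inj_q.mono fun c hc => (mem_filter.1 hc).1
    have e4 := card_le_card hsub
    have e5 := hW.load_T z
    have e6 := card_union_le {c ∈ W.F | z ∈ W.T c} {c ∈ N | z = Sum.inl c}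
    have e7 := card_union_le ({c ∈ W.F | z ∈ W.T c} ∪ {c ∈ N | z = Sum.inl c})
      {c ∈ N | z ∈ W.T (p c)}
    have e8 := card_union_le (({c ∈ W.F | z ∈ W.T c} ∪ {c ∈ N | z = Sum.inl c}) ∪
      {c ∈ N | z ∈ W.T (p c)}) {c ∈ N | z ∈ W.Q S a b (q c)}
    change #{c ∈ W.F ∪ N | z ∈ (W.extend S a b N p q N' o₁ o₂).T c} ≤ 5 * A
    omega
  · intro z
    have hsub : {d ∈ W.D ∪ N' | z ∈ (W.extend S a b N p q N' o₁ o₂).sup d} ⊆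
        (({d ∈ W.D | z ∈ W.sup d} ∪ {d ∈ N' | tok S a b d = z}) ∪
          {d ∈ N' | z ∈ W.supO (o₁ d)}) ∪ {d ∈ N' | z ∈ W.supO (o₂ d)} := by
      intro d hd
      obtain ⟨h1, h2⟩ := mem_filter.1 hd
      simp only [mem_union, mem_filter]
      rcases mem_union.1 h1 with h1 | h1
      · rw [extend_sup h1] at h2
        tauto
      · rw [extend_sup_new (hN'.notMem d h1), mem_insert, mem_union] at h2
        rcases h2 with h2 | h2 | h2
        · exact Or.inl (Or.inl (Or.inr ⟨h1, h2.symm⟩))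
        · tauto
        · tauto
    have e1 : #{d ∈ N' | tok S a b d = z} ≤ 1 := by
      rw [card_le_one]
      intro c hc c' hc'
      obtain ⟨h1, h2⟩ := mem_filter.1 hc
      obtain ⟨h3, h4⟩ := mem_filter.1 hc'
      exact hinj _ (mem_union_right _ h1) _ (mem_union_right _ h3) (h2.trans h4.symm)
    have e2 : ∀ o : V → Option V, (∀ d ∈ N', ∀ d', o d = some d' → d' ∈ W.D) →
        (∀ y ∈ N', ∀ y' ∈ N', ∀ d, o y = some d → o y' = some d → y = y') →
        #{d ∈ N' | z ∈ W.supO (o d)} ≤ A := by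
      intro o ho hoi
      have aux : ∀ d ∈ ({d ∈ N' | z ∈ W.supO (o d)} : Finset V), d ∈ N' ∧
          ∃ d', o d = some d' ∧ d' ∈ W.D ∧ z ∈ W.sup d' := by
        intro d hd
        obtain ⟨h1, h2⟩ := mem_filter.1 hd
        rcases h : o d with _ | d'
        · simp [WebData.supO, h] at h2
        · refine ⟨h1, d', rfl, ho d h1 d' h, ?_⟩
          simpa [WebData.supO, h] using h2
      refine le_trans (card_le_card_of_injOn (fun d => (o d).getD d) ?_ ?_) (hW.load_sup z)
      · intro d hd
        obtain ⟨h1, d', h2, h3, h4⟩ := aux d hd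
        simp only [h2, Option.getD_some]
        exact mem_coe.2 (mem_filter.2 ⟨h3, h4⟩)
      · intro d hd e he hde
        obtain ⟨h1, d', h2, h3, h4⟩ := aux d hd
        obtain ⟨h5, e', h6, h7, h8⟩ := aux e he
        simp only [h2, h6, Option.getD_some] at hde
        exact hoi d h1 e h5 d' h2 (by rw [h6, hde])
    have e3 := e2 o₁ (fun d hd d' h => by
      obtain ⟨_, _, -, -, hf⟩ := hN'.fam d hd
      have := hf.1
      rw [h] at this
      exact this.1) hN'.inj₁
    have e4 := e2 o₂ (fun d hd d' h => by
      obtain ⟨_, _, -, -, hf⟩ := hN'.fam d hd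
      have := hf.2.1
      rw [h] at this
      exact this.1) hN'.inj₂
    have e5 := card_le_card hsub
    have e6 := hW.load_sup z
    have e7 := card_union_le {d ∈ W.D | z ∈ W.sup d} {d ∈ N' | tok S a b d = z}
    have e8 := card_union_le ({d ∈ W.D | z ∈ W.sup d} ∪ {d ∈ N' | tok S a b d = z})
      {d ∈ N' | z ∈ W.supO (o₁ d)}
    have e9 := card_union_le (({d ∈ W.D | z ∈ W.sup d} ∪ {d ∈ N' | tok S a b d = z}) ∪
      {d ∈ N' | z ∈ W.supO (o₁ d)}) {d ∈ N' | z ∈ W.supO (o₂ d)}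
    change #{d ∈ W.D ∪ N' | z ∈ (W.extend S a b N p q N' o₁ o₂).sup d} ≤ 5 * A
    omega
  · intro y hy w hw hyw X hX hXy hXw
    rcases mem_union.1 hy with hy | hy <;> rcases mem_union.1 hw with hw | hw
    · rw [extend_sup hy] at hXy
      rw [extend_sup hw] at hXw
      exact hW.pair y hy w hw hyw X (by omega) hXy hXw
    · rw [extend_sup hy] at hXy
      rw [extend_sup_new (hN'.notMem w hw)] at hXw
      obtain ⟨Z, h1, h2⟩ := hpair1 w hw y hy X (by omega) hXw hXy
      exact ⟨Z, by rwa [pair_comm], h2⟩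
    · rw [extend_sup_new (hN'.notMem y hy)] at hXy
      rw [extend_sup hw] at hXw
      exact hpair1 y hy w hw X (by omega) hXy hXw
    · rw [extend_sup_new (hN'.notMem y hy)] at hXy
      rw [extend_sup_new (hN'.notMem w hw)] at hXw
      exact hpair2 y hy w hw hyw X hX hXy hXw

end Extend

/-! ### Maximal rounds and the existence of a stalled web. -/

section Stall

variable {G : κ → SimpleGraph V} {S : Finset κ} {a b : κ → V} {A B s : ℕ} {W : WebData κ V}
  {N : Finset κ} {p : κ → κ} {q : κ → V} {N' : Finset V} {o₁ o₂ : V → Option V}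

lemma IsWeb.mono (hW : IsWeb G S a b A B s W) {B' : ℕ} (h : B' ≤ B) :
    IsWeb G S a b A B' s W :=
  { hW with pair := fun y hy w hw hyw X hX => hW.pair y hy w hw hyw X (hX.trans h) }

/-- The web of all uncovered vertices and all unused colours. -/
noncomputable def baseWeb [Fintype V] [Fintype κ] (S : Finset κ) (a b : κ → V) : WebData κ V where
  D := {v | tok S a b v = Sum.inr v}
  F := {c | c ∉ S}
  T c := {Sum.inl c}
  sup v := {Sum.inr v}

lemma isWeb_baseWeb [Fintype V] [Fintype κ] (hM : IsRM G S a b) :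
    IsWeb G S a b 1 B s (baseWeb S a b) := by
  have hD : ∀ v ∈ (baseWeb S a b).D, tok S a b v = Sum.inr v := fun v hv => by
    simpa [baseWeb] using hv
  have hF : ∀ c ∈ (baseWeb S a b).F, c ∉ S := fun v hv => by simpa [baseWeb] using hv
  constructor
  · intro v hv
    simpa [baseWeb] using hv
  · intro c hc
    simpa [baseWeb] using hc
  · intro c hc
    exact frees_colour (hF c hc)
  · intro c hc hcS
    exact absurd hcS (hF c hc)
  · intro y hy c hc
    simp [hD y hy] at hc
  · intro c x y h hx
    have := h.tok_left hM
    simp [hD x hx] at this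
  · intro c hc c' hc'
    obtain rfl : c' = c := by simpa [baseWeb] using hc'
    exact hc
  · intro d hd z hz
    obtain rfl : z = Sum.inr d := by simpa [baseWeb] using hz
    exact ⟨d, hd, hD d hd⟩
  · intro d hd
    simp [baseWeb, hD d hd]
  · intro c _
    simp [baseWeb]
  · intro d _
    simp [baseWeb]
  · intro z
    rw [card_le_one]
    intro c hc c' hc'
    have h1 : z = Sum.inl c := by simpa [baseWeb] using (mem_filter.1 hc).2
    have h2 : z = Sum.inl c' := by simpa [baseWeb] using (mem_filter.1 hc').2
    exact Sum.inl_injective (h1.symm.trans h2)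
  · intro z
    rw [card_le_one]
    intro c hc c' hc'
    have h1 : z = Sum.inr c := by simpa [baseWeb] using (mem_filter.1 hc).2
    have h2 : z = Sum.inr c' := by simpa [baseWeb] using (mem_filter.1 hc').2
    exact Sum.inr_injective (h1.symm.trans h2)
  · intro y hy w hw _ X _ hXy hXw
    refine ⟨({y, w} : Finset V).image Sum.inr, frees_vertices ?_, ?_⟩
    · intro v hv
      rcases mem_insert.1 hv with rfl | hv
      · exact hD v hy
      · rw [mem_singleton] at hv
        exact hv ▸ hD w hw
    · simp only [baseWeb, disjoint_singleton_right] at hXy hXw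
      rw [Finset.disjoint_left]
      intro z hz hz'
      simp only [mem_image, mem_insert, mem_singleton, exists_eq_or_imp, exists_eq_left] at hz'
      rcases hz' with rfl | rfl
      · exact hXy hz
      · exact hXw hz

lemma exists_card_max {α : Type*} [Fintype α] {P : Finset α → Prop} (h : P ∅) :
    ∃ N, P N ∧ ∀ N₁, P N₁ → #N₁ ≤ #N := by
  obtain ⟨N, h1, h2⟩ := exists_max_image ({N | P N} : Finset (Finset α)) card
    ⟨∅, by simpa using h⟩
  exact ⟨N, by simpa using h1, fun N₁ h => h2 N₁ (by simpa using h)⟩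

lemma Fam.exists_link {F' : Finset κ} {D' : Finset V} {x : V} {o : Option V}
    (h : Fam G S a b s W F' D' x o) (hs : 0 < s) :
    ∃ c ∈ F', ∃ d ∈ D', Link G S a b W x c d := by
  cases o with
  | some d =>
    obtain ⟨c, hc⟩ := card_pos.1 (hs.trans_le h.2)
    exact ⟨c, (mem_filter.1 hc).1, d, h.1, (mem_filter.1 hc).2⟩
  | none =>
    obtain ⟨Γ, h1, -, -, h4⟩ := h
    obtain ⟨p, hp⟩ := card_pos.1 (hs.trans_le h1)
    exact ⟨p.1, (h4 p hp).1, p.2, (h4 p hp).2⟩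

/-- A step which adds as many colours and as many vertices as possible. -/
structure MaxStep (G : κ → SimpleGraph V) (S : Finset κ) (a b : κ → V) (s : ℕ) (W : WebData κ V)
    (N : Finset κ) (p : κ → κ) (q : κ → V) (N' : Finset V) (o₁ o₂ : V → Option V) : Prop where
  fstep : FStep G S a b s W N p q
  dstep : DStep G S a b s W N' o₁ o₂
  max_f : ∀ N₁ p₁ q₁, FStep G S a b s W N₁ p₁ q₁ → #N₁ ≤ #N
  max_d : ∀ N₁ p₁ q₁, DStep G S a b s W N₁ p₁ q₁ → #N₁ ≤ #N'

lemma exists_maxStep [Fintype V] [Fintype κ] [Nonempty V] :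
    ∃ N p q N' o₁ o₂, MaxStep G S a b s W N p q N' o₁ o₂ := by
  obtain ⟨N, ⟨p, q, h1⟩, h2⟩ := exists_card_max (P := fun N => ∃ p q, FStep G S a b s W N p q)
    ⟨id, fun _ => Classical.arbitrary V, ⟨by simp, by simp, by simp, by simp⟩⟩
  obtain ⟨N', ⟨o₁, o₂, h3⟩, h4⟩ := exists_card_max
    (P := fun N => ∃ p q, DStep G S a b s W N p q)
    ⟨fun _ => none, fun _ => none, ⟨by simp, by simp, by simp, by simp⟩⟩
  exact ⟨N, p, q, N', o₁, o₂, h1, h3, fun N₁ p₁ q₁ h => h2 N₁ ⟨p₁, q₁, h⟩,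
    fun N₁ p₁ q₁ h => h4 N₁ ⟨p₁, q₁, h⟩⟩

/-- Any single link of the family, having a colour and an end not yet used by p and q, would let c₀
be added to N. -/
lemma MaxStep.not_fam (h : MaxStep G S a b s W N p q N' o₁ o₂) (hs : 0 < s)
    {F' : Finset κ} {D' : Finset V} (hF : F' ⊆ W.F) (hD : D' ⊆ W.D)
    (hF' : ∀ c ∈ N, p c ∉ F') (hD' : ∀ c ∈ N, q c ∉ D') {c₀ : κ} {x y : V}
    (hxy : Ends S a b c₀ x y) (hc : c₀ ∉ W.F) (hcN : c₀ ∉ N) {o : Option V} :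
    ¬ Fam G S a b s W F' D' x o := by
  intro hf
  obtain ⟨c, hc', d, hd, hl⟩ := hf.exists_link hs
  have hne : ∀ e ∈ N, e ≠ c₀ := fun e he h => hcN (h ▸ he)
  have := h.max_f (insert c₀ N) (Function.update p c₀ c) (Function.update q c₀ d) ?_
  · rw [card_insert_of_notMem hcN] at this
    omega
  · refine ⟨?_, ?_, ?_, ?_⟩
    · intro e he
      rcases mem_insert.1 he with rfl | he
      · exact hc
      · exact h.fstep.notMem e he
    · intro e he
      rcases mem_insert.1 he with rfl | he
      · refine ⟨x, y, o, hxy, hf.mono hF hD, ?_⟩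
        simpa using hl
      · simpa [Function.update_of_ne (hne e he)] using h.fstep.link e he
    · rw [coe_insert, Set.injOn_insert (by simpa using hcN)]
      refine ⟨?_, ?_⟩
      · exact h.fstep.inj_p.congr fun e he => (Function.update_of_ne (hne e he) _ _).symm
      · rintro ⟨e, he, h1⟩
        rw [Function.update_of_ne (hne e he), Function.update_self] at h1
        exact hF' e he (h1 ▸ hc')
    · rw [coe_insert, Set.injOn_insert (by simpa using hcN)]
      refine ⟨?_, ?_⟩
      · exact h.fstep.inj_q.congr fun e he => (Function.update_of_ne (hne e he) _ _).symm
      · rintro ⟨e, he, h1⟩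
        rw [Function.update_of_ne (hne e he), Function.update_self] at h1
        exact hD' e he (h1 ▸ hd)

/-- Otherwise y could join N'. Only the single vertices of the families have to be new for that, so
F' is arbitrary within F. -/
lemma MaxStep.not_fam2 (h : MaxStep G S a b s W N p q N' o₁ o₂)
    {F' : Finset κ} {D' : Finset V} (hF : F' ⊆ W.F) (hD : D' ⊆ W.D)
    (hD₁ : ∀ y ∈ N', ∀ d, o₁ y = some d → d ∉ D') (hD₂ : ∀ y ∈ N', ∀ d, o₂ y = some d → d ∉ D')
    {c₀ : κ} {x y : V} (hxy : Ends S a b c₀ x y) (hc : c₀ ∈ W.F) (hy : y ∉ W.D) (hyN : y ∉ N')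
    {o o' : Option V} : ¬ Fam2 G S a b s W F' D' x o o' := by
  intro hf
  have hne : ∀ e ∈ N', e ≠ y := fun e he h => hyN (h ▸ he)
  have key : ∀ (f : V → Option V) (o : Option V),
      (∀ y ∈ N', ∀ d, f y = some d → d ∉ D') → Fam G S a b s W F' D' x o →
      (∀ y ∈ N', ∀ y' ∈ N', ∀ d, f y = some d → f y' = some d → y = y') →
      ∀ e ∈ insert y N', ∀ e' ∈ insert y N', ∀ d, Function.update f y o e = some d →
        Function.update f y o e' = some d → e = e' := by
    intro f o hD hf hi e he e' he' d h1 h2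
    rcases mem_insert.1 he with rfl | he3 <;> rcases mem_insert.1 he' with rfl | he4
    · rfl
    · rw [Function.update_self] at h1
      rw [Function.update_of_ne (hne _ he4)] at h2
      subst h1
      exact absurd hf.1 (hD e' he4 d h2)
    · rw [Function.update_self] at h2
      rw [Function.update_of_ne (hne _ he3)] at h1
      subst h2
      exact absurd hf.1 (hD e he3 d h1)
    · rw [Function.update_of_ne (hne _ he3)] at h1
      rw [Function.update_of_ne (hne _ he4)] at h2
      exact hi e he3 e' he4 d h1 h2
  have := h.max_d (insert y N') (Function.update o₁ y o) (Function.update o₂ y o') ?_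
  · rw [card_insert_of_notMem hyN] at this
    omega
  · refine ⟨?_, ?_, key o₁ o hD₁ hf.1 h.dstep.inj₁, key o₂ o' hD₂ hf.2.1 h.dstep.inj₂⟩
    · intro e he
      rcases mem_insert.1 he with rfl | he
      · exact hy
      · exact h.dstep.notMem e he
    · intro e he
      rcases mem_insert.1 he with rfl | he
      · refine ⟨c₀, x, hxy, hc, ?_⟩
        simpa using hf.mono hF hD
      · simpa [Function.update_of_ne (hne e he)] using h.dstep.fam e he

/-- The number of colours and covered vertices in a web. -/
noncomputable def WebData.size (S : Finset κ) (a b : κ → V) (W : WebData κ V) : ℕ :=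
  #W.F + #{d ∈ W.D | ∃ c x, Ends S a b c x d}

lemma size_le [Fintype κ] : W.size S a b ≤ 3 * Fintype.card κ := by
  have h1 : {d ∈ W.D | ∃ c x, Ends S a b c x d} ⊆ S.image a ∪ S.image b := by
    intro d hd
    obtain ⟨-, c, x, h, h'⟩ := mem_filter.1 hd
    rcases h' with ⟨-, rfl⟩ | ⟨-, rfl⟩
    · exact mem_union_right _ (mem_image_of_mem _ h)
    · exact mem_union_left _ (mem_image_of_mem _ h)
  have h2 := card_le_card h1
  have h3 := card_union_le (S.image a) (S.image b)
  have h4 := card_image_le (s := S) (f := a)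
  have h5 := card_image_le (s := S) (f := b)
  have h6 := card_le_univ S
  have h7 := card_le_univ W.F
  have h8 : W.size S a b = #W.F + #{d ∈ W.D | ∃ c x, Ends S a b c x d} := by
    rw [WebData.size]
    congr!
  omega

lemma size_extend (hN : FStep G S a b s W N p q) (hN' : DStep G S a b s W N' o₁ o₂) :
    (W.extend S a b N p q N' o₁ o₂).size S a b = W.size S a b + (#N + #N') := by
  have h1 : #(W.F ∪ N) = #W.F + #N :=
    card_union_of_disjoint (Finset.disjoint_right.2 hN.notMem)
  have h2 : ({d ∈ W.D ∪ N' | ∃ c x, Ends S a b c x d} : Finset V) =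
      {d ∈ W.D | ∃ c x, Ends S a b c x d} ∪ N' := by
    rw [filter_union]
    congr 1
    rw [filter_eq_self]
    intro y hy
    obtain ⟨c, x, h, -⟩ := hN'.fam y hy
    exact ⟨c, x, h⟩
  change #(W.F ∪ N) + #{d ∈ W.D ∪ N' | ∃ c x, Ends S a b c x d} = _
  rw [h1, h2, card_union_of_disjoint, WebData.size]
  · omega
  · exact Finset.disjoint_right.2 fun y hy h => hN'.notMem y hy (mem_filter.1 h).1

/-- There is a web which cannot be enlarged by more than `r` new colours and vertices. -/
theorem exists_stalled [Fintype V] [Fintype κ] [Nonempty V] (hM : IsMaxRM G S a b) {r l : ℕ}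
    (hl : 3 * Fintype.card κ < l * (r + 1)) (hs : 30 * 25 ^ l ≤ s) :
    ∃ A W N p q N' o₁ o₂, A ≤ 5 ^ l ∧ IsWeb G S a b A (4 * 5 ^ l) s W ∧
      MaxStep G S a b s W N p q N' o₁ o₂ ∧ #N + #N' ≤ r := by
  by_contra hcon
  -- A round costs 2·5^j + 2 of B, while 5^(l+1) − 5^j drops by 4·5^j; at least 4·5^l remains as
  -- long as j ≤ l.
  have key : ∀ j ≤ l, ∃ W, IsWeb G S a b (5 ^ j) (5 ^ (l + 1) - 5 ^ j) s W ∧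
      j * (r + 1) ≤ W.size S a b := by
    intro j
    induction j with
    | zero => exact fun _ => ⟨baseWeb S a b, isWeb_baseWeb hM.toIsRM, by simp⟩
    | succ j ih =>
      intro hj
      obtain ⟨W, hW, hsize⟩ := ih (by omega)
      obtain ⟨N, p, q, N', o₁, o₂, h⟩ := exists_maxStep (G := G) (S := S) (a := a) (b := b)
        (s := s) (W := W)
      have e1 : 5 ^ j ≤ 5 ^ l := Nat.pow_le_pow_right (by norm_num) (by omega)
      have e1' : 5 ^ (j + 1) ≤ 5 ^ l := Nat.pow_le_pow_right (by norm_num) (by omega)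
      have e2 : 1 ≤ 5 ^ j := Nat.one_le_pow _ _ (by norm_num)
      have e3 : 5 ^ (l + 1) = 5 * 5 ^ l := by rw [pow_succ]; ring
      have e4 : 5 ^ (j + 1) = 5 * 5 ^ j := by rw [pow_succ]; ring
      have hbig : r + 1 ≤ #N + #N' := by
        by_contra hlt
        exact hcon ⟨5 ^ j, W, N, p, q, N', o₁, o₂, e1, hW.mono (by omega), h, by omega⟩
      refine ⟨W.extend S a b N p q N' o₁ o₂, ?_, ?_⟩
      · rw [e4]
        refine (hW.mono ?_).extend hM e2 ?_ h.fstep h.dstep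
        · omega
        · refine lt_of_lt_of_le ?_ hs
          have e5 : 25 ^ l = 5 ^ l * 5 ^ l := by rw [← mul_pow]; norm_num
          have e6 : 5 ^ j * (2 * (5 ^ (l + 1) - 5 * 5 ^ j) + 9 * 5 ^ j + 9) ≤
              5 ^ l * (28 * 5 ^ l) := Nat.mul_le_mul e1 (by omega)
          have e7 : 1 ≤ 5 ^ l * 5 ^ l := Nat.mul_pos (by omega) (by omega)
          rw [e5]
          nlinarith
      · rw [size_extend h.fstep h.dstep]
        nlinarith
  obtain ⟨W, -, h⟩ := key l le_rfl
  have := size_le (W := W) (S := S) (a := a) (b := b)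
  omega

end Stall

/-! ### Double counting at a stalled web. -/

section Count

variable {G : κ → SimpleGraph V} {S : Finset κ} {a b : κ → V} {A B s : ℕ} {W : WebData κ V}
  {N : Finset κ} {p : κ → κ} {q : κ → V} {N' : Finset V} {o₁ o₂ : V → Option V}

lemma Ends.unique (hM : IsRM G S a b) {c c' : κ} {v y y' : V} (h : Ends S a b c v y)
    (h' : Ends S a b c' v y') : c = c' ∧ y = y' := by
  obtain rfl : c = c' := Sum.inl_injective ((h.tok_left hM).symm.trans (h'.tok_left hM))
  rcases h.eq_or_eq h' with ⟨-, h2⟩ | ⟨h2, -⟩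
  · exact ⟨rfl, h2.symm⟩
  · exact absurd h2 (h.ne hM)

/-- The other end of the matching edge at `v`. -/
noncomputable def partner (S : Finset κ) (a b : κ → V) (v : V) : V :=
  if h : ∃ y c, Ends S a b c v y then h.choose else v

lemma Ends.partner_eq (hM : IsRM G S a b) {c : κ} {v y : V} (h : Ends S a b c v y) :
    partner S a b v = y := by
  have h' : ∃ y c, Ends S a b c v y := ⟨y, c, h⟩
  rw [partner, dif_pos h']
  obtain ⟨c', hc'⟩ := h'.choose_spec
  exact (hc'.unique hM h).2

lemma Ends.mem_image {c : κ} {v y : V} (h : Ends S a b c v y) {N : Finset κ} (hc : c ∈ N) :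
    v ∈ N.image a ∪ N.image b := by
  rcases h.2 with ⟨rfl, -⟩ | ⟨rfl, -⟩
  · exact mem_union_left _ (mem_image_of_mem _ hc)
  · exact mem_union_right _ (mem_image_of_mem _ hc)

lemma card_image_union_image_le (N : Finset κ) (a b : κ → V) :
    #(N.image a ∪ N.image b) ≤ 2 * #N := by
  have h3 := card_union_le (N.image a) (N.image b)
  have h4 := card_image_le (s := N) (f := a)
  have h5 := card_image_le (s := N) (f := b)
  omega

/-- Without families of links there are few colours with links. -/
lemma card_link_le {F' : Finset κ} {D' E : Finset V} {x : V}
    (h0 : ¬ Fam G S a b s W F' D' x none) (h1 : ∀ d ∈ D', d ∉ E → ¬ Fam G S a b s W F' D' x (some d)) :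
    #{c ∈ F' | ∃ d ∈ D', d ∉ E ∧ Link G S a b W x c d} ≤ s * s := by
  set C : Finset κ := {c ∈ F' | ∃ d ∈ D', d ∉ E ∧ Link G S a b W x c d} with hC
  have hC' : ∀ c ∈ C, ∃ d, d ∈ D' ∧ d ∉ E ∧ Link G S a b W x c d := fun c hc =>
    (mem_filter.1 hc).2
  rcases C.eq_empty_or_nonempty with he | ⟨c₁, hc₁⟩
  · simp [he]
  have : ∃ g : κ → V, ∀ c ∈ C, g c ∈ D' ∧ g c ∉ E ∧ Link G S a b W x c (g c) := by
    have : Nonempty V := ⟨x⟩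
    choose! g hg using hC'
    exact ⟨g, hg⟩
  obtain ⟨g, hg⟩ := this
  -- One colour chosen for each of s distinct vertices would be a family of type `none`.
  have himg : #(C.image g) < s := by
    by_contra hge
    apply h0
    have hch : ∀ d ∈ C.image g, ∃ c, c ∈ C ∧ g c = d := fun d hd => mem_image.1 hd
    have : ∃ t : V → κ, ∀ d ∈ C.image g, t d ∈ C ∧ g (t d) = d := by
      have : Nonempty κ := ⟨c₁⟩
      choose! t ht using hch
      exact ⟨t, ht⟩
    obtain ⟨t, ht⟩ := this
    refine ⟨(C.image g).image fun d => (t d, d), ?_, ?_, ?_, ?_⟩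
    · rw [card_image_of_injective _ fun d d' h => (Prod.ext_iff.1 h).2]
      omega
    · intro z hz z' hz' h
      obtain ⟨d, hd, rfl⟩ := mem_image.1 (mem_coe.1 hz)
      obtain ⟨d', hd', rfl⟩ := mem_image.1 (mem_coe.1 hz')
      have h' : t d = t d' := h
      have : d = d' := by rw [← (ht d hd).2, ← (ht d' hd').2, h']
      rw [this]
    · intro z hz z' hz' h
      obtain ⟨d, hd, rfl⟩ := mem_image.1 (mem_coe.1 hz)
      obtain ⟨d', hd', rfl⟩ := mem_image.1 (mem_coe.1 hz')
      have h' : d = d' := h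
      rw [h']
    · intro z hz
      obtain ⟨d, hd, rfl⟩ := mem_image.1 hz
      obtain ⟨h2, h3⟩ := ht d hd
      have h4 := hg _ h2
      rw [h3] at h4
      exact ⟨(mem_filter.1 h2).1, h4.1, h4.2.2⟩
  have hfib : ∀ d ∈ C.image g, #{c ∈ C | g c = d} ≤ s := by
    intro d hd
    obtain ⟨c, hc, rfl⟩ := mem_image.1 hd
    by_contra hlt
    refine h1 (g c) (hg c hc).1 (hg c hc).2.1 ⟨(hg c hc).1, (not_le.1 hlt).le.trans
      (card_le_card fun c' hc' => ?_)⟩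
    obtain ⟨h2, h3⟩ := mem_filter.1 hc'
    have h4 := (hg c' h2).2.2
    rw [h3] at h4
    exact mem_filter.2 ⟨(mem_filter.1 h2).1, h4⟩
  calc #C ≤ s * #(C.image g) := card_le_mul_card_image C s hfib
    _ ≤ s * s := Nat.mul_le_mul_left _ himg.le

/-- The double counting of the links at a web which cannot be enlarged much. -/
theorem stalled_count [Fintype V] [Fintype κ] (hM : IsMaxRM G S a b)
    (hT : ∀ c x y z, (G c).Adj x y → (G c).Adj y z → x ≠ z → (G c).Adj x z)
    (hW : IsWeb G S a b A B s W) (hAB : 2 * A + 1 ≤ B) (hs : A * (3 * A + 3) + 1 < s)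
    (h : MaxStep G S a b s W N p q N' o₁ o₂) {r m N₀ : ℕ} (hr : #N + #N' ≤ r)
    (hm : ∀ x y, x ≠ y → #{c | (G c).Adj x y} ≤ m)
    (hN₀ : ∀ c, N₀ ≤ #{v | ∃ w, (G c).Adj v w}) :
    ∃ f, Fintype.card κ ≤ f + #S + r ∧ f * N₀ ≤
      f * (2 * #S + 2 * (2 * r + A * A + (A + 1) * A) + 2 * r) +
        (2 * #S * (s * s) + m * (2 * (f + r))) := by
  -- F' and D' omit whatever the maximal step has used, at a cost of O(r), so that a family within
  -- them would extend the step. X₁ and X₀ split the vertices outside D according to whether their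
  -- mate is in D.
  set F' := W.F \ N.image p with hF'
  set UV : Finset V := {d ∈ W.D | d ∈ N.image q ∨ ∃ y ∈ N', o₁ y = some d ∨ o₂ y = some d} with hUV
  set D' := W.D \ UV with hD'
  set X₁ : Finset V := {v | v ∉ W.D ∧ ∃ c y, Ends S a b c v y ∧ y ∈ W.D} with hX₁
  set X₀ : Finset V := {v | v ∉ W.D ∧ ∃ c y, Ends S a b c v y ∧ y ∉ W.D} with hX₀
  set Xe : Finset V := {v ∈ X₀ | ∃ c y, Ends S a b c v y ∧ (c ∈ N ∨ v ∈ N' ∨ y ∈ N')} with hXe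
  set Xr := X₀ \ Xe with hXr
  have hM' := hM.toIsRM
  have hFsub : F' ⊆ W.F := sdiff_subset
  have hDsub : D' ⊆ W.D := sdiff_subset
  have hFcard : #W.F ≤ #F' + r := by
    have h1 := card_le_card (show W.F ⊆ F' ∪ N.image p by
      intro c hc
      by_cases h : c ∈ N.image p
      · exact mem_union_right _ h
      · exact mem_union_left _ (mem_sdiff.2 ⟨hc, h⟩))
    have h2 := card_union_le F' (N.image p)
    have h3 := card_image_le (s := N) (f := p)
    omega
  have hUVcard : #UV ≤ 2 * r := by
    have h1 := card_le_card (show UV ⊆ (N.image q ∪ N'.image fun y => (o₁ y).getD y) ∪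
        N'.image fun y => (o₂ y).getD y by
      intro d hd
      obtain ⟨-, hd | ⟨y, hy, hd | hd⟩⟩ := mem_filter.1 hd
      · exact mem_union_left _ (mem_union_left _ hd)
      · exact mem_union_left _ (mem_union_right _ (mem_image.2 ⟨y, hy, by simp [hd]⟩))
      · exact mem_union_right _ (mem_image.2 ⟨y, hy, by simp [hd]⟩))
    have h2 := card_union_le (N.image q ∪ N'.image fun y => (o₁ y).getD y)
      (N'.image fun y => (o₂ y).getD y)
    have h3 := card_union_le (N.image q) (N'.image fun y => (o₁ y).getD y)
    have h4 := card_image_le (s := N) (f := q)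
    have h5 := card_image_le (s := N') (f := fun y => (o₁ y).getD y)
    have h6 := card_image_le (s := N') (f := fun y => (o₂ y).getD y)
    omega
  -- X₀, X₁ and the mates of X₁ are disjoint sets of matched vertices.
  have hXcard : #X₀ + 2 * #X₁ ≤ 2 * #S := by
    set DM : Finset V := {v ∈ W.D | ∃ c y, Ends S a b c v y} with hDM
    have h1 : #X₁ ≤ #DM := by
      refine card_le_card_of_injOn (partner S a b) ?_ ?_
      · intro v hv
        obtain ⟨-, -, c, y, hc, hy⟩ := mem_filter.1 (mem_coe.1 hv)
        rw [hc.partner_eq hM']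
        exact mem_coe.2 (mem_filter.2 ⟨hy, c, v, hc.symm⟩)
      · intro v hv v' hv' heq
        obtain ⟨-, -, c, y, hc, hy⟩ := mem_filter.1 (mem_coe.1 hv)
        obtain ⟨-, -, c', y', hc', hy'⟩ := mem_filter.1 (mem_coe.1 hv')
        rw [hc.partner_eq hM', hc'.partner_eq hM'] at heq
        subst heq
        exact (hc.symm.unique hM' hc'.symm).2
    have h2 : Disjoint X₀ X₁ := by
      rw [Finset.disjoint_left]
      intro v hv hv'
      obtain ⟨-, -, c, y, hc, hy⟩ := mem_filter.1 hv
      obtain ⟨-, -, c', y', hc', hy'⟩ := mem_filter.1 hv'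
      rw [(hc.unique hM' hc').2] at hy
      exact hy hy'
    have h3 : Disjoint (X₀ ∪ X₁) DM := by
      rw [Finset.disjoint_left]
      intro v hv hv'
      have hvD := (mem_filter.1 hv').1
      rcases mem_union.1 hv with hv | hv
      · exact (mem_filter.1 hv).2.1 hvD
      · exact (mem_filter.1 hv).2.1 hvD
    have h4 : (X₀ ∪ X₁) ∪ DM ⊆ S.image a ∪ S.image b := by
      intro v hv
      rcases mem_union.1 hv with hv | hv
      · rcases mem_union.1 hv with hv | hv
        · obtain ⟨-, -, c, y, hc, hy⟩ := mem_filter.1 hv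
          exact hc.mem_image hc.1
        · obtain ⟨-, -, c, y, hc, hy⟩ := mem_filter.1 hv
          exact hc.mem_image hc.1
      · obtain ⟨-, c, y, hc⟩ := mem_filter.1 hv
        exact hc.mem_image hc.1
    have h5 := card_le_card h4
    rw [card_union_of_disjoint h3, card_union_of_disjoint h2] at h5
    have := card_image_union_image_le S a b
    omega
  have hXecard : #Xe ≤ 2 * r := by
    have h1 := card_le_card (show Xe ⊆ ((N.image a ∪ N.image b) ∪ N') ∪
        N'.image (partner S a b) by
      intro v hv
      obtain ⟨-, c, y, hc, hv | hv | hv⟩ := mem_filter.1 hv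
      · exact mem_union_left _ (mem_union_left _ (hc.mem_image hv))
      · exact mem_union_left _ (mem_union_right _ hv)
      · exact mem_union_right _ (mem_image.2 ⟨y, hv, hc.symm.partner_eq hM'⟩))
    have h2 := card_union_le ((N.image a ∪ N.image b) ∪ N') (N'.image (partner S a b))
    have h3 := card_union_le (N.image a ∪ N.image b) N'
    have h4 := card_image_le (s := N') (f := partner S a b)
    have h5 := card_image_union_image_le N a b
    omega
  have hcover : ∀ v, v ∉ W.D → v ∈ X₁ ∨ v ∈ X₀ := by
    intro v hv
    rcases htok : tok S a b v with c | w
    · obtain ⟨y, hy⟩ := tok_inl htok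
      by_cases hyD : y ∈ W.D
      · exact Or.inl (mem_filter.2 ⟨mem_univ _, hv, c, y, hy.symm, hyD⟩)
      · exact Or.inr (mem_filter.2 ⟨mem_univ _, hv, c, y, hy.symm, hyD⟩)
    · obtain rfl := tok_inr htok
      exact absurd (hW.mem_D w htok) hv
  -- the number of links at a vertex
  have hlam : ∀ v ∈ Xr, #{c ∈ F' | ∃ d ∈ D', Link G S a b W v c d} ≤
      s * s + if ∃ c ∈ W.F, ∃ y, Ends S a b c v y then m else 0 := by
    intro v hv
    obtain ⟨hv0, hve⟩ := mem_sdiff.1 hv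
    obtain ⟨-, hvD, c₀, y, hc₀, hyD⟩ := mem_filter.1 hv0
    have hexc : c₀ ∉ N ∧ v ∉ N' ∧ y ∉ N' := by
      by_contra hcon
      exact hve (mem_filter.2 ⟨hv0, c₀, y, hc₀, by tauto⟩)
    have hpF : ∀ c ∈ N, p c ∉ F' := fun c hc hp =>
      (mem_sdiff.1 hp).2 (mem_image_of_mem _ hc)
    have hqD : ∀ c ∈ N, q c ∉ D' := fun c hc hq =>
      (mem_sdiff.1 hq).2 (mem_filter.2 ⟨(mem_sdiff.1 hq).1, Or.inl (mem_image_of_mem _ hc)⟩)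
    have ho₁ : ∀ y ∈ N', ∀ d, o₁ y = some d → d ∉ D' := fun y hy d hd hdD =>
      (mem_sdiff.1 hdD).2 (mem_filter.2 ⟨(mem_sdiff.1 hdD).1, Or.inr ⟨y, hy, Or.inl hd⟩⟩)
    have ho₂ : ∀ y ∈ N', ∀ d, o₂ y = some d → d ∉ D' := fun y hy d hd hdD =>
      (mem_sdiff.1 hdD).2 (mem_filter.2 ⟨(mem_sdiff.1 hdD).1, Or.inr ⟨y, hy, Or.inr hd⟩⟩)
    by_cases hcF : c₀ ∈ W.F
    · rw [if_pos ⟨c₀, hcF, y, hc₀⟩]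
      have hno : ∀ o o', ¬ Fam2 G S a b s W F' D' v o o' := fun o o' =>
        h.not_fam2 hFsub hDsub ho₁ ho₂ hc₀ hcF hyD hexc.2.2
      have hnone : ¬ Fam G S a b s W F' D' v none := fun hf =>
        hno none none ⟨hf, hf, by simp⟩
      -- E has at most one element, since two would form a `Fam2`. Multiplicity bounds the links to
      -- it by m, and `card_link_le` bounds all others by s².
      set E : Finset V := {d ∈ D' | Fam G S a b s W F' D' v (some d)} with hE
      have hE1 : ∀ d ∈ E, ∀ d' ∈ E, d = d' := by
        intro d hd d' hd'
        by_contra hne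
        refine hno (some d) (some d') ⟨(mem_filter.1 hd).2, (mem_filter.1 hd').2, ?_⟩
        rintro e he he'
        exact hne (Option.some.inj (he.trans he'.symm))
      have h1 := card_link_le (E := E) hnone (fun d hd hdE hf => hdE (mem_filter.2 ⟨hd, hf⟩))
      have h2 : #{c ∈ F' | ∃ d ∈ E, (G c).Adj v d} ≤ m := by
        rcases E.eq_empty_or_nonempty with he | ⟨d, hd⟩
        · simp [he]
        · by_cases hvd : v = d
          · have : ({c ∈ F' | ∃ d ∈ E, (G c).Adj v d} : Finset κ) = ∅ := by
              rw [filter_eq_empty_iff]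
              rintro c - ⟨d', hd', hadj⟩
              exact hadj.ne (hvd.trans (hE1 d hd d' hd'))
            rw [this]
            simp
          · refine le_trans (card_le_card fun c hc => ?_) (hm v d hvd)
            obtain ⟨-, d', hd', hadj⟩ := mem_filter.1 hc
            rw [hE1 d' hd' d hd] at hadj
            exact mem_filter.2 ⟨mem_univ _, hadj⟩
      refine le_trans (card_le_card (t := {c ∈ F' | ∃ d ∈ D', d ∉ E ∧ Link G S a b W v c d} ∪
        {c ∈ F' | ∃ d ∈ E, (G c).Adj v d}) fun c hc => ?_)
        ((card_union_le _ _).trans (Nat.add_le_add h1 h2))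
      obtain ⟨hc1, d, hd, hl⟩ := mem_filter.1 hc
      by_cases hdE : d ∈ E
      · exact mem_union_right _ (mem_filter.2 ⟨hc1, d, hdE, hl.adj⟩)
      · exact mem_union_left _ (mem_filter.2 ⟨hc1, d, hd, hdE, hl⟩)
    · have hno : ∀ o, ¬ Fam G S a b s W F' D' v o := fun o =>
        h.not_fam (by omega) hFsub hDsub hpF hqD hc₀ hcF hexc.1
      have h1 := card_link_le (E := ∅) (hno none) (fun d _ _ => hno (some d))
      refine le_trans (le_trans (card_le_card fun c hc => ?_) h1) (Nat.le_add_right _ _)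
      obtain ⟨hc1, d, hd, hl⟩ := mem_filter.1 hc
      exact mem_filter.2 ⟨hc1, d, hd, by simp, hl⟩
  have hlamsum : ∑ v ∈ Xr, #{c ∈ F' | ∃ d ∈ D', Link G S a b W v c d} ≤
      2 * #S * (s * s) + m * (2 * (#F' + r)) := by
    refine (sum_le_sum hlam).trans ?_
    rw [sum_add_distrib, sum_const, smul_eq_mul, ← sum_filter, sum_const, smul_eq_mul,
      mul_comm _ m]
    refine Nat.add_le_add (Nat.mul_le_mul_right _ ?_) (Nat.mul_le_mul_left _ ?_)
    · have := card_le_card (show Xr ⊆ X₀ from sdiff_subset)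
      omega
    · refine le_trans (card_le_card (t := W.F.image a ∪ W.F.image b) ?_)
        ((card_image_union_image_le _ _ _).trans (by omega))
      intro v hv
      obtain ⟨-, c, hc, y, hy⟩ := mem_filter.1 hv
      exact hy.mem_image hc
  -- the number of vertices of one colour
  have hcol : ∀ c ∈ F', N₀ ≤ (2 * #S + 2 * (2 * r + A * A + (A + 1) * A) + 2 * r) +
      #{v ∈ Xr | ∃ d ∈ D', Link G S a b W v c d} := by
    intro c hc
    have hcF := hFsub hc
    set Dc : Finset V := {v ∈ W.D | ∃ w, (G c).Adj v w} with hDc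
    set Dg : Finset V := {d ∈ Dc | d ∉ UV ∧ Disjoint (W.T c) (W.sup d) ∧
      Disjoint (W.T c) (W.Q S a b d)} with hDg
    have hbad : #(Dc \ Dg) ≤ 2 * r + A * A + (A + 1) * A := by
      have h1 := card_hit_le (I := W.D) (f := W.sup) (X := W.T c) hW.load_sup
      have h2 := card_hit_le (I := W.D) (f := W.Q S a b) (X := W.T c) hW.load_Q
      have h3 := Nat.mul_le_mul_left A (hW.card_T c hcF)
      have h4 := Nat.mul_le_mul_left (A + 1) (hW.card_T c hcF)
      have h5 := card_le_card (show Dc \ Dg ⊆ (UV ∪ {i ∈ W.D | ¬ Disjoint (W.sup i) (W.T c)}) ∪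
          {i ∈ W.D | ¬ Disjoint (W.Q S a b i) (W.T c)} by
        intro d hd
        obtain ⟨hd1, hd2⟩ := mem_sdiff.1 hd
        have hd3 := (mem_filter.1 hd1).1
        simp only [mem_union, mem_filter, hd3, true_and]
        by_contra hcon
        push Not at hcon
        exact hd2 (mem_filter.2 ⟨hd1, hcon.1.1, hcon.1.2.symm, hcon.2.symm⟩))
      have h6 := card_union_le (UV ∪ {i ∈ W.D | ¬ Disjoint (W.sup i) (W.T c)})
        {i ∈ W.D | ¬ Disjoint (W.Q S a b i) (W.T c)}
      have h7 := card_union_le UV {i ∈ W.D | ¬ Disjoint (W.sup i) (W.T c)}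
      omega
    have hg : ∀ d ∈ Dg, ∃ w, (G c).Adj d w := fun d hd =>
      (mem_filter.1 (mem_filter.1 hd).1).2
    have hgD : ∀ d ∈ Dg, d ∈ W.D := fun d hd => (mem_filter.1 (mem_filter.1 hd).1).1
    have hgg : ∀ d ∈ Dg, d ∉ UV ∧ Disjoint (W.T c) (W.sup d) ∧
      Disjoint (W.T c) (W.Q S a b d) := fun d hd => (mem_filter.1 hd).2
    have hnadj : ∀ d ∈ Dg, ∀ d' ∈ Dg, ¬ (G c).Adj d d' := fun d hd d' hd' =>
      hW.not_adj hM (by omega) hcF (hgD d hd) (hgD d' hd') (hgg d hd).2.1 (hgg d' hd').2.1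
    choose! w hw using hg
    -- Good vertices lie in different cliques of colour c, so their chosen neighbours are distinct.
    -- Such a neighbour is a bad vertex of D, or in X₁, or exceptional, or it carries a link. As X₁
    -- is counted here and again in `h5`, the sum #X₀ + 2 #X₁ arises.
    have hgcard : #Dg ≤ #(((Dc \ Dg) ∪ X₁) ∪ (Xe ∪ {v ∈ Xr | ∃ d ∈ D', Link G S a b W v c d})) := by
      refine card_le_card_of_injOn w ?_ ?_
      · intro d hd
        have hd := mem_coe.1 hd
        rw [mem_coe]
        have hadj := hw d hd
        by_cases hwD : w d ∈ W.D
        · refine mem_union_left _ (mem_union_left _ (mem_sdiff.2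
            ⟨mem_filter.2 ⟨hwD, d, hadj.symm⟩, fun hwg => hnadj d hd _ hwg hadj⟩))
        · rcases hcover _ hwD with h1 | h1
          · exact mem_union_left _ (mem_union_right _ h1)
          · refine mem_union_right _ ?_
            by_cases h2 : w d ∈ Xe
            · exact mem_union_left _ h2
            · refine mem_union_right _ (mem_filter.2 ⟨mem_sdiff.2 ⟨h1, h2⟩, d,
                mem_sdiff.2 ⟨hgD d hd, (hgg d hd).1⟩, ?_⟩)
              exact ⟨hcF, hgD d hd, hadj.symm, (hgg d hd).2.1, (hgg d hd).2.2⟩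
      · intro d hd d' hd' heq
        have hd := mem_coe.1 hd
        have hd' := mem_coe.1 hd'
        by_contra hne
        have h1 := hw d hd
        have h2 := hw d' hd'
        rw [← heq] at h2
        exact hnadj d hd d' hd' (hT c _ _ _ h1 h2.symm hne)
    have h1 := card_union_le ((Dc \ Dg) ∪ X₁)
      (Xe ∪ {v ∈ Xr | ∃ d ∈ D', Link G S a b W v c d})
    have h2 := card_union_le (Dc \ Dg) X₁
    have h3 := card_union_le Xe {v ∈ Xr | ∃ d ∈ D', Link G S a b W v c d}
    have h4 : #Dc ≤ #(Dc \ Dg) + #Dg := by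
      rw [card_sdiff_add_card_eq_card (filter_subset _ _)]
    have h5 : #{v | ∃ w, (G c).Adj v w} ≤ #Dc + (#X₁ + #X₀) := by
      refine le_trans (card_le_card (t := Dc ∪ (X₁ ∪ X₀)) ?_) ((card_union_le _ _).trans
        (Nat.add_le_add_left (card_union_le _ _) _))
      intro v hv
      by_cases hvD : v ∈ W.D
      · exact mem_union_left _ (mem_filter.2 ⟨hvD, (mem_filter.1 hv).2⟩)
      · exact mem_union_right _ (mem_union.2 (hcover v hvD))
    have h6 := hN₀ c
    omega
  refine ⟨#F', ?_, ?_⟩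
  · have h1 := card_le_card (show univ ⊆ W.F ∪ S by
      intro c _
      by_cases hc : c ∈ S
      · exact mem_union_right _ hc
      · exact mem_union_left _ (hW.mem_F c hc))
    have h2 := card_union_le W.F S
    rw [card_univ] at h1
    omega
  · have h1 := sum_le_sum hcol
    rw [sum_const, smul_eq_mul, sum_add_distrib, sum_const, smul_eq_mul] at h1
    refine h1.trans (Nat.add_le_add_left (le_trans (le_of_eq ?_) hlamsum) _)
    exact sum_card_bipartiteAbove_eq_sum_card_bipartiteBelow
      (fun c v => ∃ d ∈ D', Link G S a b W v c d)

end Count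

/-! ### Nearly full matchings and greedy completion. -/

section NearlyFull

variable {G : κ → SimpleGraph V} {S : Finset κ} {a b : κ → V}

/-- A maximum rainbow matching uses nearly all colours. -/
theorem IsMaxRM.card_lt [Fintype V] [Fintype κ] (hM : IsMaxRM G S a b)
    (hT : ∀ c x y z, (G c).Adj x y → (G c).Adj y z → x ≠ z → (G c).Adj x z) {m g r t l : ℕ}
    (hm : ∀ x y, x ≠ y → #{c | (G c).Adj x y} ≤ m) (hmn : m ≤ Fintype.card κ)
    (hG : ∀ c, 2 * Fintype.card κ + 2 * m + g ≤ #{v | ∃ w, (G c).Adj v w})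
    (hl : 3 * Fintype.card κ < l * (r + 1)) (hrt : 2 * r ≤ t) (hg : 12 * r + 12 * 25 ^ l ≤ g)
    (ht : 8 * Fintype.card κ * (900 * 625 ^ l + r) < t * g) :
    Fintype.card κ < #S + t := by
  by_contra! hcon
  set n := Fintype.card κ with hn
  have ht0 : 0 < t := Nat.pos_of_ne_zero (by rintro rfl; simp at ht)
  have hV : Nonempty V := by
    have : Nonempty κ := Fintype.card_pos_iff.1 (by omega)
    obtain ⟨c⟩ := this
    have := hG c
    obtain ⟨v, -⟩ := card_pos.1 (show 0 < #{v | ∃ w, (G c).Adj v w} by omega)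
    exact ⟨v⟩
  obtain ⟨A, W, N, p, q, N', o₁, o₂, hA, hW, hmax, hr⟩ :=
    exists_stalled hM hl (s := 30 * 25 ^ l) le_rfl
  have h25 : 25 ^ l = 5 ^ l * 5 ^ l := by rw [← mul_pow]; norm_num
  have h625 : 625 ^ l = 25 ^ l * 25 ^ l := by rw [← mul_pow]; norm_num
  have h5 : 1 ≤ 5 ^ l := Nat.one_le_pow _ _ (by norm_num)
  have hAA : A * A ≤ 25 ^ l := by rw [h25]; exact Nat.mul_le_mul hA hA
  have hA1 : A ≤ 25 ^ l := by rw [h25]; nlinarith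
  have h25' : 1 ≤ 25 ^ l := Nat.one_le_pow _ _ (by norm_num)
  obtain ⟨f, hf1, hf2⟩ := stalled_count hM hT hW (by omega) (by nlinarith) hmax hr hm hG
  rw [← hn] at hf1
  have hSn : #S ≤ n := card_le_univ S
  -- From n ≤ f + #S + r, #S + t ≤ n and 2r ≤ t.
  have hft : t ≤ 2 * f := by omega
  -- The terms 2mf on the two sides cancel. The error f(6r + 6·25^l) is at most fg/2, so fg ≤
  -- 4n(900·625^l + r), against `ht`.
  have e1 : f * (2 * n + 2 * m + g) = f * (2 * n) + 2 * (m * f) + f * g := by ring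
  have e2 : f * (2 * #S + 2 * (2 * r + A * A + (A + 1) * A) + 2 * r) ≤
      f * (2 * n) + f * (6 * r + 6 * 25 ^ l) := by
    rw [← Nat.mul_add f (2 * n)]
    refine Nat.mul_le_mul_left _ ?_
    have : (A + 1) * A = A * A + A := by ring
    omega
  have e3 : 2 * #S * (30 * 25 ^ l * (30 * 25 ^ l)) ≤ 2 * n * (900 * 625 ^ l) := by
    rw [h625, show 30 * 25 ^ l * (30 * 25 ^ l) = 900 * (25 ^ l * 25 ^ l) by ring]
    exact Nat.mul_le_mul_right _ (by omega)
  have e4 : m * (2 * (f + r)) ≤ 2 * (m * f) + 2 * n * r := by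
    have : m * r ≤ n * r := Nat.mul_le_mul_right _ hmn
    nlinarith
  have e5 : f * (12 * r + 12 * 25 ^ l) ≤ f * g := Nat.mul_le_mul_left _ hg
  have e6 : t * g ≤ 2 * f * g := Nat.mul_le_mul_right _ hft
  have e7 : f * (12 * r + 12 * 25 ^ l) = 2 * (f * (6 * r + 6 * 25 ^ l)) := by ring
  have e8 : 8 * n * (900 * 625 ^ l + r) = 4 * (2 * n * (900 * 625 ^ l) + 2 * n * r) := by ring
  have e9 : 2 * f * g = 2 * (f * g) := by ring
  omega

/-- Extending a rainbow matching greedily. -/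
theorem IsRM.exists_full [Fintype κ] (hM : IsRM G S a b)
    (h : ∀ c ∉ S, ∀ W : Finset V, #W + 2 ≤ 2 * #Sᶜ → ∃ x y, (G c).Adj x y ∧ x ∉ W ∧ y ∉ W ∧
      ∀ d ∈ S, a d ≠ x ∧ b d ≠ x ∧ a d ≠ y ∧ b d ≠ y) :
    ∃ a b, IsRM G univ a b := by
  induction hk : #Sᶜ generalizing S a b with
  | zero =>
    have : S = univ := by simpa using hk
    exact ⟨a, b, this ▸ hM⟩
  | succ k ih =>
    obtain ⟨c, hc⟩ := card_pos.1 (show 0 < #Sᶜ by omega)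
    have hcS : c ∉ S := by simpa using hc
    obtain ⟨x, y, hxy, -, -, hd⟩ := h c hcS ∅ (by rw [card_empty]; omega)
    have hne : ∀ e ∈ S, e ≠ c := fun e he h => hcS (h ▸ he)
    have hcard : #(insert c S)ᶜ = k := by
      rw [compl_insert, card_erase_of_mem hc, hk]
      rfl
    refine ih (hM.insert_edge hcS hxy (fun d hdS => ⟨(hd d hdS).1, (hd d hdS).2.1⟩)
      fun d hdS => (hd d hdS).2.2) ?_ hcard
    intro c' hc' W hW
    rw [mem_insert, not_or] at hc'
    have h1 := card_insert_le y W
    have h2 := card_insert_le x (insert y W)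
    -- The forbidden set gains two vertices while the number of missing colours drops by one, so the
    -- hypothesis passes to the induction step.
    obtain ⟨x', y', h3, h4, h5, h6⟩ := h c' hc'.2 (insert x (insert y W)) (by omega)
    simp only [mem_insert, not_or] at h4 h5
    refine ⟨x', y', h3, h4.2.2, h5.2.2, fun d hdS => ?_⟩
    rcases mem_insert.1 hdS with rfl | hdS
    · simp only [Function.update_self]
      exact ⟨Ne.symm h4.1, Ne.symm h4.2.1, Ne.symm h5.1, Ne.symm h5.2.1⟩
    · simp only [Function.update_of_ne (hne d hdS)]
      exact h6 d hdS

/-- Removing a set of vertices from a disjoint union of cliques isolates few other vertices. -/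
lemma card_support_le [Fintype V] {H : SimpleGraph V}
    (hT : ∀ x y z, H.Adj x y → H.Adj y z → x ≠ z → H.Adj x z) (W : Finset V) :
    #{v | ∃ w, H.Adj v w} ≤ #{v | v ∉ W ∧ ∃ w, w ∉ W ∧ H.Adj v w} +
      2 * #{v ∈ W | ∃ w, H.Adj v w} := by
  set P : Finset V := {v | v ∉ W ∧ ∃ w, w ∉ W ∧ H.Adj v w}
  set Q : Finset V := {v ∈ W | ∃ w, H.Adj v w}
  set L : Finset V := {v | v ∉ W ∧ (∃ w, H.Adj v w) ∧ ∀ w, H.Adj v w → w ∈ W} with hL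
  -- Two isolated vertices with a common removed neighbour would be adjacent, so choosing a removed
  -- neighbour is injective.
  have hLQ : #L ≤ #Q := by
    have h1 : ∀ v ∈ L, ∃ w, H.Adj v w := fun v hv => (mem_filter.1 hv).2.2.1
    choose! g hg using h1
    refine card_le_card_of_injOn g ?_ ?_
    · intro v hv
      have hv := mem_coe.1 hv
      exact mem_coe.2 (mem_filter.2 ⟨(mem_filter.1 hv).2.2.2 _ (hg v hv), v, (hg v hv).symm⟩)
    · intro v hv v' hv' heq
      have hv := mem_coe.1 hv
      have hv' := mem_coe.1 hv'
      by_contra hne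
      have h2 := hg v hv
      rw [heq] at h2
      exact (mem_filter.1 hv').2.1 ((mem_filter.1 hv).2.2.2 _ (hT _ _ _ h2 (hg v' hv').symm hne))
  have hsub : ({v | ∃ w, H.Adj v w} : Finset V) ⊆ (P ∪ Q) ∪ L := by
    intro v hv
    have hv := (mem_filter.1 hv).2
    by_cases hvW : v ∈ W
    · exact mem_union_left _ (mem_union_right _ (mem_filter.2 ⟨hvW, hv⟩))
    · by_cases h : ∃ w, w ∉ W ∧ H.Adj v w
      · exact mem_union_left _ (mem_union_left _ (mem_filter.2 ⟨mem_univ _, hvW, h⟩))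
      · push Not at h
        refine mem_union_right _ (mem_filter.2 ⟨mem_univ _, hvW, hv, fun w hw => ?_⟩)
        by_contra hwW
        exact h w hwW hw
  have h1 := card_le_card hsub
  have h2 := card_union_le (P ∪ Q) L
  have h3 := card_union_le P Q
  omega

lemma exists_adj_avoiding [Fintype V] {H : SimpleGraph V}
    (hT : ∀ x y z, H.Adj x y → H.Adj y z → x ≠ z → H.Adj x z) (W : Finset V)
    (h : 2 * #W < #{v | ∃ w, H.Adj v w}) : ∃ x y, H.Adj x y ∧ x ∉ W ∧ y ∉ W := by
  have h1 := card_support_le hT W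
  have h2 := card_le_card (filter_subset (fun v => ∃ w, H.Adj v w) W)
  obtain ⟨v, hv⟩ := card_pos.1 (show 0 < #{v | v ∉ W ∧ ∃ w, w ∉ W ∧ H.Adj v w} by omega)
  obtain ⟨-, h3, w, h4, h5⟩ := mem_filter.1 hv
  exact ⟨v, w, h5, h3, h4⟩

/-- A disjoint union of cliques contains a large matching. -/
lemma exists_matching [Fintype V] {H : SimpleGraph V}
    (hT : ∀ x y z, H.Adj x y → H.Adj y z → x ≠ z → H.Adj x z) :
    ∃ (X : Finset V) (f : V → V), Set.InjOn f (X : Set V) ∧ (∀ x ∈ X, H.Adj x (f x)) ∧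
      #{v | ∃ w, H.Adj v w} ≤ 4 * #X := by
  obtain ⟨X, ⟨f, h1, h2, h3⟩, hmax⟩ := exists_card_max (P := fun X : Finset V => ∃ f : V → V,
    Set.InjOn f (X : Set V) ∧ (∀ x ∈ X, H.Adj x (f x)) ∧ ∀ x ∈ X, f x ∉ X)
    ⟨id, by simp, by simp, by simp⟩
  refine ⟨X, f, h1, h2, ?_⟩
  by_contra! hlt
  have hc := card_union_le X (X.image f)
  have hc' := card_image_le (s := X) (f := f)
  -- Removing the at most 2 #X matched vertices spoils at most 4 #X vertices, so a smaller maximum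
  -- matching could be extended.
  obtain ⟨x, y, hxy, hx, hy⟩ := exists_adj_avoiding hT (X ∪ X.image f) (by omega)
  rw [mem_union, not_or] at hx hy
  have hne : ∀ z ∈ X, z ≠ x := fun z hz h => hx.1 (h ▸ hz)
  have := hmax (insert x X) ⟨Function.update f x y, ?_, ?_, ?_⟩
  · rw [card_insert_of_notMem hx.1] at this
    omega
  · rw [coe_insert, Set.injOn_insert (by simpa using hx.1)]
    refine ⟨h1.congr fun z hz => (Function.update_of_ne (hne z hz) _ _).symm, ?_⟩
    rintro ⟨z, hz, h⟩
    rw [Function.update_of_ne (hne z hz), Function.update_self] at h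
    exact hy.2 (mem_image.2 ⟨z, hz, h⟩)
  · intro z hz
    rcases mem_insert.1 hz with rfl | hz
    · simpa using hxy
    · simpa [Function.update_of_ne (hne z hz)] using h2 z hz
  · intro z hz
    rcases mem_insert.1 hz with rfl | hz
    · simpa using ⟨hxy.ne', hy.1⟩
    · rw [Function.update_of_ne (hne z hz), mem_insert, not_or]
      exact ⟨fun h => hx.2 (mem_image.2 ⟨z, hz, h⟩), h3 z hz⟩

/-- Colour classes with many vertices have a full rainbow matching for trivial reasons. -/
theorem exists_full_of_large [Fintype V] [Fintype κ] [Nonempty V]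
    (hT : ∀ c x y z, (G c).Adj x y → (G c).Adj y z → x ≠ z → (G c).Adj x z)
    (h : ∀ c, 4 * Fintype.card κ ≤ #{v | ∃ w, (G c).Adj v w}) : ∃ a b, IsRM G univ a b := by
  refine IsRM.exists_full (S := ∅) (a := fun _ => Classical.arbitrary V)
    (b := fun _ => Classical.arbitrary V) ⟨by simp, by simp, by simp, by simp⟩ ?_
  intro c _ W hW
  rw [compl_empty, card_univ] at hW
  obtain ⟨x, y, h1, h2, h3⟩ := exists_adj_avoiding (hT c) W (by have := h c; omega)
  exact ⟨x, y, h1, h2, h3, by simp⟩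

end NearlyFull

/-! ### Chernoff bounds and the random reservoir. -/

section Random

/-- Exponential moment, without normalisation, of a random set containing each vertex independently
with probability 1/(k+1), namely the fibre of f over 0. The sum factorises over vertices and 1 + x ≤
eˣ bounds each factor. -/
lemma sum_exp_card_le [Fintype V] (A : Finset V) (k : ℕ) (θ : ℝ) :
    ∑ f : V → Fin (k + 1), Real.exp (θ * #{v ∈ A | f v = 0}) ≤
      ((k : ℝ) + 1) ^ Fintype.card V * Real.exp ((Real.exp θ - 1) * (#A / ((k : ℝ) + 1))) := by
  have hk : (0 : ℝ) < (k : ℝ) + 1 := by positivity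
  have h1 : ∀ f : V → Fin (k + 1), Real.exp (θ * #{v ∈ A | f v = 0}) =
      ∏ v, if v ∈ A ∧ f v = 0 then Real.exp θ else 1 := by
    intro f
    rw [prod_ite, prod_const, prod_const_one, mul_one, mul_comm, Real.exp_nat_mul]
    congr 2
    ext v
    simp
  have h2 : ∑ f : V → Fin (k + 1), Real.exp (θ * #{v ∈ A | f v = 0}) =
      ∏ v, ∑ i : Fin (k + 1), if v ∈ A ∧ i = 0 then Real.exp θ else 1 := by
    rw [prod_univ_sum, Fintype.piFinset_univ]
    exact sum_congr rfl fun f _ => h1 f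
  have h3 : ∀ v, (∑ i : Fin (k + 1), if v ∈ A ∧ i = 0 then Real.exp θ else 1) ≤
      ((k : ℝ) + 1) * if v ∈ A then Real.exp ((Real.exp θ - 1) / ((k : ℝ) + 1)) else 1 := by
    intro v
    by_cases hv : v ∈ A
    · simp only [hv, true_and, if_true]
      rw [Fin.sum_univ_succ]
      simp only [if_true, Fin.succ_ne_zero, if_false, sum_const, card_univ, Fintype.card_fin,
        nsmul_eq_mul, mul_one]
      have := Real.add_one_le_exp ((Real.exp θ - 1) / ((k : ℝ) + 1))
      calc Real.exp θ + k = ((k : ℝ) + 1) * ((Real.exp θ - 1) / ((k : ℝ) + 1) + 1) := by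
            field_simp
            ring
        _ ≤ _ := mul_le_mul_of_nonneg_left this hk.le
    · simp [hv]
  rw [h2]
  refine (prod_le_prod (fun v _ => sum_nonneg fun i _ => ?_) fun v _ => h3 v).trans ?_
  · split_ifs
    · exact (Real.exp_pos _).le
    · exact zero_le_one
  · rw [prod_mul_distrib, prod_const, card_univ, prod_ite, prod_const, prod_const_one, mul_one,
      ← Real.exp_nat_mul]
    apply le_of_eq
    congr 2
    have : ({x | x ∈ A} : Finset V) = A := by ext; simp
    rw [this]
    field_simp

/-- Markov's inequality for the exponential moment; positive θ gives the upper tail and negative θ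
the lower one. -/
lemma card_tail_le [Fintype V] (A : Finset V) (k : ℕ) (θ T : ℝ) :
    (#{f : V → Fin (k + 1) | T ≤ θ * #{v ∈ A | f v = 0}} : ℝ) ≤
      ((k : ℝ) + 1) ^ Fintype.card V *
        Real.exp ((Real.exp θ - 1) * (#A / ((k : ℝ) + 1)) - T) := by
  set C : Finset (V → Fin (k + 1)) := {f | T ≤ θ * #{v ∈ A | f v = 0}} with hC
  have h1 : (#C : ℝ) * Real.exp T ≤
      ∑ f : V → Fin (k + 1), Real.exp (θ * #{v ∈ A | f v = 0}) := by
    calc (#C : ℝ) * Real.exp T = ∑ f ∈ C, Real.exp T := by rw [sum_const, nsmul_eq_mul]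
      _ ≤ ∑ f ∈ C, Real.exp (θ * #{v ∈ A | f v = 0}) :=
        sum_le_sum fun f hf => Real.exp_le_exp.2 (mem_filter.1 hf).2
      _ ≤ _ := sum_le_sum_of_subset_of_nonneg (subset_univ C) fun f _ _ => (Real.exp_pos _).le
  rw [Real.exp_sub, ← mul_div_assoc, le_div_iff₀ (Real.exp_pos T)]
  exact h1.trans (sum_exp_card_le A k θ)

/-- A random set meets each of few given large sets in about the expected number of elements. -/
lemma exists_random_set [Fintype V] {ι : Type*} [Fintype ι] (A : ι → Finset V) {q : ℕ}
    (hq : 1 ≤ q) {L : ℝ} (hL : ∀ i, L ≤ #(A i))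
    (h : 2 * (Fintype.card ι : ℝ) * Real.exp (-(L / (10 * q))) < 1) :
    ∃ R : Finset V, ∀ i, (#(A i) : ℝ) / (2 * q) ≤ #{v ∈ A i | v ∈ R} ∧
      (#{v ∈ A i | v ∈ R} : ℝ) ≤ 4 * #(A i) / q := by
  obtain ⟨k, rfl⟩ : ∃ k, q = k + 1 := ⟨q - 1, by omega⟩
  push_cast at h ⊢
  have hk : (0 : ℝ) < (k : ℝ) + 1 := by positivity
  set b₁ : ι → Finset (V → Fin (k + 1)) := fun i =>
    {f | 4 * (#(A i) / ((k : ℝ) + 1)) ≤ 1 * #{v ∈ A i | f v = 0}} with hb₁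
  set b₂ : ι → Finset (V → Fin (k + 1)) := fun i =>
    {f | -(1 / 2 * (#(A i) / ((k : ℝ) + 1))) ≤ -1 * #{v ∈ A i | f v = 0}} with hb₂
  -- The exponents used are e − 1 − 4 and e⁻¹ − 1 + 1/2, both below −1/10.
  have hE : ∀ i (x : ℝ), x ≤ -(1 / 10) →
      Real.exp (x * (#(A i) / ((k : ℝ) + 1))) ≤ Real.exp (-(L / (10 * ((k : ℝ) + 1)))) := by
    intro i x hx
    rw [Real.exp_le_exp]
    have h1 : x * (#(A i) / ((k : ℝ) + 1)) ≤ -(1 / 10) * (#(A i) / ((k : ℝ) + 1)) :=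
      mul_le_mul_of_nonneg_right hx (by positivity)
    refine h1.trans ?_
    have h2 : L / (10 * ((k : ℝ) + 1)) ≤ #(A i) / (10 * ((k : ℝ) + 1)) :=
      div_le_div_of_nonneg_right (hL i) (by positivity)
    have h3 : -(1 / 10) * (#(A i) / ((k : ℝ) + 1)) = -(#(A i) / (10 * ((k : ℝ) + 1))) := by
      field_simp
    rw [h3]
    linarith
  set p := ((k : ℝ) + 1) ^ Fintype.card V with hp
  have hp0 : 0 < p := by positivity
  have c₁ : ∀ i, (#(b₁ i) : ℝ) ≤ p * Real.exp (-(L / (10 * ((k : ℝ) + 1)))) := by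
    intro i
    refine (card_tail_le (A i) k 1 _).trans (mul_le_mul_of_nonneg_left ?_ hp0.le)
    rw [← sub_mul]
    refine hE i _ ?_
    have := Real.exp_one_lt_d9
    linarith
  have c₂ : ∀ i, (#(b₂ i) : ℝ) ≤ p * Real.exp (-(L / (10 * ((k : ℝ) + 1)))) := by
    intro i
    refine (card_tail_le (A i) k (-1) _).trans (mul_le_mul_of_nonneg_left ?_ hp0.le)
    rw [sub_neg_eq_add, ← add_mul]
    refine hE i _ ?_
    have := Real.exp_neg_one_lt_d9
    linarith
  have hcard : #(univ.biUnion fun i => b₁ i ∪ b₂ i) < #(univ : Finset (V → Fin (k + 1))) := by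
    have h1 : (#(univ.biUnion fun i => b₁ i ∪ b₂ i) : ℝ) ≤
        ∑ i : ι, (2 * (p * Real.exp (-(L / (10 * ((k : ℝ) + 1)))))) := by
      have : #(univ.biUnion fun i => b₁ i ∪ b₂ i) ≤ ∑ i, (#(b₁ i) + #(b₂ i)) :=
        card_biUnion_le.trans (sum_le_sum fun i _ => card_union_le _ _)
      refine (Nat.cast_le.2 this).trans ?_
      push_cast
      exact sum_le_sum fun i _ => by linarith [c₁ i, c₂ i]
    rw [sum_const, card_univ, nsmul_eq_mul] at h1
    have h2 : (#(univ : Finset (V → Fin (k + 1))) : ℝ) = p := by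
      rw [card_univ, Fintype.card_fun, Fintype.card_fin, hp]
      push_cast
      ring
    rw [← Nat.cast_lt (α := ℝ), h2]
    refine h1.trans_lt ?_
    have := mul_lt_mul_of_pos_left h hp0
    nlinarith
  obtain ⟨f, -, hf⟩ := exists_mem_notMem_of_card_lt_card hcard
  refine ⟨({v | f v = 0} : Finset V), fun i => ?_⟩
  have hfi : f ∉ b₁ i ∧ f ∉ b₂ i := by
    refine ⟨fun h => hf ?_, fun h => hf ?_⟩
    · exact mem_biUnion.2 ⟨i, mem_univ _, mem_union_left _ h⟩
    · exact mem_biUnion.2 ⟨i, mem_univ _, mem_union_right _ h⟩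
  have hset : ({v ∈ A i | v ∈ ({v | f v = 0} : Finset V)} : Finset V) = {v ∈ A i | f v = 0} := by
    ext v
    simp
  rw [hset]
  have h1 := hfi.1
  have h2 := hfi.2
  simp only [hb₁, hb₂, mem_filter, mem_univ, true_and, not_le] at h1 h2
  constructor
  · rw [show (#(A i) : ℝ) / (2 * ((k : ℝ) + 1)) = 1 / 2 * (#(A i) / ((k : ℝ) + 1)) by field_simp]
    linarith
  · rw [mul_div_assoc]
    linarith

/-- A random set which contains few vertices of each colour class, but many edges. -/
lemma exists_reservoir [Fintype V] [Fintype κ] {G : κ → SimpleGraph V}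
    (hT : ∀ c x y z, (G c).Adj x y → (G c).Adj y z → x ≠ z → (G c).Adj x z) {q : ℕ} (hq : 1 ≤ q)
    {L : ℝ} (hL0 : 0 ≤ L) (hL : ∀ c, L ≤ #{v | ∃ w, (G c).Adj v w})
    (h : 4 * (Fintype.card κ : ℝ) * Real.exp (-(L / (80 * (q : ℝ) ^ 2))) < 1) :
    ∃ R : Finset V, ∀ c, (#{v ∈ R | ∃ w, (G c).Adj v w} : ℝ) ≤
        8 * #{v | ∃ w, (G c).Adj v w} / q ∧
      ∃ (X : Finset V) (f : V → V), Set.InjOn f (X : Set V) ∧ X ⊆ R ∧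
        (∀ x ∈ X, (G c).Adj x (f x) ∧ f x ∈ R) ∧ L / (16 * (q : ℝ) ^ 2) ≤ #X := by
  set P : κ → Finset V := fun c => {v | ∃ w, (G c).Adj v w} with hP
  have hq' : (1 : ℝ) ≤ q := by exact_mod_cast hq
  choose X f hf1 hf2 hf3 using fun c => exists_matching (hT c)
  have hmono : ∀ L' : ℝ, L / (8 * q) ≤ L' →
      2 * (Fintype.card (κ ⊕ κ) : ℝ) * Real.exp (-(L' / (10 * q))) < 1 := by
    intro L' hL'
    refine lt_of_le_of_lt ?_ h
    rw [Fintype.card_sum]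
    push_cast
    rw [show 2 * ((Fintype.card κ : ℝ) + Fintype.card κ) = 4 * Fintype.card κ by ring]
    refine mul_le_mul_of_nonneg_left (Real.exp_le_exp.2 (neg_le_neg ?_)) (by positivity)
    calc L / (80 * (q : ℝ) ^ 2) = L / (8 * q) / (10 * q) := by field_simp; ring
      _ ≤ _ := div_le_div_of_nonneg_right hL' (by positivity)
  have hX : ∀ c, L / 4 ≤ #(X c) := by
    intro c
    have h1 : (#(P c) : ℝ) ≤ 4 * #(X c) := by exact_mod_cast hf3 c
    linarith [hL c]
  have hPL : ∀ c, L / 4 ≤ #(P c) := fun c => by linarith [hL c]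
  -- The first set samples the ends x of a matching in each colour, and a second one samples the
  -- partners of those chosen. With two stages, only numbers of single vertices need concentration,
  -- never of pairs.
  obtain ⟨R₁, hR₁⟩ := exists_random_set (Sum.elim P X) hq (L := L / 4)
    (by rintro (c | c); exacts [hPL c, hX c]) (hmono _ (by
      rw [div_le_div_iff₀ (by positivity) (by norm_num)]
      nlinarith))
  set Y : κ → Finset V := fun c => (filter (fun v => v ∈ R₁) (X c)).image (f c) with hY
  have hYcard : ∀ c, #(Y c) = #(filter (fun v => v ∈ R₁) (X c)) := fun c =>
    card_image_of_injOn ((hf1 c).mono fun v hv => (mem_filter.1 hv).1)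
  have hYL : ∀ c, L / (8 * q) ≤ #(Y c) := by
    intro c
    rw [hYcard]
    refine le_trans ?_ (hR₁ (Sum.inr c)).1
    rw [Sum.elim_inr, show L / (8 * (q : ℝ)) = L / 4 / (2 * q) by field_simp; ring]
    exact div_le_div_of_nonneg_right (hX c) (by positivity)
  have hL8 : L / (8 * q) ≤ L / 4 := by
    rw [div_le_div_iff₀ (by positivity) (by norm_num)]
    nlinarith
  obtain ⟨R₂, hR₂⟩ := exists_random_set (Sum.elim P Y) hq (L := L / (8 * q))
    (by rintro (c | c); exacts [hL8.trans (hPL c), hYL c]) (hmono _ le_rfl)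
  refine ⟨R₁ ∪ R₂, fun c => ⟨?_, ?_⟩⟩
  · have h1 := (hR₁ (Sum.inl c)).2
    have h2 := (hR₂ (Sum.inl c)).2
    simp only [Sum.elim_inl] at h1 h2
    have h3 : #{v ∈ R₁ ∪ R₂ | ∃ w, (G c).Adj v w} ≤
        #(filter (fun v => v ∈ R₁) (P c)) + #(filter (fun v => v ∈ R₂) (P c)) := by
      refine (card_le_card ?_).trans (card_union_le _ _)
      intro v hv
      obtain ⟨h4, h5⟩ := mem_filter.1 hv
      have h6 : v ∈ P c := mem_filter.2 ⟨mem_univ _, h5⟩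
      rcases mem_union.1 h4 with h4 | h4
      · exact mem_union_left _ (mem_filter.2 ⟨h6, h4⟩)
      · exact mem_union_right _ (mem_filter.2 ⟨h6, h4⟩)
    have h3' : (#{v ∈ R₁ ∪ R₂ | ∃ w, (G c).Adj v w} : ℝ) ≤
        #(filter (fun v => v ∈ R₁) (P c)) + #(filter (fun v => v ∈ R₂) (P c)) := by
      exact_mod_cast h3
    refine h3'.trans ((add_le_add h1 h2).trans (le_of_eq ?_))
    ring
  · refine ⟨{x ∈ X c | x ∈ R₁ ∧ f c x ∈ R₂}, f c,
      (hf1 c).mono fun v hv => (mem_filter.1 hv).1, ?_, ?_, ?_⟩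
    · intro x hx
      exact mem_union_left _ (mem_filter.1 hx).2.1
    · intro x hx
      exact ⟨hf2 c x (mem_filter.1 hx).1, mem_union_right _ (mem_filter.1 hx).2.2⟩
    · have h1 := (hR₂ (Sum.inr c)).1
      simp only [Sum.elim_inr] at h1
      have h2 : #(filter (fun v => v ∈ R₂) (Y c)) ≤ #{x ∈ X c | x ∈ R₁ ∧ f c x ∈ R₂} := by
        refine (card_le_card ?_).trans (card_image_le (f := f c))
        intro y hy
        obtain ⟨h3, h4⟩ := mem_filter.1 hy
        obtain ⟨x, hx, rfl⟩ := mem_image.1 h3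
        obtain ⟨h5, h6⟩ := mem_filter.1 hx
        exact mem_image_of_mem _ (mem_filter.2 ⟨h5, h6, h4⟩)
      refine le_trans ?_ (h1.trans (Nat.cast_le.2 h2))
      rw [show L / (16 * (q : ℝ) ^ 2) = L / (8 * q) / (2 * q) by field_simp; ring]
      exact div_le_div_of_nonneg_right (hYL c) (by positivity)

end Random

/-! ### Choice of the parameters. -/

section Parameters

lemma sq_div_two_le_exp {y : ℝ} (hy : 0 ≤ y) : y ^ 2 / 2 ≤ Real.exp y := by
  have := Real.quadratic_le_exp_of_nonneg hy
  linarith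

/-- As 625 < e⁷, the power is at most exp(35·10⁸x³); the remaining exp(65·10⁸x³) exceeds 10¹²x³. -/
lemma pow_le_of_exp_le {x : ℝ} {n l : ℕ} (hx0 : 0 < x) (hx3 : 1 / 8 ≤ x ^ 3)
    (hn : Real.exp (10 ^ 10 * x ^ 3) ≤ n) (hl2 : (l : ℝ) ≤ 5 * 10 ^ 8 * x ^ 3) :
    (625 : ℝ) ^ l ≤ 1 / 10 ^ 12 * (n / x ^ 3) := by
  have h1 : (625 : ℝ) ≤ Real.exp 7 := by
    have h2 : Real.exp 7 = Real.exp 1 ^ 7 := by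
      rw [← Real.exp_nat_mul]
      norm_num
    have h3 : (2.7 : ℝ) ≤ Real.exp 1 := by
      have := Real.exp_one_gt_d9
      linarith
    rw [h2]
    calc (625 : ℝ) ≤ 2.7 ^ 7 := by norm_num
      _ ≤ _ := pow_le_pow_left₀ (by norm_num) h3 7
  have h2 : (625 : ℝ) ^ l ≤ Real.exp (35 * 10 ^ 8 * x ^ 3) := by
    calc (625 : ℝ) ^ l ≤ Real.exp 7 ^ l := pow_le_pow_left₀ (by norm_num) h1 l
      _ = Real.exp (l * 7) := (Real.exp_nat_mul _ _).symm
      _ ≤ _ := Real.exp_le_exp.2 (by linarith)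
  have h3 : 10 ^ 12 * x ^ 3 ≤ Real.exp (65 * 10 ^ 8 * x ^ 3) := by
    refine le_trans ?_ (sq_div_two_le_exp (by positivity))
    have h5 : 0 ≤ x ^ 3 * (x ^ 3 - 1 / 8) := mul_nonneg (by positivity) (by linarith)
    linarith only [h5, hx3]
  have h4 : 10 ^ 12 * x ^ 3 * 625 ^ l ≤ (n : ℝ) := by
    refine le_trans ?_ hn
    rw [show (10 : ℝ) ^ 10 * x ^ 3 = 65 * 10 ^ 8 * x ^ 3 + 35 * 10 ^ 8 * x ^ 3 by ring,
      Real.exp_add]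
    exact mul_le_mul h3 h2 (by positivity) (Real.exp_pos _).le
  rw [← mul_div_assoc, le_div_iff₀ (by positivity)]
  linarith

-- Here x stands for 1/ε. The reservoir has density 1/q of order ε and serves t of order ε²n missing
-- colours, and g of order εn vertices remain to spare. The inequality with tg then asks for r of
-- order ε³n, hence l of order ε⁻³ rounds, and 625^l must stay below about ε³n. This is why log n
-- has to be at least of order ε⁻³.
set_option maxHeartbeats 1000000 in
lemma exists_parameters {x : ℝ} {n : ℕ} (hx : 1 / 2 ≤ x)
    (hn : Real.exp (10 ^ 10 * x ^ 3) ≤ n) :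
    ∃ q t g r l : ℕ, 1 ≤ q ∧ 192 * x ≤ q ∧
      4 * (n : ℝ) * Real.exp (-(2 * n / (80 * (q : ℝ) ^ 2))) < 1 ∧
      4 * (t : ℝ) ≤ 2 * n / (16 * (q : ℝ) ^ 2) ∧ (g : ℝ) ≤ n / (2 * x) ∧
      3 * n < l * (r + 1) ∧ 2 * r ≤ t ∧ 12 * r + 12 * 25 ^ l ≤ g ∧
      8 * n * (900 * 625 ^ l + r) < t * g := by
  have hx0 : 0 < x := by linarith
  have hx3 : 1 / 8 ≤ x ^ 3 := by
    calc (1 : ℝ) / 8 = (1 / 2) ^ 3 := by norm_num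
      _ ≤ x ^ 3 := pow_le_pow_left₀ (by norm_num) hx 3
  have hn6 : 5 * 10 ^ 19 * x ^ 6 ≤ n := by
    refine le_trans (le_of_eq ?_) ((sq_div_two_le_exp (by positivity)).trans hn)
    ring
  have hn0 : (0 : ℝ) < n := (Real.exp_pos _).trans_le hn
  have hn4 : 10 ^ 19 * x ^ 4 ≤ n := by
    refine le_trans ?_ hn6
    have : 1 / 4 ≤ x ^ 2 := by nlinarith
    have h4 : 0 ≤ x ^ 4 := by positivity
    nlinarith [mul_le_mul_of_nonneg_left this h4]
  have hn2 : 2 * 10 ^ 18 * x ^ 2 ≤ n := by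
    refine le_trans ?_ hn4
    have : 1 / 4 ≤ x ^ 2 := by nlinarith
    nlinarith [mul_le_mul_of_nonneg_left this (sq_nonneg x)]
  have hn1 : 10 ^ 18 * x ≤ n := by nlinarith
  -- the choice of the parameters
  obtain ⟨q, hq⟩ : ∃ q, q = ⌈192 * x⌉₊ := ⟨_, rfl⟩
  obtain ⟨t, ht⟩ : ∃ t, t = ⌊(n : ℝ) / (32 * (q : ℝ) ^ 2)⌋₊ := ⟨_, rfl⟩
  obtain ⟨g, hg⟩ : ∃ g, g = ⌊(n : ℝ) / (2 * x)⌋₊ := ⟨_, rfl⟩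
  obtain ⟨r, hr⟩ : ∃ r, r = ⌊(n : ℝ) / (10 ^ 8 * x ^ 3)⌋₊ := ⟨_, rfl⟩
  obtain ⟨l, hl⟩ : ∃ l, l = ⌈4 * 10 ^ 8 * x ^ 3⌉₊ := ⟨_, rfl⟩
  have hq1 : 192 * x ≤ q := hq ▸ Nat.le_ceil _
  have hq2 : (q : ℝ) ≤ 194 * x := by
    have := Nat.ceil_lt_add_one (show 0 ≤ 192 * x by positivity)
    rw [← hq] at this
    linarith
  have hq0 : (0 : ℝ) < q := by linarith
  have hqq : (q : ℝ) ^ 2 ≤ 37636 * x ^ 2 := by nlinarith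
  have ht1 : (t : ℝ) ≤ n / (32 * (q : ℝ) ^ 2) := ht ▸ Nat.floor_le (by positivity)
  have ht2 : (n : ℝ) / (1300000 * x ^ 2) ≤ t := by
    have h1 := Nat.lt_floor_add_one ((n : ℝ) / (32 * (q : ℝ) ^ 2))
    rw [← ht] at h1
    have h2 : (n : ℝ) / (1204352 * x ^ 2) ≤ n / (32 * (q : ℝ) ^ 2) :=
      div_le_div_of_nonneg_left hn0.le (by positivity) (by linarith)
    have h3 : (n : ℝ) / (1300000 * x ^ 2) + 1 ≤ n / (1204352 * x ^ 2) := by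
      have h5 : (10 : ℝ) ^ 9 ≤ n / x ^ 2 := by
        rw [le_div_iff₀ (by positivity)]
        linarith
      have h6 : (n : ℝ) / (1300000 * x ^ 2) = n / x ^ 2 * (1 / 1300000) := by field_simp
      have h7 : (n : ℝ) / (1204352 * x ^ 2) = n / x ^ 2 * (1 / 1204352) := by field_simp
      rw [h6, h7]
      linarith
    linarith
  have hg1 : (g : ℝ) ≤ n / (2 * x) := hg ▸ Nat.floor_le (by positivity)
  have hg2 : 49 / 100 * (n / x) ≤ g := by
    have h1 := Nat.lt_floor_add_one ((n : ℝ) / (2 * x))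
    rw [← hg] at h1
    have h5 : (10 : ℝ) ^ 9 ≤ n / x := by
      rw [le_div_iff₀ (by positivity)]
      linarith
    have h6 : (n : ℝ) / (2 * x) = n / x * (1 / 2) := by field_simp
    rw [h6] at h1
    linarith
  have hr1 : (r : ℝ) ≤ n / (10 ^ 8 * x ^ 3) := hr ▸ Nat.floor_le (by positivity)
  have hr2 : n / (10 ^ 8 * x ^ 3) < (r : ℝ) + 1 := hr ▸ Nat.lt_floor_add_one _
  have hl1 : 4 * 10 ^ 8 * x ^ 3 ≤ l := hl ▸ Nat.le_ceil _
  have hl2 : (l : ℝ) ≤ 5 * 10 ^ 8 * x ^ 3 := by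
    have := Nat.ceil_lt_add_one (show 0 ≤ 4 * 10 ^ 8 * x ^ 3 by positivity)
    rw [← hl] at this
    linarith
  have h625 := pow_le_of_exp_le hx0 hx3 hn hl2
  have hx1 : (n : ℝ) / x ^ 3 ≤ 4 * (n / x) := by
    rw [div_le_iff₀ (by positivity)]
    have : 4 * ((n : ℝ) / x) * x ^ 3 = n * (4 * x ^ 2) := by field_simp
    rw [this]
    have : 1 ≤ 4 * x ^ 2 := by nlinarith
    nlinarith
  have hx2 : (n : ℝ) / x ^ 3 ≤ 2 * (n / x ^ 2) := by
    rw [div_le_iff₀ (by positivity)]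
    have : 2 * ((n : ℝ) / x ^ 2) * x ^ 3 = n * (2 * x) := by field_simp
    rw [this]
    have : 1 ≤ 2 * x := by linarith
    nlinarith
  have hr1' : (r : ℝ) ≤ 1 / 10 ^ 8 * (n / x ^ 3) := by
    refine hr1.trans (le_of_eq ?_)
    field_simp
  have ht2' : 1 / 1300000 * (n / x ^ 2) ≤ (t : ℝ) := by
    refine le_trans (le_of_eq ?_) ht2
    field_simp
  have hnx2 : 0 < (n : ℝ) / x ^ 2 := by positivity
  have hnx : 0 < (n : ℝ) / x := by positivity
  have hnx3 : 0 < (n : ℝ) / x ^ 3 := by positivity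
  refine ⟨q, t, g, r, l, ?_, hq1, ?_, ?_, hg1, ?_, ?_, ?_, ?_⟩
  · exact_mod_cast hq0
  · rw [Real.exp_neg, ← div_eq_mul_inv, div_lt_one (Real.exp_pos _)]
    refine lt_of_lt_of_le ?_ (sq_div_two_le_exp (by positivity))
    have h1 : (n : ℝ) / (1505440 * x ^ 2) ≤ 2 * n / (80 * (q : ℝ) ^ 2) := by
      rw [div_le_div_iff₀ (by positivity) (by positivity)]
      nlinarith
    have h2 : ((n : ℝ) / (1505440 * x ^ 2)) ^ 2 ≤ (2 * n / (80 * (q : ℝ) ^ 2)) ^ 2 :=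
      pow_le_pow_left₀ (by positivity) h1 2
    refine lt_of_lt_of_le ?_ (div_le_div_of_nonneg_right h2 (by norm_num))
    rw [div_pow, div_div, lt_div_iff₀ (by positivity)]
    have h3 : 4 * (n : ℝ) * ((1505440 * x ^ 2) ^ 2 * 2) = n * (8 * 1505440 ^ 2 * x ^ 4) := by ring
    rw [h3, pow_two (n : ℝ)]
    refine mul_lt_mul_of_pos_left ?_ hn0
    have : 0 < x ^ 4 := by positivity
    linarith
  · calc 4 * (t : ℝ) ≤ 4 * (n / (32 * (q : ℝ) ^ 2)) := by linarith
      _ = _ := by field_simp; norm_num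
  · rw [← Nat.cast_lt (α := ℝ)]
    push_cast
    have h1 : 4 * 10 ^ 8 * x ^ 3 * (n / (10 ^ 8 * x ^ 3)) ≤ (l : ℝ) * (r + 1) :=
      mul_le_mul hl1 hr2.le (by positivity) (by positivity)
    have h2 : 4 * 10 ^ 8 * x ^ 3 * (n / (10 ^ 8 * x ^ 3)) = 4 * (n : ℝ) := by field_simp
    linarith
  · rw [← Nat.cast_le (α := ℝ)]
    push_cast
    linarith
  · rw [← Nat.cast_le (α := ℝ)]
    push_cast
    have : (25 : ℝ) ^ l ≤ 625 ^ l := pow_le_pow_left₀ (by norm_num) (by norm_num) l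
    linarith
  · rw [← Nat.cast_lt (α := ℝ)]
    push_cast
    have h1 : 900 * 625 ^ l + (r : ℝ) ≤ 2 / 10 ^ 8 * (n / x ^ 3) := by linarith
    have h2 : 8 * (n : ℝ) * (900 * 625 ^ l + r) ≤ 8 * n * (2 / 10 ^ 8 * (n / x ^ 3)) :=
      mul_le_mul_of_nonneg_left h1 (by positivity)
    have h3 : 1 / 1300000 * (n / x ^ 2) * (49 / 100 * (n / x)) ≤ (t : ℝ) * g :=
      mul_le_mul ht2' hg2 (by positivity) (by positivity)
    have h4 : 1 / 1300000 * (n / x ^ 2) * (49 / 100 * (n / x)) =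
        49 / 130000000 * (n * ((n : ℝ) / x ^ 3)) := by field_simp; norm_num
    have h5 : 0 < n * ((n : ℝ) / x ^ 3) := by positivity
    have h6 : 8 * (n : ℝ) * (2 / 10 ^ 8 * (n / x ^ 3)) = 16 / 10 ^ 8 * (n * ((n : ℝ) / x ^ 3)) := by
      ring
    linarith

end Parameters

/-! ### Full rainbow matchings in families of clique unions. -/

section Full

variable {G : κ → SimpleGraph V}

/-- The graph obtained by isolating the vertices of `R`. -/
def avoid (H : SimpleGraph V) (R : Finset V) : SimpleGraph V where
  Adj x y := H.Adj x y ∧ x ∉ R ∧ y ∉ R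
  symm := ⟨fun _ _ h => ⟨h.1.symm, h.2.2, h.2.1⟩⟩
  loopless := ⟨fun _ h => h.1.ne rfl⟩

lemma exists_isMaxRM [Fintype κ] [Nonempty V] (G : κ → SimpleGraph V) :
    ∃ S a b, IsMaxRM G S a b := by
  obtain ⟨S, ⟨a, b, h⟩, hmax⟩ := exists_card_max (P := fun S => ∃ a b, IsRM G S a b)
    ⟨fun _ => Classical.arbitrary V, fun _ => Classical.arbitrary V,
      ⟨by simp, by simp, by simp, by simp⟩⟩
  exact ⟨S, a, b, h, fun S' a' b' h' => hmax S' ⟨a', b', h'⟩⟩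

/-- The maximum matching is taken in the graphs `avoid (G c) R`, so the reservoir R is untouched
when the remaining colours are inserted there. -/
theorem exists_full_of_exp_le [Fintype V] [Fintype κ]
    (hT : ∀ c x y z, (G c).Adj x y → (G c).Adj y z → x ≠ z → (G c).Adj x z) {m : ℕ} {ε : ℝ}
    (hε0 : 0 < ε) (hε : ε ≤ 2) (hn : Real.exp (10 ^ 10 / ε ^ 3) ≤ Fintype.card κ)
    (hm : ∀ x y, x ≠ y → #{c | (G c).Adj x y} ≤ m) (hmn : m ≤ Fintype.card κ)
    (hG : ∀ c, 2 * (Fintype.card κ : ℝ) + 2 * m + ε * Fintype.card κ ≤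
      #{v | ∃ w, (G c).Adj v w}) :
    ∃ a b, IsRM G univ a b := by
  set n := Fintype.card κ with hncard
  have hn0 : (0 : ℝ) < n := (Real.exp_pos _).trans_le hn
  obtain ⟨q, t, g, r, l, hq1, hq, hexp, ht, hg, hl, hrt, hrg, htg⟩ :=
    exists_parameters (x := 1 / ε) (n := n)
      (by rw [div_le_div_iff₀ (by norm_num) hε0]; linarith)
      (by rwa [div_pow, one_pow, mul_one_div])
  have hq0 : (0 : ℝ) < q := by exact_mod_cast hq1
  have hV : Nonempty V := by
    have : Nonempty κ := Fintype.card_pos_iff.1 (by exact_mod_cast hn0)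
    obtain ⟨c⟩ := this
    have h1 := hG c
    have h2 : (0 : ℝ) < #{v | ∃ w, (G c).Adj v w} := lt_of_lt_of_le (by positivity) h1
    obtain ⟨v, -⟩ := card_pos.1 (Nat.cast_pos.1 h2)
    exact ⟨v⟩
  obtain ⟨R, hR⟩ := exists_reservoir hT hq1 (L := 2 * (n : ℝ)) (by positivity)
    (fun c => le_trans (by nlinarith) (hG c)) hexp
  set H : κ → SimpleGraph V := fun c => avoid (G c) R with hH
  have hHT : ∀ c x y z, (H c).Adj x y → (H c).Adj y z → x ≠ z → (H c).Adj x z :=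
    fun c x y z h1 h2 h3 => ⟨hT c x y z h1.1 h2.1 h3, h1.2.1, h2.2.2⟩
  have hHm : ∀ x y, x ≠ y → #{c | (H c).Adj x y} ≤ m := fun x y hxy =>
    (card_le_card (monotone_filter_right _ fun c _ h => h.1)).trans (hm x y hxy)
  have hHG : ∀ c, 2 * n + 2 * m + g ≤ #{v | ∃ w, (H c).Adj v w} := by
    intro c
    have h1 := card_support_le (hT c) R
    have h2 : ({v | v ∉ R ∧ ∃ w, w ∉ R ∧ (G c).Adj v w} : Finset V) =
        ({v | ∃ w, (H c).Adj v w} : Finset V) := by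
      ext v
      simp only [mem_filter, mem_univ, true_and, hH, avoid]
      constructor
      · rintro ⟨h3, w, h4, h5⟩
        exact ⟨w, h5, h3, h4⟩
      · rintro ⟨w, h5, h3, h4⟩
        exact ⟨h3, w, h4, h5⟩
    rw [h2] at h1
    have h3 := (hR c).1
    have h1' : (#{v | ∃ w, (G c).Adj v w} : ℝ) ≤ #{v | ∃ w, (H c).Adj v w} +
        2 * #{v ∈ R | ∃ w, (G c).Adj v w} := by exact_mod_cast h1
    have h4 := hG c
    set p : ℝ := ((#({v | ∃ w, (G c).Adj v w} : Finset V) : ℕ) : ℝ) with hp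
    have hmn' : (m : ℝ) ≤ n := by exact_mod_cast hmn
    -- Deleting R costs a class at most the proportion ε/12. The guaranteed 2n + 2m + εn ≤ 6n
    -- vertices thus shrink by at most εn/2, which leaves g to spare.
    have h5 : 16 / (q : ℝ) ≤ ε / 12 := by
      rw [div_le_div_iff₀ hq0 (by norm_num)]
      have : 192 * (1 / ε) * ε ≤ q * ε := mul_le_mul_of_nonneg_right hq hε0.le
      rw [mul_assoc, one_div_mul_cancel hε0.ne'] at this
      linarith
    have h6 : 2 * (8 * p / q) = 16 / q * p := by ring
    have h7 : p * (1 - ε / 12) ≤ #{v | ∃ w, (H c).Adj v w} := by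
      have : 16 / q * p ≤ ε / 12 * p := mul_le_mul_of_nonneg_right h5 (Nat.cast_nonneg _)
      linarith
    have h8 : (2 * (n : ℝ) + 2 * m + ε * n) * (1 - ε / 12) ≤ p * (1 - ε / 12) :=
      mul_le_mul_of_nonneg_right h4 (by linarith)
    have h9 : (2 * (n : ℝ) + 2 * m + ε * n) * (ε / 12) ≤ ε * n / 2 := by
      have : 2 * (n : ℝ) + 2 * m + ε * n ≤ 6 * n := by nlinarith
      have := mul_le_mul_of_nonneg_right this (show 0 ≤ ε / 12 by positivity)
      linarith
    have h10 : (n : ℝ) / (2 * (1 / ε)) = ε * n / 2 := by field_simp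
    rw [← Nat.cast_le (α := ℝ)]
    push_cast
    linarith
  obtain ⟨S, a, b, hM⟩ := exists_isMaxRM H
  have hcard := hM.card_lt hHT hHm hmn hHG hl hrt hrg htg
  have hSc : #Sᶜ < t := by
    rw [card_compl]
    have := card_le_univ S
    omega
  have hM' : IsRM G S a b :=
    ⟨fun c hc => (hM.adj c hc).1, hM.ne_aa, hM.ne_ab, hM.ne_bb⟩
  refine hM'.exists_full ?_
  intro c _ W hW
  obtain ⟨-, X, f, hf, hXR, hadj, hX⟩ := hR c
  -- W has fewer than 2t vertices and may hit an edge at x or at f x, which spoils fewer than 4t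
  -- edges.
  have hXt : 4 * t ≤ #X := by
    rw [← Nat.cast_le (α := ℝ)]
    push_cast
    linarith
  have h1 : #{x ∈ X | f x ∈ W} ≤ #W := by
    refine card_le_card_of_injOn f (fun x hx => (mem_filter.1 hx).2)
      (hf.mono fun x hx => (mem_filter.1 hx).1)
  have h2 := card_union_le W {x ∈ X | f x ∈ W}
  obtain ⟨x, hx, hx'⟩ := exists_mem_notMem_of_card_lt_card
    (show #(W ∪ {x ∈ X | f x ∈ W}) < #X by omega)
  simp only [mem_union, mem_filter, hx, true_and, not_or] at hx'
  refine ⟨x, f x, (hadj x hx).1, hx'.1, hx'.2, fun d hd => ?_⟩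
  have hd' := (hM.adj d hd).2
  refine ⟨?_, ?_, ?_, ?_⟩
  · rintro rfl
    exact hd'.1 (hXR hx)
  · rintro rfl
    exact hd'.2 (hXR hx)
  · intro h
    exact hd'.1 (h ▸ (hadj x hx).2)
  · intro h
    exact hd'.2 (h ▸ (hadj x hx).2)

end Full

end

/-! ### Translation to coloured multigraphs and the upper bound. -/

section Multigraph

variable {V : Type u₁} {E : Type v₁} {n : ℕ}

/-- The simple graph formed by the edges of colour `c`. -/
def colourGraph (G : ColouredMultigraph V E n) (c : Fin n) : SimpleGraph V where
  Adj x y := ∃ e, G.colour e = c ∧ G.ends e = s(x, y)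
  symm := ⟨fun x y ⟨e, h1, h2⟩ => ⟨e, h1, h2.trans Sym2.eq_swap⟩⟩
  loopless := ⟨fun x ⟨e, _, h2⟩ => G.loopless e (by rw [h2]; exact Sym2.mk_isDiag_iff.2 rfl)⟩

lemma colourGraph_trans {G : ColouredMultigraph V E n} {c : Fin n} {P : Set (Set V)}
    (hP : G.IsCliqueUnion c P) {x y z : V} (hxy : (colourGraph G c).Adj x y)
    (hyz : (colourGraph G c).Adj y z) (hxz : x ≠ z) : (colourGraph G c).Adj x z := by
  obtain ⟨-, hdisj, -, hadj⟩ := hP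
  obtain ⟨-, K, hK, hxK, hyK⟩ := (hadj x y).1 hxy
  obtain ⟨-, L, hL, hyL, hzL⟩ := (hadj y z).1 hyz
  have hKL : K = L := hdisj.elim_set hK hL y hyK hyL
  exact (hadj x z).2 ⟨hxz, K, hK, hxK, hKL ▸ hzL⟩

lemma ncard_le_card_support [Fintype V] {G : ColouredMultigraph V E n} {c : Fin n}
    {P : Set (Set V)} (hP : G.IsCliqueUnion c P) :
    (⋃₀ P).ncard ≤ #{v | ∃ w, (colourGraph G c).Adj v w} := by
  obtain ⟨hnt, -, -, hadj⟩ := hP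
  rw [← Set.ncard_coe_finset]
  refine Set.ncard_le_ncard ?_ (Set.toFinite _)
  rintro v ⟨K, hK, hv⟩
  obtain ⟨w, hw, hwv⟩ := (hnt K hK).exists_ne v
  simp only [coe_filter, mem_univ, true_and, Set.mem_ofPred_eq]
  exact ⟨w, (hadj v w).2 ⟨hwv.symm, K, hK, hv, hw⟩⟩

lemma card_colours_le {G : ColouredMultigraph V E n} {m : ℕ} (hm : G.MultiplicityAtMost m)
    (x y : V) : #{c | (colourGraph G c).Adj x y} ≤ m := by
  have h := hm x y
  have hfin : {e : E | G.ends e = s(x, y)}.Finite := Set.finite_of_encard_le_coe h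
  have h1 : (({c | (colourGraph G c).Adj x y} : Finset (Fin n)) : Set (Fin n)) ⊆
      G.colour '' {e : E | G.ends e = s(x, y)} := by
    intro c hc
    simp only [coe_filter, mem_univ, true_and, Set.mem_ofPred_eq] at hc
    obtain ⟨e, he1, he2⟩ := hc
    exact ⟨e, he2, he1⟩
  have h2 := (Set.encard_le_encard h1).trans ((Set.encard_image_le _ _).trans h)
  rw [Set.encard_coe_eq_coe_finsetCard] at h2
  exact_mod_cast h2

lemma IsRM.hasFullRainbowMatching {G : ColouredMultigraph V E n} {a b : Fin n → V}
    (h : IsRM (colourGraph G) univ a b) : G.HasFullRainbowMatching := by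
  choose e he1 he2 using fun c => h.adj c (mem_univ c)
  refine ⟨Set.range e, ?_, ?_, fun c => ⟨e c, ⟨c, rfl⟩, he1 c⟩⟩
  · rintro _ ⟨c, rfl⟩ _ ⟨d, rfl⟩ hcd x hx hx'
    have hne : c ≠ d := fun h => hcd (h ▸ rfl)
    rw [he2, Sym2.mem_iff] at hx hx'
    exact hne (h.eq_of_mem (mem_univ c) (mem_univ d) hx hx')
  · rintro _ ⟨c, rfl⟩ _ ⟨d, rfl⟩ hcd
    rw [he1, he1] at hcd
    rw [hcd]

/-- With ε = 10000/(log n)^(1/4) the main case applies; its hypothesis asks only for ε of order (log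
n)^(−1/3), so there is room to spare. If m > n or ε > 2 the classes have at least 4n vertices and
the greedy choice suffices. -/
theorem hasFullRainbowMatching_of_isCliqueMultigraph [Finite V] {m : ℕ} (hn : 2 ≤ n)
    (G : ColouredMultigraph V E n)
    (hG : G.IsCliqueMultigraph
      (2 * (n : ℝ) + 2 * (m : ℝ) + 10000 * ((n : ℝ) / (Real.log (n : ℝ)) ^ (1 / 4 : ℝ))))
    (hm : G.MultiplicityAtMost m) : G.HasFullRainbowMatching := by
  have := Fintype.ofFinite V
  have hn0 : (2 : ℝ) ≤ n := by exact_mod_cast hn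
  have hlog : 0 < Real.log n := Real.log_pos (by linarith)
  obtain ⟨L, hL⟩ : ∃ L, L = Real.log n ^ (1 / 4 : ℝ) := ⟨_, rfl⟩
  have hL0 : 0 < L := hL ▸ Real.rpow_pos_of_pos hlog _
  have hL4 : L ^ 4 = Real.log n := by
    rw [hL, ← Real.rpow_natCast, ← Real.rpow_mul hlog.le]
    norm_num
  obtain ⟨ε, hε⟩ : ∃ ε, ε = 10000 / L := ⟨_, rfl⟩
  have hε0 : 0 < ε := hε ▸ by positivity
  have hT : ∀ c x y z, (colourGraph G c).Adj x y → (colourGraph G c).Adj y z → x ≠ z →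
      (colourGraph G c).Adj x z := by
    intro c x y z
    obtain ⟨P, hP, -⟩ := hG c
    exact colourGraph_trans hP
  have hsupp : ∀ c, 2 * (n : ℝ) + 2 * m + ε * n ≤
      ((#({v | ∃ w, (colourGraph G c).Adj v w} : Finset V) : ℕ) : ℝ) := by
    intro c
    obtain ⟨P, hP, hN⟩ := hG c
    refine le_trans (le_trans (le_of_eq ?_) hN) (Nat.cast_le.2 (ncard_le_card_support hP))
    rw [hε, ← hL]
    ring
  suffices h : ∃ a b, IsRM (colourGraph G) univ a b by
    obtain ⟨a, b, hab⟩ := h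
    exact hab.hasFullRainbowMatching
  by_cases hbig : n < m ∨ 2 < ε
  · have hsupp' : ∀ c, 4 * n ≤ #({v | ∃ w, (colourGraph G c).Adj v w} : Finset V) := by
      intro c
      rw [← Nat.cast_le (α := ℝ)]
      refine le_trans ?_ (hsupp c)
      push_cast
      rcases hbig with h | h
      · have : (n : ℝ) ≤ m := by exact_mod_cast h.le
        have : 0 ≤ ε * n := by positivity
        linarith
      · have : 2 * (n : ℝ) ≤ ε * n := mul_le_mul_of_nonneg_right h.le (by linarith)
        have : (0 : ℝ) ≤ m := Nat.cast_nonneg _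
        linarith
    have hV : Nonempty V := by
      have h1 := hsupp' ⟨0, by omega⟩
      obtain ⟨v, -⟩ := card_pos.1 (lt_of_lt_of_le (show 0 < 4 * n by omega) h1)
      exact ⟨v⟩
    exact exists_full_of_large hT fun c => by simpa using hsupp' c
  · push Not at hbig
    refine exists_full_of_exp_le (m := m) hT hε0 hbig.2 ?_ (fun x y _ => ?_) ?_ fun c => ?_
    · rw [Fintype.card_fin, ← Real.le_log_iff_exp_le (by linarith), ← hL4, hε,
        div_pow, div_div_eq_mul_div, div_le_iff₀ (by positivity)]
      have : 1 ≤ L := by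
        by_contra! hlt
        have : 2 < ε := by
          rw [hε, lt_div_iff₀ hL0]
          linarith
        linarith [hbig.2]
      have h3 : 0 < L ^ 3 := by positivity
      nlinarith
    · convert card_colours_le hm x y
    · simpa using hbig.1
    · simpa using hsupp c

end Multigraph

/-! ### Multigraphs given by one equivalence relation per colour. -/

section SetoidMultigraph

variable {V : Type u₁} {n : ℕ}

/-- The multigraph in which the edges of colour `c` join the distinct `s c`-equivalent vertices. -/
def setoidMultigraph (s : Fin n → Setoid V) : ColouredMultigraph V
    {p : Fin n × Sym2 V // ∃ x y, x ≠ y ∧ s p.1 x y ∧ p.2 = s(x, y)} n where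
  ends e := e.1.2
  loopless := by
    rintro ⟨p, x, y, hxy, -, h⟩
    simpa [h] using hxy
  colour e := e.1.1

lemma setoidMultigraph_adj (s : Fin n → Setoid V) (c : Fin n) (x y : V) :
    (∃ e, (setoidMultigraph s).colour e = c ∧ (setoidMultigraph s).ends e = s(x, y)) ↔
      x ≠ y ∧ s c x y := by
  constructor
  · rintro ⟨⟨⟨c', e⟩, x', y', hne, hs, he⟩, rfl, h⟩
    change e = s(x, y) at h
    change e = s(x', y') at he
    change s c' x' y' at hs
    rw [h, Sym2.eq_iff] at he
    obtain ⟨rfl, rfl⟩ | ⟨rfl, rfl⟩ := he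
    · exact ⟨hne, hs⟩
    · exact ⟨hne.symm, (s c').symm hs⟩
  · rintro ⟨hne, hs⟩
    exact ⟨⟨(c, s(x, y)), x, y, hne, hs, rfl⟩, rfl, rfl⟩

lemma setoidMultigraph_isCliqueUnion (s : Fin n → Setoid V) (c : Fin n)
    (hs : ∀ x, ∃ y, y ≠ x ∧ s c y x) :
    (setoidMultigraph s).IsCliqueUnion c (s c).classes := by
  refine ⟨?_, (Setoid.isPartition_classes _).pairwiseDisjoint, ?_, fun x y => ?_⟩
  · rintro K ⟨x, rfl⟩
    obtain ⟨y, hy, hyx⟩ := hs x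
    exact ⟨y, hyx, x, (s c).refl x, hy⟩
  · rintro ⟨⟨c₁, e₁⟩, h₁⟩ ⟨⟨c₂, e₂⟩, h₂⟩ hc₁ hc₂ he
    exact Subtype.ext (Prod.ext (hc₁.trans hc₂.symm) he)
  · rw [setoidMultigraph_adj, Setoid.rel_iff_exists_classes]

lemma setoidMultigraph_isCliqueMultigraph [Finite V] (s : Fin n → Setoid V)
    (hs : ∀ c x, ∃ y, y ≠ x ∧ s c y x) :
    (setoidMultigraph s).IsCliqueMultigraph (Nat.card V) := by
  intro c
  refine ⟨_, setoidMultigraph_isCliqueUnion s c (hs c), ?_⟩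
  rw [(Setoid.isPartition_classes (s c)).sUnion_eq_univ, Set.ncard_univ]

lemma setoidMultigraph_multiplicityAtMost (s : Fin n → Setoid V) {m : ℕ}
    (hm : ∀ x y, x ≠ y → #{c | s c x y} ≤ m) : (setoidMultigraph s).MultiplicityAtMost m := by
  intro x y
  by_cases hxy : x = y
  · have : {e | (setoidMultigraph s).ends e = s(x, y)} = ∅ := by
      rw [Set.eq_empty_iff_forall_notMem]
      intro e he
      refine (setoidMultigraph s).loopless e ?_
      rw [show (setoidMultigraph s).ends e = s(x, y) from he]
      exact Sym2.mk_isDiag_iff.2 hxy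
    rw [this]
    simp
  have hinj : Set.InjOn (setoidMultigraph s).colour
      {e | (setoidMultigraph s).ends e = s(x, y)} := by
    rintro ⟨⟨c₁, e₁⟩, h₁⟩ he₁ ⟨⟨c₂, e₂⟩, h₂⟩ he₂ hc
    exact Subtype.ext (Prod.ext hc (Eq.trans he₁ (Eq.symm he₂)))
  rw [← hinj.encard_image]
  refine (Set.encard_le_encard (t := (({c | s c x y} : Finset (Fin n)) : Set (Fin n))) ?_).trans ?_
  · rintro _ ⟨e, he, rfl⟩
    simpa using ((setoidMultigraph_adj s _ x y).1 ⟨e, rfl, he⟩).2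
  · rw [Set.encard_coe_eq_coe_finsetCard]
    exact_mod_cast hm x y hxy

/-- If equivalent vertices lie in the same one of `k` blocks of size at most `2 * b + 1`, then a
rainbow matching has at most `k * b` edges. -/
lemma setoidMultigraph_not_hasFullRainbowMatching [Fintype V] (s : Fin n → Setoid V) {k b : ℕ}
    (B : V → Fin k) (hB : ∀ c x y, s c x y → B x = B y)
    (hcard : ∀ r, #{v | B v = r} ≤ 2 * b + 1) (hkb : k * b < n) :
    ¬ (setoidMultigraph s).HasFullRainbowMatching := by
  rintro ⟨M, hM, -, hfull⟩
  choose e heM hec using hfull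
  have hxy : ∀ c, ∃ x y, x ≠ y ∧ s c x y ∧ (setoidMultigraph s).ends (e c) = s(x, y) := by
    intro c
    induction h : (setoidMultigraph s).ends (e c) with | _ x y
    obtain ⟨h1, h2⟩ := (setoidMultigraph_adj s c x y).1 ⟨e c, hec c, h⟩
    exact ⟨x, y, h1, h2, rfl⟩
  choose x y hne hs he using hxy
  have hdis : ∀ c d v, v ∈ s(x c, y c) → v ∈ s(x d, y d) → c = d := by
    intro c d v hc hd
    by_contra hcd
    have hed : e c ≠ e d := fun h => hcd (by rw [← hec c, ← hec d, h])
    exact hM _ (heM c) _ (heM d) hed v (he c ▸ hc) (he d ▸ hd)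
  have hfib : ∀ r, #{c | B (x c) = r} ≤ b := by
    intro r
    set F : Finset (Fin n) := {c | B (x c) = r} with hF
    have h1 : #(F.image x) = #F := card_image_of_injective _ fun c d h =>
      hdis c d (x c) (Sym2.mem_mk_left _ _) (h ▸ Sym2.mem_mk_left _ _)
    have h2 : #(F.image y) = #F := card_image_of_injective _ fun c d h =>
      hdis c d (y c) (Sym2.mem_mk_right _ _) (h ▸ Sym2.mem_mk_right _ _)
    have h3 : Disjoint (F.image x) (F.image y) := by
      rw [disjoint_left]
      intro v hv hv'
      obtain ⟨c, -, rfl⟩ := mem_image.1 hv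
      obtain ⟨d, -, hd⟩ := mem_image.1 hv'
      have := hdis c d (x c) (Sym2.mem_mk_left _ _) (hd ▸ Sym2.mem_mk_right _ _)
      subst this
      exact hne c hd.symm
    have h4 : F.image x ∪ F.image y ⊆ ({v | B v = r} : Finset V) := by
      intro v hv
      rw [mem_union, mem_image, mem_image] at hv
      rw [mem_filter]
      refine ⟨mem_univ _, ?_⟩
      obtain ⟨c, hc, rfl⟩ | ⟨c, hc, rfl⟩ := hv
      · exact (mem_filter.1 hc).2
      · exact (hB c _ _ (hs c)) ▸ (mem_filter.1 hc).2
    have h5 := (card_le_card h4).trans (hcard r)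
    rw [card_union_of_disjoint h3] at h5
    omega
  have h := card_eq_sum_card_fiberwise (f := fun c => B (x c)) (s := univ) (t := univ)
    (fun _ _ => mem_coe.2 (mem_univ _))
  have h' := h.trans_le (sum_le_sum fun r _ => hfib r)
  rw [card_univ, Fintype.card_fin, sum_const, card_univ, Fintype.card_fin, smul_eq_mul] at h'
  omega

end SetoidMultigraph

/-! ### The extremal construction from reflections of odd cycles. -/

section Reflections

variable {b : ℕ}

lemma eq_zero_of_two_mul_eq_zero {z : ZMod (2 * b + 1)} (h : 2 * z = 0) : z = 0 := by
  have h0 : ((2 * b + 1 : ℕ) : ZMod (2 * b + 1)) = 0 := ZMod.natCast_self _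
  push_cast at h0
  linear_combination (b + 1 : ZMod (2 * b + 1)) * h - z * h0

lemma natCast_fin_injective :
    Function.Injective fun j : Fin b => (((j : ℕ) + 1 : ℕ) : ZMod (2 * b + 1)) := by
  intro i j h
  have h' := (ZMod.natCast_eq_natCast_iff' _ _ _).1 h
  rw [Nat.mod_eq_of_lt (by omega), Nat.mod_eq_of_lt (by omega)] at h'
  exact Fin.ext (by omega)

lemma natCast_fin_ne_zero (j : Fin b) : (((j : ℕ) + 1 : ℕ) : ZMod (2 * b + 1)) ≠ 0 := by
  intro h
  have := Nat.le_of_dvd (by omega) ((ZMod.natCast_eq_zero_iff _ _).1 h)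
  omega

/-- The triangle formed by `p.1` and two points at distance `p.2 + 1` from it. -/
def tri (p : ZMod (2 * b + 1) × Fin b) : Set (ZMod (2 * b + 1)) :=
  {x | x = p.1 ∨ x = p.1 + ((p.2 : ℕ) + 1 : ℕ) ∨ x = p.1 - ((p.2 : ℕ) + 1 : ℕ)}

/-- The reflection preserves the triangle; this makes the relation generated by both transitive as
it stands. -/
lemma mem_tri_of_add_eq {p : ZMod (2 * b + 1) × Fin b} {x y : ZMod (2 * b + 1)}
    (h : x + y = 2 * p.1) (hx : x ∈ tri p) : y ∈ tri p := by
  obtain hx | hx | hx := hx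
  · exact Or.inl (by linear_combination h - hx)
  · exact Or.inr (Or.inr (by linear_combination h - hx))
  · exact Or.inr (Or.inl (by linear_combination h - hx))

/-- In each of `k` cyclic blocks, identify the points exchanged by the reflection in `p.1`, and the
points of the triangle `tri p`. -/
def reflectionSetoid (k : ℕ) (p : ZMod (2 * b + 1) × Fin b) :
    Setoid (Fin k × ZMod (2 * b + 1)) where
  r u v := u.1 = v.1 ∧ (u.2 = v.2 ∨ u.2 + v.2 = 2 * p.1 ∨ (u.2 ∈ tri p ∧ v.2 ∈ tri p))
  iseqv := by
    refine ⟨fun u => ⟨rfl, Or.inl rfl⟩, fun {u v} h => ⟨h.1.symm, ?_⟩, fun {u v w} h h' =>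
      ⟨h.1.trans h'.1, ?_⟩⟩
    · obtain ⟨-, h | h | h⟩ := h
      · exact Or.inl h.symm
      · exact Or.inr (Or.inl (by linear_combination h))
      · exact Or.inr (Or.inr h.symm)
    · obtain ⟨-, h | h | h⟩ := h
      · rw [h]
        exact h'.2
      · obtain ⟨-, h' | h' | h'⟩ := h'
        · exact Or.inr (Or.inl (h' ▸ h))
        · exact Or.inl (by linear_combination h - h')
        · exact Or.inr (Or.inr ⟨mem_tri_of_add_eq (by linear_combination h) h'.1, h'.2⟩)
      · obtain ⟨-, h' | h' | h'⟩ := h'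
        · exact Or.inr (Or.inr ⟨h.1, h' ▸ h.2⟩)
        · exact Or.inr (Or.inr ⟨h.1, mem_tri_of_add_eq h' h.2⟩)
        · exact Or.inr (Or.inr ⟨h.1, h'.2⟩)

lemma reflectionSetoid_nontrivial {k : ℕ} (p : ZMod (2 * b + 1) × Fin b)
    (u : Fin k × ZMod (2 * b + 1)) : ∃ v, v ≠ u ∧ reflectionSetoid k p v u := by
  by_cases h : u.2 = p.1
  · refine ⟨(u.1, p.1 + ((p.2 : ℕ) + 1 : ℕ)), fun h' => natCast_fin_ne_zero p.2 ?_, rfl,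
      Or.inr (Or.inr ⟨Or.inr (Or.inl rfl), Or.inl h⟩)⟩
    have h2 : p.1 + (((p.2 : ℕ) + 1 : ℕ) : ZMod (2 * b + 1)) = u.2 := congrArg Prod.snd h'
    linear_combination h2 + h
  · refine ⟨(u.1, 2 * p.1 - u.2), fun h' => h ?_, rfl, Or.inr (Or.inl (sub_add_cancel _ _))⟩
    have h2 : 2 * p.1 - u.2 = u.2 := congrArg Prod.snd h'
    exact (sub_eq_zero.1 (eq_zero_of_two_mul_eq_zero
      (show 2 * (p.1 - u.2) = 0 by linear_combination h2))).symm

/-- If x + y = 2 `p.1`, the centre is determined and b values of `p.2` remain; this includes the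
triangle side opposite the centre. Otherwise x or y is the centre, and the choice of centre and of
sign determines `p.2`, which gives four more. Varying `p.2` is what keeps this contribution bounded.
-/
lemma card_reflectionSetoid_le {k : ℕ} {u v : Fin k × ZMod (2 * b + 1)} (huv : u ≠ v) :
    #{p : ZMod (2 * b + 1) × Fin b | reflectionSetoid k p u v} ≤ b + 4 := by
  by_cases h1 : u.1 = v.1
  swap
  · rw [card_eq_zero.2]
    · omega
    · exact filter_eq_empty_iff.2 fun p _ h => h1 h.1
  have hne : u.2 ≠ v.2 := fun h => huv (Prod.ext h1 h)
  obtain ⟨x, hx⟩ : ∃ x, x = u.2 := ⟨_, rfl⟩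
  obtain ⟨y, hy⟩ : ∃ y, y = v.2 := ⟨_, rfl⟩
  rw [← hx, ← hy] at hne
  set j : Fin b → ZMod (2 * b + 1) := fun i => ((i : ℕ) + 1 : ℕ) with hj
  let A₀ : Finset (ZMod (2 * b + 1) × Fin b) := {p | x + y = 2 * p.1}
  let A₁ (x y) : Finset (ZMod (2 * b + 1) × Fin b) := {p | x = p.1 ∧ y = p.1 + j p.2}
  let A₂ (x y) : Finset (ZMod (2 * b + 1) × Fin b) := {p | x = p.1 ∧ y = p.1 - j p.2}
  have hsub : ({p | reflectionSetoid k p u v} : Finset (ZMod (2 * b + 1) × Fin b)) ⊆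
      A₀ ∪ (A₁ x y ∪ (A₂ x y ∪ (A₁ y x ∪ A₂ y x))) := by
    intro p hp
    obtain ⟨-, h | h | ⟨h, h'⟩⟩ := (mem_filter.1 hp).2
    · exact absurd (hx.trans (h.trans hy.symm)) hne
    · simp [A₀, hx, hy, h]
    · rw [← hx] at h
      rw [← hy] at h'
      simp only [A₀, A₁, A₂, mem_union, mem_filter, mem_univ, true_and]
      obtain h | h | h := h <;> obtain h' | h' | h' := h'
      · exact absurd (h.trans h'.symm) hne
      · exact Or.inr (Or.inl ⟨h, h'⟩)
      · exact Or.inr (Or.inr (Or.inl ⟨h, h'⟩))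
      · exact Or.inr (Or.inr (Or.inr (Or.inl ⟨h', h⟩)))
      · exact absurd (h.trans h'.symm) hne
      · exact Or.inl (by linear_combination h + h')
      · exact Or.inr (Or.inr (Or.inr (Or.inr ⟨h', h⟩)))
      · exact Or.inl (by linear_combination h + h')
      · exact absurd (h.trans h'.symm) hne
  have hb : #A₀ ≤ b := by
    have := card_le_card_of_injOn (s := {p : ZMod (2 * b + 1) × Fin b | x + y = 2 * p.1})
      (t := (univ : Finset (Fin b))) Prod.snd (fun _ _ => mem_coe.2 (mem_univ _)) (by
        intro p hp p' hp' h
        have hp := (mem_filter.1 (mem_coe.1 hp)).2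
        have hp' := (mem_filter.1 (mem_coe.1 hp')).2
        refine Prod.ext (sub_eq_zero.1 (eq_zero_of_two_mul_eq_zero ?_)) h
        linear_combination hp' - hp)
    simpa using this
  have hadd : ∀ x y, #(A₁ x y) ≤ 1 := by
    intro x y
    rw [card_le_one]
    intro p hp p' hp'
    obtain ⟨h1, h2⟩ := (mem_filter.1 hp).2
    obtain ⟨h3, h4⟩ := (mem_filter.1 hp').2
    exact Prod.ext (h1.symm.trans h3)
      (natCast_fin_injective (show j p.2 = j p'.2 by linear_combination h4 - h2 + h1 - h3))
  have hsub' : ∀ x y, #(A₂ x y) ≤ 1 := by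
    intro x y
    rw [card_le_one]
    intro p hp p' hp'
    obtain ⟨h1, h2⟩ := (mem_filter.1 hp).2
    obtain ⟨h3, h4⟩ := (mem_filter.1 hp').2
    exact Prod.ext (h1.symm.trans h3)
      (natCast_fin_injective (show j p.2 = j p'.2 by linear_combination h2 - h4 + h3 - h1))
  refine (card_le_card hsub).trans ?_
  have := card_union_le A₀ (A₁ x y ∪ (A₂ x y ∪ (A₁ y x ∪ A₂ y x)))
  have := card_union_le (A₁ x y) (A₂ x y ∪ (A₁ y x ∪ A₂ y x))
  have := card_union_le (A₂ x y) (A₁ y x ∪ A₂ y x)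
  have := card_union_le (A₁ y x) (A₂ y x)
  have := hadd x y
  have := hadd y x
  have := hsub' x y
  have := hsub' y x
  omega

/-- Assign the elements of `α` to the colours periodically. -/
lemma exists_periodic (α : Type*) [Fintype α] [Nonempty α] (n : ℕ) :
    ∃ φ : Fin n → α, ∀ T : Finset α, #{c | φ c ∈ T} ≤ #T * (n / Fintype.card α + 1) := by
  have h0 : 0 < Fintype.card α := Fintype.card_pos
  let e := Fintype.equivFin α
  refine ⟨fun c => e.symm ⟨c % Fintype.card α, Nat.mod_lt _ h0⟩, fun T => ?_⟩
  rw [← card_range (n / Fintype.card α + 1), ← card_product]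
  refine card_le_card_of_injOn
    (fun c => (e.symm ⟨c % Fintype.card α, Nat.mod_lt _ h0⟩, (c : ℕ) / Fintype.card α)) ?_ ?_
  · intro c hc
    have hc := (mem_filter.1 (mem_coe.1 hc)).2
    refine mem_coe.2 (mem_product.2 ⟨hc, mem_range.2 ?_⟩)
    exact Nat.lt_succ_of_le (Nat.div_le_div_right c.2.le)
  · intro c _ d _ h
    have h1 := congrArg Fin.val (e.symm.injective (congrArg Prod.fst h))
    have h2 : (c : ℕ) / Fintype.card α = d / Fintype.card α := congrArg Prod.snd h
    simp only at h1
    apply Fin.ext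
    rw [← Nat.div_add_mod c (Fintype.card α), ← Nat.div_add_mod d (Fintype.card α), h1, h2]

/-- The n colours run periodically through the (2b + 1)b pairs of a centre and a triangle; every
class covers all k(2b + 1) vertices. -/
theorem exists_multigraph_without_full {n k b : ℕ} (hb : 0 < b) (hkb : k * b < n) :
    ∃ (V E : Type) (_ : Finite V) (G : ColouredMultigraph V E n),
      G.IsCliqueMultigraph ((k * (2 * b + 1) : ℕ) : ℝ) ∧
      G.MultiplicityAtMost ((b + 4) * (n / ((2 * b + 1) * b) + 1)) ∧
      ¬ G.HasFullRainbowMatching := by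
  have : Nonempty (Fin b) := ⟨⟨0, hb⟩⟩
  obtain ⟨φ, hφ⟩ := exists_periodic (ZMod (2 * b + 1) × Fin b) n
  refine ⟨Fin k × ZMod (2 * b + 1), _, inferInstance,
    setoidMultigraph fun c => reflectionSetoid k (φ c), ?_, ?_, ?_⟩
  · have h := setoidMultigraph_isCliqueMultigraph (fun c => reflectionSetoid k (φ c))
      fun c x => reflectionSetoid_nontrivial (φ c) x
    rwa [Nat.card_prod, Nat.card_fin, Nat.card_zmod] at h
  · refine setoidMultigraph_multiplicityAtMost _ fun x y hxy => ?_
    have h := hφ {p | reflectionSetoid k p x y}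
    rw [Fintype.card_prod, ZMod.card, Fintype.card_fin] at h
    simp only [mem_filter, mem_univ, true_and] at h
    exact h.trans (Nat.mul_le_mul_right _ (card_reflectionSetoid_le hxy))
  · refine setoidMultigraph_not_hasFullRainbowMatching _ (b := b) Prod.fst
      (fun c x y h => h.1) (fun r => ?_) hkb
    have := card_le_card_of_injOn (s := {v : Fin k × ZMod (2 * b + 1) | v.1 = r})
      (t := (univ : Finset (ZMod (2 * b + 1)))) Prod.snd (fun _ _ => mem_coe.2 (mem_univ _)) (by
        intro p hp p' hp' h
        exact Prod.ext (((mem_filter.1 (mem_coe.1 hp)).2).trans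
          ((mem_filter.1 (mem_coe.1 hp')).2).symm) h)
    rwa [card_univ, ZMod.card] at this

lemma multiplicityAtMost_mono {V : Type u₁} {E : Type v₁} {n m m' : ℕ}
    {G : ColouredMultigraph V E n} (h : G.MultiplicityAtMost m) (hm : m ≤ m') :
    G.MultiplicityAtMost m' :=
  fun x y => (h x y).trans (by exact_mod_cast hm)

lemma isCliqueMultigraph_mono {V : Type u₁} {E : Type v₁} {n : ℕ} {N N' : ℝ}
    {G : ColouredMultigraph V E n} (h : G.IsCliqueMultigraph N) (hN : N' ≤ N) :
    G.IsCliqueMultigraph N' := by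
  intro c
  obtain ⟨P, hP, hc⟩ := h c
  exact ⟨P, hP, hN.trans hc⟩

theorem exists_multigraph_without_full_of_le {ε : ℝ} (hε0 : 0 < ε) (hε : ε ≤ 1 / 100) {n : ℕ}
    (hn : 100 * (1 / ε) ^ 3 ≤ n) :
    ∃ (V E : Type) (_ : Finite V) (G : ColouredMultigraph V E n),
      G.IsCliqueMultigraph (2 * (n : ℝ) + 2 * (ε * (n : ℝ)) - 100 * ε ^ 2 * (n : ℝ)) ∧
      G.MultiplicityAtMost ⌊ε * (n : ℝ)⌋₊ ∧ ¬ G.HasFullRainbowMatching := by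
  obtain ⟨x, hx⟩ : ∃ x, x = 1 / ε := ⟨_, rfl⟩
  have hεx : ε * x = 1 := by
    rw [hx]
    exact mul_one_div_cancel hε0.ne'
  have hx0 : 100 ≤ x := by
    rw [hx, le_div_iff₀ hε0]
    linarith
  rw [← hx] at hn
  have hn0 : (0 : ℝ) < n := lt_of_lt_of_le (by positivity) hn
  -- The main term is 1/(2ε). The summand 6 makes ε(2b + 1)b ≥ b + 6: of this b + 4 counts colour
  -- types per pair, and 2 covers rounding in the periodic assignment.
  obtain ⟨b, hb⟩ : ∃ b, b = ⌈x / 2 + 6⌉₊ := ⟨_, rfl⟩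
  have hb1 : x / 2 + 6 ≤ b := hb ▸ Nat.le_ceil _
  have hb2 : (b : ℝ) ≤ x / 2 + 7 := by
    have := Nat.ceil_lt_add_one (show 0 ≤ x / 2 + 6 by positivity)
    rw [← hb] at this
    linarith
  have hb0 : 0 < b := by
    rw [← Nat.cast_pos (α := ℝ)]
    linarith
  have hb0' : (0 : ℝ) < b := Nat.cast_pos.2 hb0
  -- The largest k with kb < n.
  obtain ⟨k, hk⟩ : ∃ k, k = (n - 1) / b := ⟨_, rfl⟩
  have hn1 : 0 < n := Nat.cast_pos.1 hn0
  have hkb : k * b < n := by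
    have : k * b ≤ n - 1 := hk ▸ Nat.div_mul_le_self _ _
    omega
  have hk1 : (n : ℝ) ≤ k * b + b := by
    have h : n - 1 < b * ((n - 1) / b + 1) := Nat.lt_mul_div_succ _ hb0
    have h' : n ≤ k * b + b := by
      rw [← hk] at h
      have : b * (k + 1) = k * b + b := by ring
      omega
    exact_mod_cast h'
  obtain ⟨V, E, hV, G, h1, h2, h3⟩ := exists_multigraph_without_full hb0 hkb
  refine ⟨V, E, hV, G, isCliqueMultigraph_mono h1 ?_,
    multiplicityAtMost_mono h2 (Nat.le_floor ?_), h3⟩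
  · push_cast
    have h4 : 2 * ε * n - 99 * ε ^ 2 * n ≤ k + 1 := by
      have h5 : (2 * ε - 99 * ε ^ 2) * b ≤ 1 := by
        have h6 : 0 ≤ 2 * ε - 99 * ε ^ 2 := by nlinarith
        have h7 := mul_le_mul_of_nonneg_left hb2 h6
        have h8 : (2 * ε - 99 * ε ^ 2) * (x / 2 + 7) =
            1 + ε * (14 - 99 / 2 - 693 * ε) + (ε * x - 1) * (1 - 99 / 2 * ε) := by ring
        rw [h8, hεx] at h7
        nlinarith
      have h9 : (n : ℝ) ≤ (k + 1) * b := by linarith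
      have h10 : (2 * ε - 99 * ε ^ 2) * n * b ≤ (k + 1) * b := by nlinarith
      have := le_of_mul_le_mul_right h10 hb0'
      linarith
    -- Rounding k loses 2b + 1 vertices, which the last of the 100 units of ε²n pays for.
    have h5 : 2 * (b : ℝ) + 1 ≤ ε ^ 2 * n := by
      have h6 : ε ^ 2 * (100 * x ^ 3) ≤ ε ^ 2 * n := mul_le_mul_of_nonneg_left hn (sq_nonneg _)
      have h7 : ε ^ 2 * (100 * x ^ 3) = 100 * x * (ε * x) ^ 2 := by ring
      rw [h7, hεx] at h6
      linarith
    linarith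
  · push_cast
    have h4 : ((n / ((2 * b + 1) * b) : ℕ) : ℝ) ≤ n / ((2 * b + 1) * b) := by
      exact_mod_cast Nat.cast_div_le (α := ℝ) (m := n) (n := (2 * b + 1) * b)
    refine (mul_le_mul_of_nonneg_left (add_le_add_left h4 1) (by positivity)).trans ?_
    have h5 : (b : ℝ) + 6 ≤ ε * ((2 * b + 1) * b) := by
      have h6 : 1 / 2 + 6 * ε ≤ ε * b := by
        have := mul_le_mul_of_nonneg_left hb1 hε0.le
        linarith
      have h7 : ε * ((2 * b + 1) * b) = (2 * b + 1) * (ε * b) := by ring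
      have h8 : (2 * (b : ℝ) + 1) * (1 / 2 + 6 * ε) ≤ (2 * b + 1) * (ε * b) :=
        mul_le_mul_of_nonneg_left h6 (by positivity)
      linarith
    have hD : (0 : ℝ) < (2 * b + 1) * b := by positivity
    have h6 : (b + 4 : ℝ) * ((2 * b + 1) * b) ≤ 2 * n := by
      have e1 : (b + 4 : ℝ) ≤ x := by linarith
      have e2 : (2 * b + 1 : ℝ) ≤ 2 * x := by linarith
      have e3 : (b : ℝ) ≤ x := by linarith
      have e4 : (2 * b + 1 : ℝ) * b ≤ 2 * x * x := mul_le_mul e2 e3 hb0'.le (by linarith)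
      have e5 : (b + 4 : ℝ) * ((2 * b + 1) * b) ≤ x * (2 * x * x) :=
        mul_le_mul e1 e4 hD.le (by linarith)
      have e6 : x * (2 * x * x) = 2 * x ^ 3 := by ring
      have e7 : 0 ≤ x ^ 3 := by positivity
      linarith
    refine le_of_mul_le_mul_right ?_ hD
    have h7 : ((b : ℝ) + 4) * (n / ((2 * b + 1) * b) + 1) * ((2 * b + 1) * b) =
        (b + 4) * n + (b + 4) * ((2 * b + 1) * b) := by
      field_simp
    have h8 := mul_le_mul_of_nonneg_right h5 hn0.le
    rw [h7]
    linarith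

end Reflections

end RainbowClique

theorem theorem1p4 :
    (∃ C : ℝ, 0 < C ∧
      ∀ (n m : ℕ), 2 ≤ n →
      ∀ (V : Type u) (E : Type v) [Finite V] (G : ColouredMultigraph V E n),
        G.IsCliqueMultigraph
          (2 * (n : ℝ) + 2 * (m : ℝ) + C * ((n : ℝ) / (Real.log (n : ℝ)) ^ (1 / 4 : ℝ))) →
        G.MultiplicityAtMost m →
        G.HasFullRainbowMatching) ∧
    (∃ C ε₀ : ℝ, 0 < C ∧ 0 < ε₀ ∧
      ∀ ε : ℝ, 0 < ε → ε ≤ ε₀ →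
      ∀ n : ℕ, C * (1 / ε) ^ 3 * Real.log (1 / ε) ≤ (n : ℝ) →
      ∃ (V : Type) (E : Type) (_ : Finite V) (G : ColouredMultigraph V E n),
        G.IsCliqueMultigraph (2 * (n : ℝ) + 2 * (ε * (n : ℝ)) - C * ε ^ 2 * (n : ℝ)) ∧
        G.MultiplicityAtMost ⌊ε * (n : ℝ)⌋₊ ∧
        ¬ G.HasFullRainbowMatching) := by
  refine ⟨⟨10000, by norm_num, fun n m hn V E _ G hG hm =>
    RainbowClique.hasFullRainbowMatching_of_isCliqueMultigraph hn G hG hm⟩,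
    100, 1 / 100, by norm_num, by norm_num, fun ε hε0 hε n hn =>
      RainbowClique.exists_multigraph_without_full_of_le hε0 hε (le_trans ?_ hn)⟩
  -- The construction needs only n ≥ 100 ε⁻³; the logarithm is at least 1 and is dropped.
  refine le_mul_of_one_le_right (by positivity) ?_
  rw [Real.le_log_iff_exp_le (by positivity)]
  have h1 := Real.exp_one_lt_d9
  have h2 : 100 ≤ 1 / ε := by
    rw [le_div_iff₀ hε0]
    linarith
  linarith
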